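/- Identify $\mathbb{S}^2$ with $\mathbb{C}\cup\{\infty\}$ and equip it with the spherical (great-circle) metric. A domain is a nonempty connected open subset $\Omega\subset\mathbb{S}^2$; $\mathcal{C}(\Omega)$ denotes the set of connected components of $\mathbb{S}^2\setminus\Omega$, $\mathcal{C}_N(\Omega)$ the set of those with positive diameter (non-trivial components), and $\mathcal{C}_P(\Omega)=\mathcal{C}(\Omega)\setminus\mathcal{C}_N(\Omega)$ the set of point-components. A circle domain is a domain $D\subset\mathbb{S}^2$ such that every $q\in\mathcal{C}_N(D)$ is a closed disk. Let $\hat\Omega$ be the quotient of $\mathbb{S}^2$, with the quotient topology, in which each $p\in\mathcal{C}(\Omega)$ is collapsed to a point. Every homeomorphism $f\colon\Omega\to D$ between domains extends to a homeomorphism $\hat f\colon\hat\Omega\to\hat D$, and elements of $\mathcal{C}(\Omega)$ and $\mathcal{C}(D)$ are identified with points of $\hat\Omega$ and $\hat D$. **Theorem.** For every $\alpha>0$ there is a domain $\Omega_\alpha\subset\mathbb{S}^2$ such that $\mathcal{C}(\Omega_\alpha)$ is countable, $\sum_{p\in\mathcal{C}(\Omega_\alpha)}\operatorname{diam}(p)^\alpha<\infty$,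 and $\{0\}\in\mathcal{C}_P(\Omega_\alpha)$, but $\hat f(\{0\})\in\mathcal{C}_N(D)$ for every conformal homeomorphism $f\colon\Omega_\alpha\to D$ onto a circle domain $D\subset\mathbb{S}^2$. -/

import Mathlib

open scoped OnePoint

/-- The Riemann sphere `ℂ ∪ {∞}`, as the one-point compactification of `ℂ`. -/
abbrev RiemannSphere : Type := OnePoint ℂ

namespace RiemannSphere

noncomputable section

/-! ### The spherical metric -/

/-- Half the length of the chord in `ℝ³` between the points of the unit sphere that correspond to
two points of `ℂ ∪ {∞}` under stereographic projection. -/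
def halfChord : RiemannSphere → RiemannSphere → ℝ
  | OnePoint.some z, OnePoint.some w => ‖z - w‖ / (√(1 + ‖z‖ ^ 2) * √(1 + ‖w‖ ^ 2))
  | OnePoint.some z, ∞ => 1 / √(1 + ‖z‖ ^ 2)
  | ∞, OnePoint.some w => 1 / √(1 + ‖w‖ ^ 2)
  | ∞, ∞ => 0

/-- The spherical (great-circle) distance on the unit sphere; it takes values in `[0, π]`. -/
def sphDist (x y : RiemannSphere) : ℝ :=
  2 * Real.arcsin (halfChord x y)

/-- The diameter of a subset of the sphere with respect to the spherical metric. -/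
def sphDiam (A : Set RiemannSphere) : ℝ :=
  sSup {d : ℝ | ∃ x ∈ A, ∃ y ∈ A, d = sphDist x y}

/-- A (nondegenerate, closed) disk of the sphere: a closed ball of positive radius with respect to
the spherical metric. -/
def IsDisk (A : Set RiemannSphere) : Prop :=
  ∃ (c : RiemannSphere) (r : ℝ), 0 < r ∧ A = {x | sphDist x c ≤ r}

/-! ### Domains and their complementary components -/

/-- A domain: a nonempty connected open subset of the sphere. -/
def IsSphereDomain (Ω : Set RiemannSphere) : Prop :=
  IsOpen Ω ∧ IsConnected Ω

/-- `𝒞(Ω)`: the connected components of the complement of `Ω`. -/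
def complComponents (Ω : Set RiemannSphere) : Set (Set RiemannSphere) :=
  {p | ∃ x ∈ Ωᶜ, p = connectedComponentIn Ωᶜ x}

/-- `𝒞_N(Ω)`: the non-trivial complementary components. -/
def nontrivialComponents (Ω : Set RiemannSphere) : Set (Set RiemannSphere) :=
  {p | p ∈ complComponents Ω ∧ 0 < sphDiam p}

/-- `𝒞_P(Ω)`: the point-components. -/
def pointComponents (Ω : Set RiemannSphere) : Set (Set RiemannSphere) :=
  {p | p ∈ complComponents Ω ∧ ¬ 0 < sphDiam p}

/-- `ℓ^α`-domains: countably connected domains (countably many complementary components) for which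
the sum of `diam(p)^α` over all complementary components `p` is finite. -/
def IsEllDomain (α : ℝ) (Ω : Set RiemannSphere) : Prop :=
  IsSphereDomain Ω ∧ (complComponents Ω).Countable ∧
    Summable fun p : complComponents Ω => sphDiam (p : Set RiemannSphere) ^ α

/-- Circle domains: domains all of whose non-trivial complementary components are disks. -/
def IsCircleDomain (D : Set RiemannSphere) : Prop :=
  IsSphereDomain D ∧ ∀ p ∈ nontrivialComponents D, IsDisk p

/-! ### The decomposition space of a domain -/

/-- Two points are identified if they are equal or lie in a common complementary component. -/
def decompositionSetoid (Ω : Set RiemannSphere) : Setoid RiemannSphere where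
  r z w := z = w ∨ ∃ p ∈ complComponents Ω, z ∈ p ∧ w ∈ p
  iseqv :=
    { refl := fun _ => Or.inl rfl
      symm := by
        rintro z w (rfl | ⟨p, hp, hz, hw⟩)
        · exact Or.inl rfl
        · exact Or.inr ⟨p, hp, hw, hz⟩
      trans := by
        rintro z w v (rfl | ⟨p, ⟨x, hx, rfl⟩, hz, hw⟩) h
        · exact h
        · rcases h with rfl | ⟨q, ⟨y, hy, rfl⟩, hw', hv⟩
          · exact Or.inr ⟨_, ⟨x, hx, rfl⟩, hz, hw⟩
          · refine Or.inr ⟨_, ⟨x, hx, rfl⟩, hz, ?_⟩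
            rw [connectedComponentIn_eq hw, ← connectedComponentIn_eq hw']
            exact hv }

/-- The decomposition space `Ω̂`, in which every complementary component of `Ω` is collapsed to a
point, with the quotient topology. -/
abbrev DecompositionSpace (Ω : Set RiemannSphere) : Type :=
  Quotient (decompositionSetoid Ω)

/-- The quotient map `π_Ω` from the sphere onto the decomposition space. -/
def quotMap (Ω : Set RiemannSphere) (z : RiemannSphere) : DecompositionSpace Ω :=
  Quotient.mk (decompositionSetoid Ω) z

/-! ### Conformal homeomorphisms and their extensions -/

/-- The inverse of the standard holomorphic chart around `x`: the inclusion of `ℂ` if `x ≠ ∞`, and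
`ζ ↦ 1/ζ` (with `0 ↦ ∞`) if `x = ∞`. -/
def param : RiemannSphere → ℂ → RiemannSphere
  | OnePoint.some _, ζ => (ζ : RiemannSphere)
  | ∞, ζ => open Classical in if ζ = 0 then ∞ else ((ζ⁻¹ : ℂ) : RiemannSphere)

/-- The standard holomorphic chart around `x`: the identity of `ℂ` if `x ≠ ∞`, and `w ↦ 1/w` (with
`∞ ↦ 0`) if `x = ∞`. The value at the one point of the sphere outside the domain of the chart is
irrelevant. -/
def coord : RiemannSphere → RiemannSphere → ℂ
  | OnePoint.some _, OnePoint.some w => w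
  | OnePoint.some _, ∞ => 0
  | ∞, OnePoint.some w => w⁻¹
  | ∞, ∞ => 0

/-- `f` is complex differentiable at `x`, in the standard charts around `x` and `f x`. -/
def ComplexDifferentiableAt (f : RiemannSphere → RiemannSphere) (x : RiemannSphere) : Prop :=
  DifferentiableAt ℂ (fun ζ => coord (f x) (f (param x ζ))) (coord x x)

/-- `f` is a conformal homeomorphism of `Ω` onto `D`: a homeomorphism (between open sets) that is
holomorphic on `Ω`. The values of `f` outside `Ω` are irrelevant. -/
def IsConformalHomeo (f : OpenPartialHomeomorph RiemannSphere RiemannSphere)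
    (Ω D : Set RiemannSphere) : Prop :=
  f.source = Ω ∧ f.target = D ∧ ∀ x ∈ Ω, ComplexDifferentiableAt f x

/-- `F` is an extension `f̂ : Ω̂ → D̂` of `f : Ω → D` to a homeomorphism of the decomposition
spaces. -/
def IsHatExtension {Ω D : Set RiemannSphere} (f : RiemannSphere → RiemannSphere)
    (F : DecompositionSpace Ω ≃ₜ DecompositionSpace D) : Prop :=
  ∀ z ∈ Ω, F (quotMap Ω z) = quotMap D (f z)

/-- The subset `π_D⁻¹(F(π_Ω(p)))` of the sphere: the image of `p` under `F`, when complementary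
components are identified with points of the decomposition spaces. -/
def hatImage {Ω D : Set RiemannSphere} (F : DecompositionSpace Ω ≃ₜ DecompositionSpace D)
    (p : Set RiemannSphere) : Set RiemannSphere :=
  quotMap D ⁻¹' (F '' (quotMap Ω '' p))

end

end RiemannSphere

namespace RiemannSphere

open Filter Set Topology

/-! ### The spherical metric and the inversion -/

/-! In logarithmic coordinates the complement of the domain is a binary tree of horizontal segments.
Level `n` has `2 ^ n` of them, each of length `L + 1` and shifted to the left by `L` from the level
above, so that every segment runs above or below its parent for a stretch of length one. The
exponential function turns them into radial slits that accumulate only at `0`. Level `n` contributes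
at most a constant times `2 ^ n * exp (-α * L * n)` to the sum of the `α`-th powers of the
diameters, which is summable once `L` is large compared with `1 / α`; the combinatorics of the tree
do not depend on `L`.

The point `0` has to blow up because the binary tree is transient. Suppose that its image is a
single point `w₀`. The images of the slits are pairwise disjoint disks or points, and they shrink
towards `w₀`. Averaging bump functions over many well separated scales gives a function that is `1`
near `w₀`, vanishes on the image of the root slit, and has arbitrarily small Dirichlet energy. Since
disks are fat, the sum of its squared oscillations over the images of the slits is arbitrarily small
too (`exists_cutoff`, `sum_min_sq_le`).

Composition with the conformal map does not increase the energy (`lintegral_energy_comp_le`).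
Between a slit and its parent lies a rectangle of width one and height at most one, and its energy
bounds the squared difference of the boundary values on the two slits
(`ofReal_sq_le_lintegral_rectangle`). One value per slit therefore defines a function on the tree
that is `0` at the root, `1` on a whole deep level, and has a small sum of squared differences along
the edges of each level (`sum_sq_sub_le`). The averages over successive levels then change by at
most a small geometric sequence, so they cannot climb from `0` to `1`
(`exists_ne_one_of_small_energy`). The contradiction is put together in `false_of_round_images` and
`hatFiber_ne_singleton`.

That conformal maps extend to the decomposition spaces is proved separately
(`exists_isHatExtension`). Connected neighbourhoods of the complementary components give limits in
the decomposition space, and winding numbers keep different components apart (`not_same_component`).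
-/

lemma halfChord_nonneg (x y : RiemannSphere) : 0 ≤ halfChord x y := by
  induction x using OnePoint.rec <;> induction y using OnePoint.rec <;>
    simp only [halfChord] <;> positivity

lemma eq_of_halfChord_eq_zero {x y : RiemannSphere} (h : halfChord x y = 0) : x = y := by
  induction x using OnePoint.rec with
  | infty =>
    induction y using OnePoint.rec with
    | infty => rfl
    | coe w =>
      have : 0 < 1 / √(1 + ‖w‖ ^ 2) := by positivity
      exact absurd h this.ne'
  | coe z =>
    induction y using OnePoint.rec with
    | infty =>
      have : 0 < 1 / √(1 + ‖z‖ ^ 2) := by positivity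
      exact absurd h this.ne'
    | coe w =>
      have h' : ‖z - w‖ / (√(1 + ‖z‖ ^ 2) * √(1 + ‖w‖ ^ 2)) = 0 := h
      have hp : (√(1 + ‖z‖ ^ 2) * √(1 + ‖w‖ ^ 2)) ≠ 0 := by positivity
      rw [div_eq_zero_iff, or_iff_left hp, norm_eq_zero, sub_eq_zero] at h'
      rw [h']

lemma halfChord_coe_le (z w : ℂ) : halfChord z w ≤ ‖z - w‖ := by
  have h1 : 1 ≤ √(1 + ‖z‖ ^ 2) := Real.one_le_sqrt.2 (by nlinarith [sq_nonneg ‖z‖])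
  have h2 : 1 ≤ √(1 + ‖w‖ ^ 2) := Real.one_le_sqrt.2 (by nlinarith [sq_nonneg ‖w‖])
  exact div_le_self (norm_nonneg _) (one_le_mul_of_one_le_of_one_le h1 h2)

lemma sphDist_nonneg (x y : RiemannSphere) : 0 ≤ sphDist x y :=
  mul_nonneg zero_le_two (Real.arcsin_nonneg.2 (halfChord_nonneg x y))

lemma sphDist_le_pi (x y : RiemannSphere) : sphDist x y ≤ Real.pi := by
  have := Real.arcsin_le_pi_div_two (halfChord x y)
  unfold sphDist
  linarith

lemma eq_of_sphDist_le_zero {x y : RiemannSphere} (h : sphDist x y ≤ 0) : x = y := by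
  have h1 : Real.arcsin (halfChord x y) ≤ 0 := by unfold sphDist at h; linarith
  exact eq_of_halfChord_eq_zero
    (le_antisymm (Real.arcsin_nonpos.1 h1) (halfChord_nonneg x y))

lemma sphDist_self (x : RiemannSphere) : sphDist x x = 0 := by
  induction x using OnePoint.rec <;> simp [sphDist, halfChord]

/-- Jordan's inequality for the sine, with `π ≤ 4`. Only some linear bound is needed, to compare
spherical with Euclidean diameters. -/
lemma arcsin_le_two_mul {x : ℝ} (hx : 0 ≤ x) : Real.arcsin x ≤ 2 * x := by
  rcases le_total x 1 with h1 | h1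
  · have h := Real.mul_le_sin (Real.arcsin_nonneg.2 hx) (Real.arcsin_le_pi_div_two x)
    rw [Real.sin_arcsin (by linarith) h1] at h
    have hpi := Real.pi_le_four
    have hpos := Real.pi_pos
    have h2 : Real.arcsin x = Real.pi / 2 * (2 / Real.pi * Real.arcsin x) := by field_simp
    rw [h2]
    nlinarith
  · have := Real.arcsin_le_pi_div_two x
    have hpi := Real.pi_le_four
    linarith

lemma sphDist_coe_le (z w : ℂ) : sphDist z w ≤ 4 * ‖z - w‖ := by
  have h1 := arcsin_le_two_mul (halfChord_nonneg z w)
  have h2 := halfChord_coe_le z w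
  unfold sphDist
  linarith

lemma sphDist_le_sphDiam {A : Set RiemannSphere} {x y : RiemannSphere} (hx : x ∈ A) (hy : y ∈ A) :
    sphDist x y ≤ sphDiam A := by
  refine le_csSup ⟨Real.pi, ?_⟩ ⟨x, hx, y, hy, rfl⟩
  rintro d ⟨x, -, y, -, rfl⟩
  exact sphDist_le_pi x y

lemma sphDiam_le {A : Set RiemannSphere} {C : ℝ} (hC : 0 ≤ C)
    (h : ∀ x ∈ A, ∀ y ∈ A, sphDist x y ≤ C) : sphDiam A ≤ C := by
  refine Real.sSup_le ?_ hC
  rintro d ⟨x, hx, y, hy, rfl⟩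
  exact h x hx y hy

lemma sphDiam_nonneg (A : Set RiemannSphere) : 0 ≤ sphDiam A := by
  refine Real.sSup_nonneg ?_
  rintro d ⟨x, -, y, -, rfl⟩
  exact sphDist_nonneg x y

lemma sphDiam_singleton (x : RiemannSphere) : sphDiam {x} = 0 := by
  refine le_antisymm (sphDiam_le le_rfl ?_) (sphDiam_nonneg _)
  rintro _ rfl _ rfl
  exact (sphDist_self _).le

lemma eq_of_not_sphDiam_pos {A : Set RiemannSphere} (h : ¬ 0 < sphDiam A) {x y : RiemannSphere}
    (hx : x ∈ A) (hy : y ∈ A) : x = y :=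
  eq_of_sphDist_le_zero ((sphDist_le_sphDiam hx hy).trans (not_lt.1 h))

/-- The affine coordinate on the sphere, with the junk value `0` at `∞`. -/
def affine (x : RiemannSphere) : ℂ := x.elim 0 id

@[simp] lemma affine_coe (z : ℂ) : affine (z : RiemannSphere) = z := rfl

lemma coe_affine {x : RiemannSphere} (hx : x ≠ ∞) : (affine x : RiemannSphere) = x := by
  obtain ⟨z, rfl⟩ := OnePoint.ne_infty_iff_exists.1 hx
  rfl

/-- The inversion `z ↦ 1 / z` of the sphere. -/
noncomputable def inversion (x : RiemannSphere) : RiemannSphere :=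
  open Classical in x.elim ((0 : ℂ) : RiemannSphere) fun z => if z = 0 then ∞ else (z⁻¹ : ℂ)

@[simp] lemma inversion_infty : inversion ∞ = ((0 : ℂ) : RiemannSphere) := rfl

@[simp] lemma inversion_zero : inversion ((0 : ℂ) : RiemannSphere) = ∞ := by
  simp [inversion]

lemma inversion_coe {z : ℂ} (hz : z ≠ 0) :
    inversion (z : RiemannSphere) = ((z⁻¹ : ℂ) : RiemannSphere) := by
  simp [inversion, hz]

lemma inversion_inversion (x : RiemannSphere) : inversion (inversion x) = x := by
  induction x using OnePoint.rec with
  | infty => simp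
  | coe z =>
    by_cases hz : z = 0
    · simp [hz]
    · rw [inversion_coe hz, inversion_coe (inv_ne_zero hz), inv_inv]

lemma affine_inversion (z : ℂ) : affine (inversion z) = z⁻¹ := by
  by_cases hz : z = 0
  · simp [hz, affine]
  · rw [inversion_coe hz, affine_coe]

lemma continuous_inversion : Continuous inversion := by
  rw [continuous_iff_continuousAt]
  intro x
  induction x using OnePoint.rec with
  | infty =>
    rw [OnePoint.continuousAt_infty', inversion_infty]
    have h : Tendsto (fun z : ℂ => (z⁻¹ : ℂ)) (coclosedCompact ℂ) (𝓝 0) := by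
      rw [coclosedCompact_eq_cocompact, ← Metric.cobounded_eq_cocompact]
      exact tendsto_inv₀_cobounded
    refine ((OnePoint.continuous_coe.tendsto (0 : ℂ)).comp h).congr' ?_
    have : ({0}ᶜ : Set ℂ) ∈ coclosedCompact ℂ :=
      isCompact_singleton.compl_mem_coclosedCompact_of_isClosed isClosed_singleton
    filter_upwards [this] with z hz
    exact (inversion_coe hz).symm
  | coe z =>
    rw [OnePoint.continuousAt_coe]
    by_cases hz : z = 0
    · subst hz
      rw [← continuousWithinAt_compl_self]
      have h : Tendsto (fun z : ℂ => (z⁻¹ : ℂ)) (𝓝[≠] 0) (coclosedCompact ℂ) := by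
        rw [coclosedCompact_eq_cocompact, ← Metric.cobounded_eq_cocompact]
        exact tendsto_inv₀_nhdsNE_zero
      have h2 := OnePoint.tendsto_coe_infty.comp h
      change Tendsto _ _ (𝓝 (inversion ((0 : ℂ) : RiemannSphere)))
      rw [inversion_zero]
      refine h2.congr' ?_
      filter_upwards [self_mem_nhdsWithin] with w hw
      exact (inversion_coe hw).symm
    · have h : ContinuousAt (fun w : ℂ => ((w⁻¹ : ℂ) : RiemannSphere)) z :=
        OnePoint.continuous_coe.continuousAt.comp (continuousAt_inv₀ hz)
      refine h.congr ?_
      filter_upwards [isOpen_ne.mem_nhds hz] with w hw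
      exact (inversion_coe hw).symm

/-- The inversion as a homeomorphism. -/
noncomputable def inversionHomeomorph : RiemannSphere ≃ₜ RiemannSphere where
  toFun := inversion
  invFun := inversion
  left_inv := inversion_inversion
  right_inv := inversion_inversion
  continuous_toFun := continuous_inversion
  continuous_invFun := continuous_inversion

lemma halfChord_comm (x y : RiemannSphere) : halfChord x y = halfChord y x := by
  induction x using OnePoint.rec <;> induction y using OnePoint.rec <;>
    simp only [halfChord, norm_sub_rev, mul_comm]

lemma halfChord_inversion_infty (z : ℂ) :
    halfChord (inversion z) ((0 : ℂ) : RiemannSphere) = 1 / √(1 + ‖z‖ ^ 2) := by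
  by_cases hz : z = 0
  · simp [hz, halfChord]
  · rw [inversion_coe hz]
    have hn : 0 < ‖z‖ := norm_pos_iff.2 hz
    have h1 : √(1 + ‖z⁻¹‖ ^ 2) = √(1 + ‖z‖ ^ 2) / ‖z‖ := by
      rw [← Real.sqrt_sq hn.le, ← Real.sqrt_div (by positivity), Real.sqrt_sq hn.le]
      congr 1
      rw [norm_inv]
      field_simp
      ring
    have h2 : √(1 + ‖(0 : ℂ)‖ ^ 2) = 1 := by simp
    change ‖z⁻¹ - 0‖ / (√(1 + ‖z⁻¹‖ ^ 2) * √(1 + ‖(0 : ℂ)‖ ^ 2)) = _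
    rw [h1, h2, sub_zero, norm_inv]
    field_simp

/-- The inversion is a rotation of the sphere. This permits the assumption later that a given point
is finite, since spherical disks go to spherical disks. -/
lemma halfChord_inversion (x y : RiemannSphere) :
    halfChord (inversion x) (inversion y) = halfChord x y := by
  induction x using OnePoint.rec with
  | infty =>
    induction y using OnePoint.rec with
    | infty => simp [halfChord]
    | coe w =>
      rw [halfChord_comm, inversion_infty, halfChord_inversion_infty]
      rfl
  | coe z =>
    induction y using OnePoint.rec with
    | infty =>
      rw [inversion_infty, halfChord_inversion_infty]
      rfl
    | coe w =>
      by_cases hz : z = 0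
      · subst hz
        rw [inversion_zero]
        by_cases hw : w = 0
        · simp [hw, halfChord]
        · rw [inversion_coe hw]
          have hn : 0 < ‖w‖ := norm_pos_iff.2 hw
          have h := halfChord_inversion_infty w⁻¹
          rw [inversion_coe (inv_ne_zero hw), inv_inv, halfChord_comm] at h
          exact h.symm
      · by_cases hw : w = 0
        · subst hw
          rw [inversion_zero, inversion_coe hz]
          have h := halfChord_inversion_infty z⁻¹
          rw [inversion_coe (inv_ne_zero hz), inv_inv] at h
          exact h.symm
        · rw [inversion_coe hz, inversion_coe hw]
          have key : ∀ v : ℂ, v ≠ 0 → √(1 + ‖v⁻¹‖ ^ 2) = √(1 + ‖v‖ ^ 2) / ‖v‖ := by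
            intro v hv
            have hn : 0 < ‖v‖ := norm_pos_iff.2 hv
            rw [← Real.sqrt_sq hn.le, ← Real.sqrt_div (by positivity), Real.sqrt_sq hn.le]
            congr 1
            rw [norm_inv]
            field_simp
            ring
          have hzn : 0 < ‖z‖ := norm_pos_iff.2 hz
          have hwn : 0 < ‖w‖ := norm_pos_iff.2 hw
          change ‖z⁻¹ - w⁻¹‖ / (√(1 + ‖z⁻¹‖ ^ 2) * √(1 + ‖w⁻¹‖ ^ 2)) =
            ‖z - w‖ / (√(1 + ‖z‖ ^ 2) * √(1 + ‖w‖ ^ 2))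
          rw [key z hz, key w hw, inv_sub_inv hz hw, norm_div, norm_mul, norm_sub_rev]
          field_simp

lemma sphDist_inversion (x y : RiemannSphere) :
    sphDist (inversion x) (inversion y) = sphDist x y := by
  rw [sphDist, halfChord_inversion, sphDist]

lemma IsDisk.image_inversion {A : Set RiemannSphere} (hA : IsDisk A) :
    IsDisk (inversion '' A) := by
  obtain ⟨c, r, hr, rfl⟩ := hA
  refine ⟨inversion c, r, hr, ?_⟩
  ext x
  constructor
  · rintro ⟨y, hy, rfl⟩
    exact (sphDist_inversion y c).trans_le hy
  · intro hx
    refine ⟨inversion x, ?_, inversion_inversion x⟩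
    have h : sphDist x (inversion c) ≤ r := hx
    rwa [← sphDist_inversion, inversion_inversion] at h

/-! ### Spherical disks as Euclidean disks. -/

lemma apollonius (z c : ℂ) {k : ℝ} (hk : k < 1) :
    ‖z - c‖ ^ 2 ≤ k * (1 + ‖z‖ ^ 2) ↔
      ‖z - ((1 - k)⁻¹ : ℝ) * c‖ ^ 2 ≤ (k * ‖c‖ ^ 2 + (1 - k) * k) / (1 - k) ^ 2 := by
  have ha : 0 < 1 - k := by linarith
  have hn : ∀ w : ℂ, ‖w‖ ^ 2 = w.re ^ 2 + w.im ^ 2 := fun w => by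
    rw [← Complex.normSq_eq_norm_sq, Complex.normSq_apply]; ring
  rw [le_div_iff₀ (by positivity), hn, hn, hn, hn]
  simp only [Complex.sub_re, Complex.sub_im, Complex.re_ofReal_mul, Complex.im_ofReal_mul]
  -- Multiplying by `1 - k > 0` and completing the square turns one inequality into the other.
  have h1 : ((z.re - (1 - k)⁻¹ * c.re) ^ 2 + (z.im - (1 - k)⁻¹ * c.im) ^ 2) * (1 - k) ^ 2 =
      ((1 - k) * z.re - c.re) ^ 2 + ((1 - k) * z.im - c.im) ^ 2 := by
    field_simp
  rw [h1]
  constructor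
  · intro h
    nlinarith [mul_le_mul_of_nonneg_left h ha.le]
  · intro h
    have h2 : (1 - k) * ((z.re - c.re) ^ 2 + (z.im - c.im) ^ 2) ≤
        (1 - k) * (k * (1 + (z.re ^ 2 + z.im ^ 2))) := by nlinarith
    exact le_of_mul_le_mul_left h2 ha

/-- After squaring, the bound on the chord has the form treated in `apollonius` with `k = sin (r /
2) ^ 2 * (1 + ‖c‖ ^ 2)`. That `∞` lies outside the disk says exactly that `k < 1`, so the locus is a
disk and not a half plane or an exterior. -/
lemma IsDisk.eq_closedBall {A : Set RiemannSphere} (hA : IsDisk A) (hinf : ∞ ∉ A) :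
    ∃ (c : ℂ) (s : ℝ), 0 ≤ s ∧ A = (fun z : ℂ => (z : RiemannSphere)) '' Metric.closedBall c s := by
  obtain ⟨c, r, hr, rfl⟩ := hA
  simp only [mem_ofPred_eq, not_le] at hinf
  have hrpi : r < Real.pi := hinf.trans_le (sphDist_le_pi _ _)
  induction c using OnePoint.rec with
  | infty => rw [sphDist_self] at hinf; exact absurd hinf (not_lt.2 hr.le)
  | coe c =>
    have hiff : ∀ x, sphDist x c ≤ r ↔ halfChord x c ≤ Real.sin (r / 2) := by
      intro x
      rw [sphDist, ← le_div_iff₀' (by norm_num : (0 : ℝ) < 2)]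
      exact Real.arcsin_le_iff_le_sin' ⟨by linarith, by linarith⟩
    have hσ : 0 ≤ Real.sin (r / 2) :=
      Real.sin_nonneg_of_nonneg_of_le_pi (by linarith) (by linarith)
    rw [← not_le, hiff, not_le] at hinf
    set σ := Real.sin (r / 2) with hσdef
    have hc : 0 < √(1 + ‖c‖ ^ 2) := by positivity
    have hk : σ ^ 2 * (1 + ‖c‖ ^ 2) < 1 := by
      have h1 : σ < 1 / √(1 + ‖c‖ ^ 2) := hinf
      rw [lt_div_iff₀ hc] at h1
      have h2 : (σ * √(1 + ‖c‖ ^ 2)) ^ 2 < 1 := by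
        have : 0 ≤ σ * √(1 + ‖c‖ ^ 2) := by positivity
        nlinarith
      rwa [mul_pow, Real.sq_sqrt (by positivity)] at h2
    set k := σ ^ 2 * (1 + ‖c‖ ^ 2) with hkdef
    have hk0 : 0 ≤ k := by positivity
    have h1k : 0 < 1 - k := by linarith
    have hR : 0 ≤ (k * ‖c‖ ^ 2 + (1 - k) * k) / (1 - k) ^ 2 :=
      div_nonneg (add_nonneg (by positivity) (mul_nonneg h1k.le hk0)) (sq_nonneg _)
    refine ⟨((1 - k)⁻¹ : ℝ) * c, √((k * ‖c‖ ^ 2 + (1 - k) * k) / (1 - k) ^ 2),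
      Real.sqrt_nonneg _, ?_⟩
    ext x
    rw [mem_ofPred_eq, hiff]
    induction x using OnePoint.rec with
    | infty =>
      refine iff_of_false (not_le.2 hinf) ?_
      rintro ⟨z, -, hz⟩
      exact OnePoint.coe_ne_infty z hz
    | coe z =>
      have h2 : ((z : RiemannSphere) ∈ (fun z : ℂ => (z : RiemannSphere)) ''
          Metric.closedBall (((1 - k)⁻¹ : ℝ) * c) √((k * ‖c‖ ^ 2 + (1 - k) * k) / (1 - k) ^ 2)) ↔
          z ∈ Metric.closedBall (((1 - k)⁻¹ : ℝ) * c)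
            √((k * ‖c‖ ^ 2 + (1 - k) * k) / (1 - k) ^ 2) :=
        OnePoint.coe_injective.mem_set_image
      rw [h2, mem_closedBall_iff_norm, Real.le_sqrt (norm_nonneg _) hR, ← apollonius z c hk]
      change ‖z - c‖ / (√(1 + ‖z‖ ^ 2) * √(1 + ‖c‖ ^ 2)) ≤ σ ↔ _
      rw [div_le_iff₀ (by positivity), ← abs_of_nonneg (norm_nonneg (z - c)),
        ← abs_of_nonneg (by positivity : 0 ≤ σ * (√(1 + ‖z‖ ^ 2) * √(1 + ‖c‖ ^ 2))),
        ← sq_le_sq, mul_pow, mul_pow, Real.sq_sqrt (by positivity), Real.sq_sqrt (by positivity),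
        abs_of_nonneg (norm_nonneg _)]
      rw [hkdef]
      ring_nf

end RiemannSphere

namespace RiemannSphere

open Filter Set Topology

/-! ### The decomposition space of an open set -/

variable {D : Set RiemannSphere}

lemma quotMap_eq_iff {z w : RiemannSphere} :
    quotMap D z = quotMap D w ↔ z = w ∨ (w ∈ Dᶜ ∧ z ∈ connectedComponentIn Dᶜ w) := by
  have h : quotMap D z = quotMap D w ↔ z = w ∨ ∃ p ∈ complComponents D, z ∈ p ∧ w ∈ p :=
    Quotient.eq (r := decompositionSetoid D)
  rw [h]
  refine or_congr_right ⟨?_, ?_⟩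
  · rintro ⟨p, ⟨x, hx, rfl⟩, hz, hw⟩
    refine ⟨connectedComponentIn_subset _ _ hw, ?_⟩
    rwa [← connectedComponentIn_eq hw]
  · rintro ⟨hw, hz⟩
    exact ⟨_, ⟨w, hw, rfl⟩, hz, mem_connectedComponentIn hw⟩

lemma quotMap_eq_iff_of_mem {z w : RiemannSphere} (hw : w ∈ D) :
    quotMap D z = quotMap D w ↔ z = w := by
  rw [quotMap_eq_iff, or_iff_left]
  exact fun h => h.1 hw

lemma preimage_quotMap_singleton {w : RiemannSphere} (hw : w ∉ D) :
    quotMap D ⁻¹' {quotMap D w} = connectedComponentIn Dᶜ w := by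
  ext z
  rw [mem_preimage, mem_singleton_iff, quotMap_eq_iff]
  constructor
  · rintro (rfl | h)
    · exact mem_connectedComponentIn hw
    · exact h.2
  · exact fun h => Or.inr ⟨hw, h⟩

lemma surjective_quotMap : Function.Surjective (quotMap D) := Quotient.mk_surjective

lemma continuous_quotMap : Continuous (quotMap D) := continuous_quot_mk

lemma isQuotientMap_quotMap : IsQuotientMap (quotMap D) := isQuotientMap_quot_mk

/-- The saturation of a closed set `C` adds to `C` the components of the compact set `Dᶜ` that meet
`C`. They form a closed set, because the space of components of a compact Hausdorff space is
Hausdorff and hence the image of a compact set in it is closed. -/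
lemma isClosedMap_quotMap (hD : IsOpen D) : IsClosedMap (quotMap D) := by
  intro C hC
  rw [← isQuotientMap_quotMap.isClosed_preimage]
  have hK : IsClosed Dᶜ := hD.isClosed_compl
  have : CompactSpace (Dᶜ : Set RiemannSphere) := isCompact_iff_compactSpace.1 hK.isCompact
  let π : (Dᶜ : Set RiemannSphere) → ConnectedComponents (Dᶜ : Set RiemannSphere) :=
    fun x => (x : ConnectedComponents _)
  have hπ : Continuous π := ConnectedComponents.continuous_coe
  have hC' : IsClosed ((↑) ⁻¹' C : Set (Dᶜ : Set RiemannSphere)) := hC.preimage continuous_subtype_val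
  have hS : IsClosed (π ⁻¹' (π '' ((↑) ⁻¹' C))) :=
    ((hC'.isCompact.image hπ).isClosed).preimage hπ
  have heq : quotMap D ⁻¹' (quotMap D '' C) =
      C ∪ (↑) '' (π ⁻¹' (π '' ((↑) ⁻¹' C)) : Set (Dᶜ : Set RiemannSphere)) := by
    ext z
    constructor
    · rintro ⟨c, hc, hcz⟩
      rw [quotMap_eq_iff] at hcz
      rcases hcz with rfl | ⟨hz, hcz⟩
      · exact Or.inl hc
      · refine Or.inr ⟨⟨z, hz⟩, ?_, rfl⟩
        rw [connectedComponentIn_eq_image hz] at hcz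
        obtain ⟨c', hc', rfl⟩ := hcz
        exact ⟨c', hc, ConnectedComponents.coe_eq_coe'.2 hc'⟩
    · rintro (hz | ⟨⟨z, hz⟩, ⟨c, hc, hcz⟩, rfl⟩)
      · exact ⟨z, hz, rfl⟩
      · refine ⟨c, hc, ?_⟩
        rw [quotMap_eq_iff]
        refine Or.inr ⟨hz, ?_⟩
        rw [connectedComponentIn_eq_image hz]
        exact ⟨c, ConnectedComponents.coe_eq_coe'.1 hcz, rfl⟩
  rw [heq]
  exact hC.union (hK.isClosedEmbedding_subtypeVal.isClosedMap _ hS)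

/-- Upper semicontinuity of the decomposition: the union of the classes contained in an open set
is open, and it is the preimage of an open set. -/
lemma exists_isOpen_preimage_subset (hD : IsOpen D) {V : Set RiemannSphere} (hV : IsOpen V) :
    ∃ O : Set (DecompositionSpace D), IsOpen O ∧ quotMap D ⁻¹' O ⊆ V ∧
      ∀ a, quotMap D ⁻¹' {a} ⊆ V → a ∈ O := by
  refine ⟨(quotMap D '' Vᶜ)ᶜ, (isClosedMap_quotMap hD _ hV.isClosed_compl).isOpen_compl, ?_, ?_⟩
  · intro z hz
    by_contra hzV
    exact hz ⟨z, hzV, rfl⟩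
  · rintro a ha ⟨z, hz, rfl⟩
    exact hz (ha rfl)

/-- The classes are closed, so two of them are separated by normality of the sphere. Upper
semicontinuity then replaces the separating sets by saturated ones. -/
lemma t2Space_decompositionSpace (hD : IsOpen D) : T2Space (DecompositionSpace D) := by
  refine ⟨fun a b hab => ?_⟩
  have hcl : ∀ a : DecompositionSpace D, IsClosed (quotMap D ⁻¹' {a}) := by
    intro a
    obtain ⟨x, rfl⟩ := surjective_quotMap a
    have := (isClosedMap_quotMap hD {x} isClosed_singleton).preimage continuous_quotMap
    rwa [image_singleton] at this
  have hd : Disjoint (quotMap D ⁻¹' {a}) (quotMap D ⁻¹' {b}) := by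
    refine Disjoint.preimage _ ?_
    simpa using hab
  obtain ⟨V₁, V₂, hV₁, hV₂, h₁, h₂, hV⟩ := normal_separation (hcl a) (hcl b) hd
  obtain ⟨O₁, hO₁, hO₁V, ha⟩ := exists_isOpen_preimage_subset hD hV₁
  obtain ⟨O₂, hO₂, hO₂V, hb⟩ := exists_isOpen_preimage_subset hD hV₂
  refine ⟨O₁, O₂, hO₁, hO₂, ha a h₁, hb b h₂, ?_⟩
  rw [Set.disjoint_left]
  intro c hc₁ hc₂
  obtain ⟨x, rfl⟩ := surjective_quotMap c
  exact Set.disjoint_left.1 hV (hO₁V hc₁) (hO₂V hc₂)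

/-- Two distinct components of a compact set lie in the two parts of a separation of it. -/
lemma exists_separation (hD : IsOpen D) {x y : RiemannSphere} (hx : x ∉ D) (hy : y ∉ D)
    (hxy : y ∉ connectedComponentIn Dᶜ x) :
    ∃ V₁ V₂ : Set RiemannSphere, IsOpen V₁ ∧ IsOpen V₂ ∧ Disjoint V₁ V₂ ∧ Dᶜ ⊆ V₁ ∪ V₂ ∧
      x ∈ V₁ ∧ y ∈ V₂ := by
  have hK : IsClosed Dᶜ := hD.isClosed_compl
  have : CompactSpace (Dᶜ : Set RiemannSphere) := isCompact_iff_compactSpace.1 hK.isCompact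
  have h : (⟨y, hy⟩ : (Dᶜ : Set RiemannSphere)) ∉ connectedComponent ⟨x, hx⟩ := by
    intro h
    rw [connectedComponentIn_eq_image hx] at hxy
    exact hxy ⟨_, h, rfl⟩
  -- In a compact Hausdorff space a component is the intersection of the clopen sets around it, so
  -- some clopen set separates the two points.
  rw [connectedComponent_eq_iInter_isClopen, mem_iInter] at h
  push Not at h
  obtain ⟨⟨s, hs, hxs⟩, hys⟩ := h
  have h1 : IsClosed ((↑) '' s : Set RiemannSphere) :=
    hK.isClosedEmbedding_subtypeVal.isClosedMap _ hs.1
  have h2 : IsClosed ((↑) '' sᶜ : Set RiemannSphere) :=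
    hK.isClosedEmbedding_subtypeVal.isClosedMap _ hs.compl.1
  have hd : Disjoint ((↑) '' s : Set RiemannSphere) ((↑) '' sᶜ) :=
    (disjoint_image_iff Subtype.val_injective).2 disjoint_compl_right
  obtain ⟨V₁, V₂, hV₁, hV₂, hs₁, hs₂, hV⟩ := normal_separation h1 h2 hd
  refine ⟨V₁, V₂, hV₁, hV₂, hV, ?_, hs₁ ⟨_, hxs, rfl⟩, hs₂ ⟨_, hys, rfl⟩⟩
  intro z hz
  by_cases hzs : (⟨z, hz⟩ : (Dᶜ : Set RiemannSphere)) ∈ s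
  · exact Or.inl (hs₁ ⟨_, hzs, rfl⟩)
  · exact Or.inr (hs₂ ⟨_, hzs, rfl⟩)

/-- Along a filter with a basis of preconnected sets which leaves all compact subsets of the source,
a homeomorphism onto `D` converges to a complementary component of `D`. -/
lemma exists_tendsto_quotMap (hD : IsOpen D)
    (f : OpenPartialHomeomorph RiemannSphere RiemannSphere) (hf : f.target = D)
    {l : Filter RiemannSphere} [NeBot l]
    (hl : ∀ s ∈ l, ∃ t ∈ l, t ⊆ s ∧ IsPreconnected t)
    (hsource : f.source ∈ l) (hcompact : ∀ C : Set RiemannSphere, IsCompact C → C ⊆ f.source → Cᶜ ∈ l) :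
    ∃ w ∉ D, Tendsto (fun z => quotMap D (f z)) l (𝓝 (quotMap D w)) := by
  subst hf
  -- The map is proper: a compact subset of the target has a compact preimage, which the filter
  -- leaves.
  have hout : ∀ K : Set RiemannSphere, IsCompact K → K ⊆ f.target → ∀ᶠ z in l, f z ∉ K := by
    intro K hK hKD
    have h1 : IsCompact (f.symm '' K) := hK.image_of_continuousOn (f.symm.continuousOn.mono hKD)
    have h2 : f.symm '' K ⊆ f.source := by
      rintro _ ⟨w, hw, rfl⟩
      exact f.map_target (hKD hw)
    filter_upwards [hcompact _ h1 h2, hsource] with z hz hzs hzK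
    exact hz ⟨f z, hzK, f.left_inv hzs⟩
  obtain ⟨w, hw⟩ := exists_clusterPt_of_compactSpace (map f l)
  have hnotin : ∀ w, ClusterPt w (map f l) → w ∉ f.target := by
    intro w hw hwD
    obtain ⟨K, hK, hwK, hKD⟩ := exists_compact_subset f.open_target hwD
    have := hw.frequently (mem_interior_iff_mem_nhds.1 hwK : ∀ᶠ z in 𝓝 w, z ∈ K)
    rw [frequently_map] at this
    exact this (hout K hK hKD)
  have hwD := hnotin w hw
  refine ⟨w, hwD, ?_⟩
  have huniq : ∀ w', ClusterPt w' (map f l) → w' ∈ connectedComponentIn f.targetᶜ w := by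
    intro w' hw'
    by_contra hne
    obtain ⟨V₁, V₂, hV₁, hV₂, hV, hDV, h₁, h₂⟩ :=
      exists_separation f.open_target hwD (hnotin w' hw') hne
    -- The complement of `V₁ ∪ V₂` is a compact subset of the target. Images of small connected
    -- members of the filter avoid it and so lie in one of the two parts, which contradicts cluster
    -- points in both.
    have hK : IsCompact (V₁ ∪ V₂)ᶜ := (hV₁.union hV₂).isClosed_compl.isCompact
    have hev := hout _ hK (compl_subset_comm.1 hDV)
    obtain ⟨t, ht, htV, htc⟩ := hl _ (inter_mem hev hsource)
    have himg : IsPreconnected (f '' t) :=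
      htc.image _ (f.continuousOn.mono fun z hz => (htV hz).2)
    have hsub : f '' t ⊆ V₁ ∪ V₂ := by
      rintro _ ⟨z, hz, rfl⟩
      exact not_not.1 (htV hz).1
    have hmem : f '' t ∈ map f l := image_mem_map ht
    have key : ∀ {v : RiemannSphere} {V : Set RiemannSphere}, IsOpen V → v ∈ V →
        ClusterPt v (map f l) → (f '' t ∩ V).Nonempty := by
      intro v V hVo hv hvc
      have := clusterPt_iff_nonempty.1 hvc (hVo.mem_nhds hv) hmem
      rwa [inter_comm] at this
    rcases himg.subset_or_subset hV₁ hV₂ hV hsub with h | h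
    · obtain ⟨v, hv, hv'⟩ := key hV₂ h₂ hw'
      exact Set.disjoint_left.1 hV (h hv) hv'
    · obtain ⟨v, hv, hv'⟩ := key hV₁ h₁ hw
      exact Set.disjoint_left.1 hV hv' (h hv)
  have := t2Space_decompositionSpace f.open_target
  -- By compactness it suffices that the class of `w` is the only cluster point in the decomposition
  -- space. Any cluster point there lifts, along an ultrafilter, to a cluster point of `f` itself.
  refine le_nhds_of_unique_clusterPt fun a ha => ?_
  have hmapeq : map (fun z => quotMap f.target (f z)) l = map (quotMap f.target) (map f l) := by
    rw [map_map]; rfl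
  rw [hmapeq] at ha
  obtain ⟨U, hU, hUa⟩ := mapClusterPt_iff_ultrafilter.1 ha
  obtain ⟨w', -, hw'⟩ := isCompact_univ.ultrafilter_le_nhds U (by simp)
  have hcl : ClusterPt w' (map f l) := ClusterPt.mono (ClusterPt.of_le_nhds hw') hU
  have h1 : Tendsto (quotMap f.target) U (𝓝 (quotMap f.target w')) :=
    (continuous_quotMap.tendsto w').mono_left hw'
  rw [tendsto_nhds_unique hUa h1, quotMap_eq_iff]
  exact Or.inr ⟨hwD, huniq w' hcl⟩

end RiemannSphere

namespace RiemannSphere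

open Filter Set Topology

/-! ### A binary tree of radial slits -/

/-- The argument of the `j`-th slit of level `n`. -/
noncomputable def treeAngle (n j : ℕ) : ℝ := (2 * j + 1) / 2 ^ (n + 1)

/-- The nodes `(n, j)` of the binary tree: `j < 2 ^ n`. -/
def treeNodes : Set (ℕ × ℕ) := {x | x.2 < 2 ^ x.1}

/-- The slits in logarithmic coordinates. -/
def logSlit (L : ℝ) (x : ℕ × ℕ) : Set ℂ :=
  {ζ | ζ.im = treeAngle x.1 x.2 ∧ -L * (x.1 + 1) ≤ ζ.re ∧ ζ.re ≤ -L * x.1 + 1}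

/-- The radial slit of the node `x`. -/
noncomputable def slit (L : ℝ) (x : ℕ × ℕ) : Set ℂ := Complex.exp '' logSlit L x

/-- The slits of the nodes in `J`, together with the point `0`. -/
noncomputable def slitSet (L : ℝ) (J : Set (ℕ × ℕ)) : Set ℂ := {0} ∪ ⋃ x ∈ J, slit L x

lemma treeAngle_pos (n j : ℕ) : 0 < treeAngle n j := by unfold treeAngle; positivity

lemma treeAngle_lt_one {n j : ℕ} (h : j < 2 ^ n) : treeAngle n j < 1 := by
  unfold treeAngle
  rw [div_lt_one (by positivity)]
  have h' : j + 1 ≤ 2 ^ n := h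
  have : (j : ℝ) + 1 ≤ 2 ^ n := by exact_mod_cast h'
  rw [pow_succ]
  linarith

/-- The angles are dyadic fractions in lowest terms: the exponent of the denominator gives the
level, the odd numerator gives the index. -/
lemma treeAngle_injective {n j n' j' : ℕ} (h : treeAngle n j = treeAngle n' j') :
    n = n' ∧ j = j' := by
  unfold treeAngle at h
  rw [div_eq_div_iff (by positivity) (by positivity)] at h
  have hN : (2 * j + 1) * 2 ^ (n' + 1) = (2 * j' + 1) * 2 ^ (n + 1) := by exact_mod_cast h
  have key : ∀ a b m m' : ℕ, (2 * a + 1) * 2 ^ m = (2 * b + 1) * 2 ^ m' → m ≤ m' := by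
    intro a b m m' h
    have hcop : Nat.Coprime (2 ^ m') (2 * a + 1) :=
      Nat.Coprime.pow_left _ (by simp)
    have hdvd : 2 ^ m' ∣ 2 ^ m :=
      hcop.dvd_of_dvd_mul_left (h ▸ Dvd.intro_left _ rfl)
    by_contra hlt
    push Not at hlt
    have h2 : 2 ^ m' < 2 ^ m := Nat.pow_lt_pow_right (by norm_num) hlt
    obtain ⟨d, hd⟩ : 2 ^ m' ∣ 2 ^ m := hdvd
    have hcop2 : Nat.Coprime (2 ^ m) (2 * b + 1) := Nat.Coprime.pow_left _ (by simp)
    have hdvd2 : 2 ^ m ∣ 2 ^ m' := hcop2.dvd_of_dvd_mul_left (h ▸ Dvd.intro_left _ rfl)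
    exact absurd (Nat.le_of_dvd (by positivity) hdvd2) (not_le.2 h2)
  have hn : n = n' := by
    have h1 := key _ _ _ _ hN
    have h2 := key _ _ _ _ hN.symm
    omega
  subst hn
  have := Nat.eq_of_mul_eq_mul_right (by positivity) hN
  exact ⟨rfl, by omega⟩

variable {L : ℝ}

/-- The height `1` of the strip is less than the period `2π`. -/
lemma injOn_exp_strip : InjOn Complex.exp {ζ : ℂ | 0 < ζ.im ∧ ζ.im < 1} := by
  intro z hz w hw h
  obtain ⟨k, hk⟩ := Complex.exp_eq_exp_iff_exists_int.1 h
  have him : z.im = w.im + k * (2 * Real.pi) := by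
    have := congrArg Complex.im hk
    simpa using this
  have hpi := Real.pi_gt_three
  have hk0 : k = 0 := by
    have h1 : (k : ℝ) < 1 := by
      by_contra hc
      push Not at hc
      nlinarith [hz.2, hw.1]
    have h2 : (-1 : ℝ) < k := by
      by_contra hc
      push Not at hc
      nlinarith [hz.1, hw.2]
    have h1' : k < 1 := by exact_mod_cast h1
    have h2' : -1 < k := by exact_mod_cast h2
    omega
  simpa [hk0] using hk

lemma logSlit_subset_strip {x : ℕ × ℕ} (hx : x ∈ treeNodes) :
    logSlit L x ⊆ {ζ : ℂ | 0 < ζ.im ∧ ζ.im < 1} := by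
  rintro ζ ⟨h, -⟩
  exact ⟨h ▸ treeAngle_pos _ _, h ▸ treeAngle_lt_one hx⟩

lemma logSlit_eq_image (x : ℕ × ℕ) :
    logSlit L x = (fun t : ℝ => (⟨t, treeAngle x.1 x.2⟩ : ℂ)) ''
      Icc (-L * (x.1 + 1)) (-L * x.1 + 1) := by
  ext ζ
  constructor
  · rintro ⟨h1, h2, h3⟩
    exact ⟨ζ.re, ⟨h2, h3⟩, Complex.ext rfl h1.symm⟩
  · rintro ⟨t, ht, rfl⟩
    exact ⟨rfl, ht.1, ht.2⟩

lemma continuous_horizontal (y : ℝ) : Continuous fun t : ℝ => (⟨t, y⟩ : ℂ) := by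
  have h : (fun t : ℝ => (⟨t, y⟩ : ℂ)) = fun t : ℝ => (t : ℂ) + y * Complex.I := by
    ext t
    exact Complex.mk_eq_add_mul_I t y
  rw [h]
  fun_prop

lemma isCompact_logSlit (x : ℕ × ℕ) : IsCompact (logSlit L x) := by
  rw [logSlit_eq_image]
  exact isCompact_Icc.image (continuous_horizontal _)

lemma isPreconnected_logSlit (x : ℕ × ℕ) : IsPreconnected (logSlit L x) := by
  rw [logSlit_eq_image]
  exact isPreconnected_Icc.image _ (continuous_horizontal _).continuousOn

lemma nonempty_logSlit (hL : 0 ≤ L) (x : ℕ × ℕ) : (logSlit L x).Nonempty :=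
  ⟨⟨-L * x.1, treeAngle x.1 x.2⟩, rfl, by simp only; linarith, by simp only; linarith⟩

lemma isCompact_slit (x : ℕ × ℕ) : IsCompact (slit L x) :=
  (isCompact_logSlit x).image Complex.continuous_exp

lemma isPreconnected_slit (x : ℕ × ℕ) : IsPreconnected (slit L x) :=
  (isPreconnected_logSlit x).image _ Complex.continuous_exp.continuousOn

lemma nonempty_slit (hL : 0 ≤ L) (x : ℕ × ℕ) : (slit L x).Nonempty :=
  (nonempty_logSlit hL x).image _

lemma norm_le_of_mem_slit {x : ℕ × ℕ} {z : ℂ} (hz : z ∈ slit L x) :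
    ‖z‖ ≤ Real.exp (-L * x.1 + 1) := by
  obtain ⟨ζ, ⟨-, -, h⟩, rfl⟩ := hz
  rw [Complex.norm_exp]
  exact Real.exp_le_exp.2 h

lemma zero_notMem_slit (x : ℕ × ℕ) : (0 : ℂ) ∉ slit L x := by
  rintro ⟨ζ, -, h⟩
  exact Complex.exp_ne_zero ζ h

lemma eq_of_mem_slit {x y : ℕ × ℕ} (hx : x ∈ treeNodes) (hy : y ∈ treeNodes) {z : ℂ}
    (hzx : z ∈ slit L x) (hzy : z ∈ slit L y) : x = y := by
  obtain ⟨ζ, hζ, rfl⟩ := hzx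
  obtain ⟨ζ', hζ', h⟩ := hzy
  have := injOn_exp_strip (logSlit_subset_strip hy hζ') (logSlit_subset_strip hx hζ) h
  subst this
  obtain ⟨h1, h2⟩ := treeAngle_injective (hζ.1.symm.trans hζ'.1)
  exact Prod.ext h1 h2

lemma mem_slitSet {J : Set (ℕ × ℕ)} {z : ℂ} :
    z ∈ slitSet L J ↔ z = 0 ∨ ∃ x ∈ J, z ∈ slit L x := by
  simp [slitSet]

lemma finite_treeNodes_lt (N : ℕ) : {x ∈ treeNodes | x.1 < N}.Finite := by
  refine ((Set.finite_lt_nat N).prod (Set.finite_lt_nat (2 ^ N))).subset ?_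
  rintro ⟨n, j⟩ ⟨h1, h2⟩
  refine ⟨h2, ?_⟩
  have h1' : j < 2 ^ n := h1
  have h2' : n < N := h2
  exact h1'.trans (Nat.pow_lt_pow_right (by norm_num) h2')

lemma tendsto_exp_level (hL : 0 < L) :
    Tendsto (fun n : ℕ => Real.exp (-L * n + 1)) atTop (𝓝 0) := by
  refine Real.tendsto_exp_atBot.comp ?_
  refine tendsto_atBot_add_const_right _ _ ?_
  exact tendsto_natCast_atTop_atTop.const_mul_atTop_of_neg (neg_lt_zero.2 hL)

/-- The set is an intersection of closed sets, each consisting of a small disk around `0` and the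
finitely many slits of low level. -/
lemma isClosed_slitSet (hL : 0 < L) {J : Set (ℕ × ℕ)} (hJ : J ⊆ treeNodes) :
    IsClosed (slitSet L J) := by
  have heq : slitSet L J = ⋂ N : ℕ, (Metric.closedBall 0 (Real.exp (-L * N + 1)) ∪
      ⋃ x ∈ {x ∈ J | x.1 < N}, slit L x) := by
    ext z
    simp only [mem_iInter, mem_union, mem_iUnion, mem_closedBall_zero_iff]
    constructor
    · intro hz N
      rcases mem_slitSet.1 hz with rfl | ⟨x, hx, hzx⟩
      · left
        rw [norm_zero]
        positivity
      · by_cases hN : x.1 < N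
        · exact Or.inr ⟨x, ⟨hx, hN⟩, hzx⟩
        · left
          refine (norm_le_of_mem_slit hzx).trans (Real.exp_le_exp.2 ?_)
          have : (N : ℝ) ≤ x.1 := by exact_mod_cast not_lt.1 hN
          nlinarith
    · intro hz
      rw [mem_slitSet]
      by_contra hcon
      push Not at hcon
      obtain ⟨N, hN⟩ := ((tendsto_exp_level hL).eventually_lt_const
        (norm_pos_iff.2 hcon.1)).exists
      rcases hz N with h | ⟨x, hx, hzx⟩
      · exact absurd h (not_le.2 hN)
      · exact hcon.2 x hx.1 hzx
  rw [heq]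
  refine isClosed_iInter fun N => Metric.isClosed_closedBall.union ?_
  refine Set.Finite.isClosed_biUnion ((finite_treeNodes_lt N).subset ?_)
    fun x _ => (isCompact_slit x).isClosed
  rintro x ⟨h1, h2⟩
  exact ⟨hJ h1, h2⟩

lemma isCompact_slitSet (hL : 0 < L) {J : Set (ℕ × ℕ)} (hJ : J ⊆ treeNodes) :
    IsCompact (slitSet L J) := by
  refine Metric.isCompact_of_isClosed_isBounded (isClosed_slitSet hL hJ)
    ((Metric.isBounded_closedBall (x := (0 : ℂ)) (r := Real.exp 1)).subset ?_)
  intro z hz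
  rw [mem_closedBall_zero_iff]
  rcases mem_slitSet.1 hz with rfl | ⟨x, hx, hzx⟩
  · rw [norm_zero]
    positivity
  · refine (norm_le_of_mem_slit hzx).trans (Real.exp_le_exp.2 ?_)
    have : (0 : ℝ) ≤ x.1 := by positivity
    nlinarith

/-! ### The slit domain and its complementary components. -/

/-- The complement in the sphere of the tree of slits. -/
noncomputable def slitDomain (L : ℝ) : Set RiemannSphere :=
  ((fun z : ℂ => (z : RiemannSphere)) '' slitSet L treeNodes)ᶜ

/-- The slit of the node `x`, as a subset of the sphere. -/
noncomputable def sphereSlit (L : ℝ) (x : ℕ × ℕ) : Set RiemannSphere :=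
  (fun z : ℂ => (z : RiemannSphere)) '' slit L x

lemma isOpen_slitDomain (hL : 0 < L) : IsOpen (slitDomain L) :=
  ((isCompact_slitSet hL subset_rfl).image OnePoint.continuous_coe).isClosed.isOpen_compl

lemma coe_mem_slitDomain {z : ℂ} :
    (z : RiemannSphere) ∈ slitDomain L ↔ z ∉ slitSet L treeNodes :=
  not_congr OnePoint.coe_injective.mem_set_image

lemma infty_mem_slitDomain : ∞ ∈ slitDomain L := by
  rintro ⟨z, -, hz⟩
  exact OnePoint.coe_ne_infty z hz

lemma compl_slitDomain :
    (slitDomain L)ᶜ = (fun z : ℂ => (z : RiemannSphere)) '' slitSet L treeNodes :=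
  compl_compl _

lemma notMem_slitDomain {w : RiemannSphere} (hw : w ∉ slitDomain L) :
    w = ((0 : ℂ) : RiemannSphere) ∨ ∃ x ∈ treeNodes, w ∈ sphereSlit L x := by
  obtain ⟨z, hz, rfl⟩ := not_not.1 hw
  rcases mem_slitSet.1 hz with rfl | ⟨x, hx, hzx⟩
  · exact Or.inl rfl
  · exact Or.inr ⟨x, hx, z, hzx, rfl⟩

lemma sphereSlit_subset_compl {x : ℕ × ℕ} (hx : x ∈ treeNodes) :
    sphereSlit L x ⊆ (slitDomain L)ᶜ := by
  rw [compl_slitDomain]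
  exact image_mono fun z hz => mem_slitSet.2 (Or.inr ⟨x, hx, hz⟩)

lemma zero_notMem_slitDomain : ((0 : ℂ) : RiemannSphere) ∉ slitDomain L := by
  rw [coe_mem_slitDomain, not_not]
  exact mem_slitSet.2 (Or.inl rfl)

lemma isCompact_sphereSlit (x : ℕ × ℕ) : IsCompact (sphereSlit L x) :=
  (isCompact_slit x).image OnePoint.continuous_coe

lemma isPreconnected_sphereSlit (x : ℕ × ℕ) : IsPreconnected (sphereSlit L x) :=
  (isPreconnected_slit x).image _ OnePoint.continuous_coe.continuousOn

/-- A preconnected subset of the complement of the slit domain which meets a slit is contained in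
that slit. -/
lemma subset_sphereSlit (hL : 0 < L) {x : ℕ × ℕ} (hx : x ∈ treeNodes) {T : Set RiemannSphere}
    (hT : IsPreconnected T) (hTK : T ⊆ (slitDomain L)ᶜ) (hTx : (T ∩ sphereSlit L x).Nonempty) :
    T ⊆ sphereSlit L x := by
  -- The set stays closed when one slit is removed, so each slit is relatively clopen in the
  -- complement.
  have hrest : IsClosed ((fun z : ℂ => (z : RiemannSphere)) '' slitSet L (treeNodes \ {x})) :=
    ((isCompact_slitSet hL sdiff_subset).image OnePoint.continuous_coe).isClosed
  have hcover : T ⊆ sphereSlit L x ∪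
      (fun z : ℂ => (z : RiemannSphere)) '' slitSet L (treeNodes \ {x}) := by
    intro w hw
    rcases notMem_slitDomain (hTK hw) with rfl | ⟨y, hy, z, hz, rfl⟩
    · exact Or.inr ⟨0, mem_slitSet.2 (Or.inl rfl), rfl⟩
    · by_cases hxy : y = x
      · exact Or.inl ⟨z, hxy ▸ hz, rfl⟩
      · exact Or.inr ⟨z, mem_slitSet.2 (Or.inr ⟨y, ⟨hy, hxy⟩, hz⟩), rfl⟩
  have hdisj : Disjoint (sphereSlit L x)
      ((fun z : ℂ => (z : RiemannSphere)) '' slitSet L (treeNodes \ {x})) := by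
    refine (disjoint_image_iff OnePoint.coe_injective).2 (Set.disjoint_left.2 fun z hz hz' => ?_)
    rcases mem_slitSet.1 hz' with rfl | ⟨y, ⟨hy, hyx⟩, hzy⟩
    · exact zero_notMem_slit x hz
    · exact hyx (eq_of_mem_slit hy hx hzy hz)
  rcases isPreconnected_iff_subset_of_disjoint_closed.1 hT _ _
    (isCompact_sphereSlit x).isClosed hrest hcover (by rw [hdisj.inter_eq, inter_empty]) with h | h
  · exact h
  · obtain ⟨w, hwT, hwx⟩ := hTx
    exact absurd (h hwT) (Set.disjoint_left.1 hdisj hwx)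

lemma connectedComponentIn_of_mem_sphereSlit (hL : 0 < L) {x : ℕ × ℕ} (hx : x ∈ treeNodes)
    {w : RiemannSphere} (hw : w ∈ sphereSlit L x) :
    connectedComponentIn (slitDomain L)ᶜ w = sphereSlit L x := by
  have hwK := sphereSlit_subset_compl hx hw
  refine Subset.antisymm ?_ ?_
  · exact subset_sphereSlit hL hx isPreconnected_connectedComponentIn
      (connectedComponentIn_subset _ _) ⟨w, mem_connectedComponentIn hwK, hw⟩
  · exact (isPreconnected_sphereSlit x).subset_connectedComponentIn hw (sphereSlit_subset_compl hx)

lemma zero_notMem_sphereSlit (x : ℕ × ℕ) : ((0 : ℂ) : RiemannSphere) ∉ sphereSlit L x := by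
  intro h
  exact zero_notMem_slit x (OnePoint.coe_injective.mem_set_image.1 h)

/-- A connected subset of the complement that meets a slit stays inside it, and no slit contains
`0`. -/
lemma connectedComponentIn_zero (hL : 0 < L) :
    connectedComponentIn (slitDomain L)ᶜ ((0 : ℂ) : RiemannSphere) =
      {((0 : ℂ) : RiemannSphere)} := by
  have h0 : ((0 : ℂ) : RiemannSphere) ∈ (slitDomain L)ᶜ := zero_notMem_slitDomain
  refine Subset.antisymm ?_ (singleton_subset_iff.2 (mem_connectedComponentIn h0))
  intro w hw
  rcases notMem_slitDomain (connectedComponentIn_subset _ _ hw) with h | ⟨x, hx, hwx⟩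
  · exact h
  · have := subset_sphereSlit hL hx isPreconnected_connectedComponentIn
      (connectedComponentIn_subset _ _) ⟨w, hw, hwx⟩ (mem_connectedComponentIn h0)
    exact absurd this (zero_notMem_sphereSlit x)

/-- The complementary components of the slit domain, indexed by the nodes and `none` (for `0`). -/
noncomputable def slitComponent (L : ℝ) : Option treeNodes → Set RiemannSphere
  | none => {((0 : ℂ) : RiemannSphere)}
  | some x => sphereSlit L x

lemma complComponents_slitDomain (hL : 0 < L) :
    complComponents (slitDomain L) = range (slitComponent L) := by
  ext p
  constructor
  · rintro ⟨w, hw, rfl⟩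
    rcases notMem_slitDomain hw with rfl | ⟨x, hx, hwx⟩
    · exact ⟨none, (connectedComponentIn_zero hL).symm⟩
    · exact ⟨some ⟨x, hx⟩, (connectedComponentIn_of_mem_sphereSlit hL hx hwx).symm⟩
  · rintro ⟨_ | ⟨x, hx⟩, rfl⟩
    · exact ⟨_, zero_notMem_slitDomain, (connectedComponentIn_zero hL).symm⟩
    · obtain ⟨w, hw⟩ := (nonempty_slit hL.le x).image (fun z : ℂ => (z : RiemannSphere))
      exact ⟨w, sphereSlit_subset_compl hx hw,
        (connectedComponentIn_of_mem_sphereSlit hL hx hw).symm⟩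

lemma sphDiam_sphereSlit_le (x : ℕ × ℕ) :
    sphDiam (sphereSlit L x) ≤ 8 * Real.exp (-L * x.1 + 1) := by
  refine sphDiam_le (by positivity) ?_
  rintro _ ⟨z, hz, rfl⟩ _ ⟨w, hw, rfl⟩
  have h1 := sphDist_coe_le z w
  have h2 := norm_sub_le z w
  have h3 := norm_le_of_mem_slit hz
  have h4 := norm_le_of_mem_slit hw
  linarith

/-- Each of the `2 ^ n` slits of level `n` contributes at most a constant times `exp (-α * L * n) ≤
exp (-n)`, and `2 / e < 1`. -/
lemma summable_sphDiam_slitComponent {α : ℝ} (hα : 0 < α) (hLα : 1 ≤ α * L) :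
    Summable fun i => sphDiam (slitComponent L i) ^ α := by
  have hsome : Summable fun x : treeNodes => sphDiam (sphereSlit L x) ^ α := by
    let e : (Σ n : ℕ, Fin (2 ^ n)) ≃ treeNodes :=
      { toFun := fun a => ⟨(a.1, a.2), a.2.2⟩
        invFun := fun x => ⟨x.1.1, ⟨x.1.2, x.2⟩⟩
        left_inv := fun _ => rfl
        right_inv := fun _ => rfl }
    rw [← e.summable_iff]
    have hnn : ∀ a, 0 ≤ ((fun x : treeNodes => sphDiam (sphereSlit L x) ^ α) ∘ e) a :=
      fun a => Real.rpow_nonneg (sphDiam_nonneg _) _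
    have hbound : ∀ (n : ℕ) (j : Fin (2 ^ n)),
        ((fun x : treeNodes => sphDiam (sphereSlit L x) ^ α) ∘ e) ⟨n, j⟩ ≤
          (8 * Real.exp 1) ^ α * Real.exp (-1) ^ n := by
      intro n j
      have h1 : sphDiam (sphereSlit L (n, (j : ℕ))) ≤ 8 * Real.exp 1 * Real.exp (-L * n) := by
        refine (sphDiam_sphereSlit_le _).trans_eq ?_
        rw [mul_assoc, ← Real.exp_add, add_comm]
      refine (Real.rpow_le_rpow (sphDiam_nonneg _) h1 hα.le).trans ?_
      rw [Real.mul_rpow (by positivity) (by positivity), ← Real.exp_mul, ← Real.exp_nat_mul]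
      refine mul_le_mul_of_nonneg_left (Real.exp_le_exp.2 ?_) (by positivity)
      have : (0 : ℝ) ≤ n := by positivity
      nlinarith
    rw [summable_sigma_of_nonneg hnn]
    refine ⟨fun n => (hasSum_fintype _).summable, ?_⟩
    have hgeo : Summable fun n : ℕ => (8 * Real.exp 1) ^ α * (2 * Real.exp (-1)) ^ n := by
      refine (summable_geometric_of_lt_one (by positivity) ?_).mul_left _
      rw [Real.exp_neg, ← div_eq_mul_inv, div_lt_one (Real.exp_pos 1)]
      have := Real.exp_one_gt_d9
      linarith
    refine Summable.of_nonneg_of_le (fun n => tsum_nonneg fun j => hnn _) (fun n => ?_) hgeo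
    rw [tsum_fintype]
    refine (Finset.sum_le_card_nsmul _ _ _ fun j _ => hbound n j).trans_eq ?_
    rw [Finset.card_univ, Fintype.card_fin, nsmul_eq_mul, mul_pow]
    push_cast
    ring
  -- The component `{0}` contributes `0 ^ α`, which is `0` because `α ≠ 0`.
  have h0 : Summable fun i : Option treeNodes => sphDiam (slitComponent L i) ^ α := by
    rw [← (Function.Injective.summable_iff (Option.some_injective treeNodes) ?_)]
    · exact hsome
    · rintro (_ | x) hx
      · simp only [slitComponent, sphDiam_singleton]
        exact Real.zero_rpow hα.ne'
      · exact absurd ⟨x, rfl⟩ hx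
  exact h0

end RiemannSphere

namespace RiemannSphere

open Filter Set Topology

variable {L : ℝ}

/-! ### Connectivity of the slit domain -/

/-- The left half plane bounded by `M`, without the slits in logarithmic coordinates. -/
noncomputable def logSlitDomain (L M : ℝ) : Set ℂ :=
  {ζ | ζ.re < M ∧ Complex.exp ζ ∉ slitSet L treeNodes}

lemma isOpen_logSlitDomain (hL : 0 < L) (M : ℝ) : IsOpen (logSlitDomain L M) :=
  (isOpen_lt Complex.continuous_re continuous_const).inter
    ((isClosed_slitSet hL subset_rfl).isOpen_compl.preimage Complex.continuous_exp)

/-- The ordinates of the slits in logarithmic coordinates. -/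
def slitOrdinates : Set ℝ := {y | ∃ x : ℕ × ℕ, ∃ k : ℤ, y = treeAngle x.1 x.2 + k * (2 * Real.pi)}

lemma countable_slitOrdinates : slitOrdinates.Countable := by
  have : slitOrdinates = range fun a : (ℕ × ℕ) × ℤ =>
      treeAngle a.1.1 a.1.2 + a.2 * (2 * Real.pi) := by
    ext y
    simp [slitOrdinates, eq_comm]
  rw [this]
  exact countable_range _

lemma exists_of_exp_mem_slitSet {ζ : ℂ} (h : Complex.exp ζ ∈ slitSet L treeNodes) :
    ∃ x ∈ treeNodes, ∃ k : ℤ, ζ.im = treeAngle x.1 x.2 + k * (2 * Real.pi) ∧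
      -L * (x.1 + 1) ≤ ζ.re := by
  rcases mem_slitSet.1 h with h | ⟨x, hx, ξ, ⟨h1, h2, h3⟩, hξ⟩
  · exact absurd h (Complex.exp_ne_zero ζ)
  · obtain ⟨k, rfl⟩ := Complex.exp_eq_exp_iff_exists_int.1 hξ.symm
    refine ⟨x, hx, k, ?_, ?_⟩
    · simp [h1]
    · simpa using h2

lemma exp_notMem_slitSet {ζ : ℂ} (h : ζ.im ∉ slitOrdinates) :
    Complex.exp ζ ∉ slitSet L treeNodes := by
  intro hmem
  obtain ⟨x, -, k, hk, -⟩ := exists_of_exp_mem_slitSet hmem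
  exact h ⟨x, k, hk⟩

/-- On every horizontal line the points far to the left avoid the slits. -/
lemma exists_ray_subset (M y : ℝ) :
    ∃ b, ∀ x < b, (⟨x, y⟩ : ℂ) ∈ logSlitDomain L M := by
  by_cases hy : ∃ x ∈ treeNodes, ∃ k : ℤ, y = treeAngle x.1 x.2 + k * (2 * Real.pi)
  · obtain ⟨x, hx, k, hk⟩ := hy
    refine ⟨min M (-L * (x.1 + 1)), fun t ht => ⟨ht.trans_le (min_le_left _ _), fun hmem => ?_⟩⟩
    obtain ⟨x', hx', k', hk', hre⟩ := exists_of_exp_mem_slitSet hmem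
    -- All angles lie in `(0, 1)` and the period exceeds `1`, so the height determines the
    -- translate, then the angle, and then the level. Hence all slit points at this height share one
    -- left bound.
    have hkk : k = k' := by
      have h1 := treeAngle_pos x.1 x.2
      have h2 := treeAngle_lt_one hx
      have h3 := treeAngle_pos x'.1 x'.2
      have h4 := treeAngle_lt_one hx'
      have hpi := Real.pi_gt_three
      have heq : treeAngle x.1 x.2 + k * (2 * Real.pi) =
        treeAngle x'.1 x'.2 + k' * (2 * Real.pi) := hk.symm.trans hk'
      have h5 : (k : ℝ) - k' < 1 := by
        by_contra hc
        push Not at hc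
        nlinarith
      have h6 : (-1 : ℝ) < k - k' := by
        by_contra hc
        push Not at hc
        nlinarith
      have h5' : k - k' < 1 := by exact_mod_cast h5
      have h6' : -1 < k - k' := by exact_mod_cast h6
      omega
    subst hkk
    have hang : treeAngle x.1 x.2 = treeAngle x'.1 x'.2 := by
      have heq : treeAngle x.1 x.2 + k * (2 * Real.pi) =
        treeAngle x'.1 x'.2 + k * (2 * Real.pi) := hk.symm.trans hk'
      linarith
    obtain ⟨hn, -⟩ := treeAngle_injective hang
    rw [← hn] at hre
    exact absurd (ht.trans_le (min_le_right _ _)) (not_lt.2 hre)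
  · refine ⟨M, fun t ht => ⟨ht, fun hmem => ?_⟩⟩
    obtain ⟨x, hx, k, hk, -⟩ := exists_of_exp_mem_slitSet hmem
    exact hy ⟨x, hx, k, hk⟩

lemma isPreconnected_horizontal {s : Set ℝ} (hs : IsPreconnected s) (y : ℝ) :
    IsPreconnected ((fun t : ℝ => (⟨t, y⟩ : ℂ)) '' s) :=
  hs.image _ (continuous_horizontal y).continuousOn

/-- All but countably many horizontal lines avoid the slits, and every line avoids them far to the
left. Given a separation, heights are sorted by the part that contains the left end of their line;
both classes turn out to be open in `ℝ`, so one of them is empty. -/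
lemma isPreconnected_logSlitDomain (hL : 0 < L) (M : ℝ) :
    IsPreconnected (logSlitDomain L M) := by
  set G := logSlitDomain L M with hG
  have hGo : IsOpen G := isOpen_logSlitDomain hL M
  have hdense : Dense slitOrdinatesᶜ := countable_slitOrdinates.dense_compl ℝ
  have hline : ∀ y ∉ slitOrdinates, ∀ x < M, (⟨x, y⟩ : ℂ) ∈ G :=
    fun y hy x hx => ⟨hx, exp_notMem_slitSet hy⟩
  rw [isPreconnected_iff_subset_of_disjoint]
  intro u v hu hv huv hdisj
  have hnot : ∀ z ∈ G, z ∈ u → z ∉ v := fun z hz hzu hzv => by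
    have : z ∈ G ∩ (u ∩ v) := ⟨hz, hzu, hzv⟩
    rw [hdisj] at this
    exact this
  have hset : ∀ w : Set ℂ, ∀ T : Set ℂ, IsPreconnected T → T ⊆ G → (T ∩ w).Nonempty →
      (w = u ∨ w = v) → T ⊆ w := by
    intro w T hT hTG hTw hw
    rcases isPreconnected_iff_subset_of_disjoint.1 hT u v hu hv (hTG.trans huv)
      (subset_empty_iff.1 (hdisj ▸ inter_subset_inter_left _ hTG)) with h | h
    · rcases hw with rfl | rfl
      · exact h
      · obtain ⟨z, hz, hzv⟩ := hTw
        exact absurd hzv (hnot z (hTG hz) (h hz))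
    · rcases hw with rfl | rfl
      · obtain ⟨z, hz, hzu⟩ := hTw
        exact absurd (h hz) (hnot z (hTG hz) hzu)
      · exact h
  let S : Set ℂ → Set ℝ := fun w => {y | ∃ b, ∀ x < b, (⟨x, y⟩ : ℂ) ∈ w ∩ G}
  have hcover : ∀ y, y ∈ S u ∨ y ∈ S v := by
    intro y
    obtain ⟨b, hb⟩ := exists_ray_subset (L := L) M y
    have hT := isPreconnected_horizontal (isPreconnected_Iio (a := b)) y
    have hTG : (fun t : ℝ => (⟨t, y⟩ : ℂ)) '' Iio b ⊆ G := by
      rintro _ ⟨t, ht, rfl⟩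
      exact hb t ht
    rcases isPreconnected_iff_subset_of_disjoint.1 hT u v hu hv (hTG.trans huv)
      (subset_empty_iff.1 (hdisj ▸ inter_subset_inter_left _ hTG)) with h | h
    · exact Or.inl ⟨b, fun x hx => ⟨h ⟨x, hx, rfl⟩, hb x hx⟩⟩
    · exact Or.inr ⟨b, fun x hx => ⟨h ⟨x, hx, rfl⟩, hb x hx⟩⟩
  have hSdisj : ∀ y, y ∈ S u → y ∉ S v := by
    rintro y ⟨b, hb⟩ ⟨b', hb'⟩
    have h1 := hb (min b b' - 1) (by linarith [min_le_left b b'])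
    have h2 := hb' (min b b' - 1) (by linarith [min_le_right b b'])
    exact hnot _ h1.2 h1.1 h2.1
  -- Generic lines are connected, so a generic height close to a point of `w` belongs to the class
  -- of `w`.
  have hgen : ∀ w, IsOpen w → (w = u ∨ w = v) → ∀ z ∈ w ∩ G,
      ∀ᶠ y' in 𝓝 z.im, y' ∉ slitOrdinates → y' ∈ S w := by
    intro w hwo hw z hz
    have hcont : Tendsto (fun y' : ℝ => (⟨z.re, y'⟩ : ℂ)) (𝓝 z.im) (𝓝 z) := by
      have : Continuous fun y' : ℝ => (⟨z.re, y'⟩ : ℂ) := by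
        have h : (fun t : ℝ => (⟨z.re, t⟩ : ℂ)) = fun t : ℝ => (z.re : ℂ) + t * Complex.I := by
          ext t
          exact Complex.mk_eq_add_mul_I _ _
        rw [h]
        fun_prop
      exact this.tendsto z.im
    filter_upwards [hcont ((hwo.inter hGo).mem_nhds hz)] with y' hy' hgen'
    have hTG : (fun t : ℝ => (⟨t, y'⟩ : ℂ)) '' Iio M ⊆ G := by
      rintro _ ⟨t, ht, rfl⟩
      exact hline y' hgen' t ht
    have hsub := hset w _ (isPreconnected_horizontal (isPreconnected_Iio (a := M)) y') hTG
      ⟨_, ⟨z.re, hz.2.1, rfl⟩, hy'.1⟩ hw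
    exact ⟨M, fun x hx => ⟨hsub ⟨x, hx, rfl⟩, hTG ⟨x, hx, rfl⟩⟩⟩
  have hpoint : ∀ w y, y ∈ S w → ∃ z ∈ w ∩ G, z.im = y := by
    rintro w y ⟨b, hb⟩
    exact ⟨_, hb (b - 1) (by linarith), rfl⟩
  -- An exceptional height close to `y` but in the other class would have generic heights nearby
  -- lying in both classes.
  have hopen : ∀ w w', IsOpen w → (w = u ∨ w = v) → IsOpen w' → (w' = u ∨ w' = v) →
      (∀ y, y ∈ S w ∨ y ∈ S w') → (∀ y, y ∈ S w → y ∉ S w') → IsOpen (S w) := by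
    intro w w' hwo hw hwo' hw' hcov hdis
    rw [isOpen_iff_mem_nhds]
    intro y hy
    obtain ⟨z, hz, rfl⟩ := hpoint w y hy
    filter_upwards [(hgen w hwo hw z hz).eventually_nhds] with y' hy'
    refine (hcov y').resolve_right fun hyv => ?_
    obtain ⟨z', hz', rfl⟩ := hpoint w' y' hyv
    obtain ⟨y'', hy'', hy1, hy2⟩ := ((mem_closure_iff_frequently.1 (hdense z'.im)).and_eventually
      (hy'.and (hgen w' hwo' hw' z' hz'))).exists
    exact hdis y'' (hy1 hy'') (hy2 hy'')
  have hSu : IsOpen (S u) := hopen u v hu (Or.inl rfl) hv (Or.inr rfl) hcover hSdisj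
  have hSv : IsOpen (S v) := hopen v u hv (Or.inr rfl) hu (Or.inl rfl) (fun y => (hcover y).symm)
    fun y hyv hyu => hSdisj y hyu hyv
  -- A point in the other part would force nearby generic heights into the empty class.
  have hfinal : ∀ w w', IsOpen w' → (w' = u ∨ w' = v) → (∀ y, y ∈ S w → y ∉ S w') →
      S w = univ → G ⊆ w ∪ w' → G ⊆ w := by
    intro w w' hwo' hw' hdis huniv hsub z hz
    refine (hsub hz).resolve_right fun hzv => ?_
    obtain ⟨y, hy, hy'⟩ := ((mem_closure_iff_frequently.1 (hdense z.im)).and_eventually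
      (hgen w' hwo' hw' z ⟨hzv, hz⟩)).exists
    exact hdis y (huniv ▸ mem_univ y) (hy' hy)
  rcases isPreconnected_iff_subset_of_disjoint.1 (isPreconnected_univ (α := ℝ)) (S u) (S v) hSu hSv
    (fun y _ => hcover y) (by
      rw [univ_inter, ← disjoint_iff_inter_eq_empty]
      exact Set.disjoint_left.2 hSdisj) with h | h
  · exact Or.inl (hfinal u v hv (Or.inr rfl) hSdisj (univ_subset_iff.1 h) huv)
  · exact Or.inr (hfinal v u hu (Or.inl rfl) (fun y hyv hyu => hSdisj y hyu hyv)
      (univ_subset_iff.1 h) (by rwa [union_comm]))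

lemma exp_image_logSlitDomain (M : ℝ) :
    Complex.exp '' logSlitDomain L M = {z | ‖z‖ < Real.exp M ∧ z ∉ slitSet L treeNodes} := by
  ext z
  constructor
  · rintro ⟨ζ, ⟨h1, h2⟩, rfl⟩
    refine ⟨?_, h2⟩
    rw [Complex.norm_exp]
    exact Real.exp_lt_exp.2 h1
  · rintro ⟨h1, h2⟩
    have hz : z ≠ 0 := fun h => h2 (mem_slitSet.2 (Or.inl h))
    refine ⟨Complex.log z, ⟨?_, ?_⟩, Complex.exp_log hz⟩
    · rw [Complex.log_re]
      exact (Real.log_lt_iff_lt_exp (norm_pos_iff.2 hz)).2 h1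
    · rwa [Complex.exp_log hz]

lemma isPreconnected_ball_diff_slitSet (hL : 0 < L) (M : ℝ) :
    IsPreconnected {z : ℂ | ‖z‖ < Real.exp M ∧ z ∉ slitSet L treeNodes} := by
  rw [← exp_image_logSlitDomain]
  exact (isPreconnected_logSlitDomain hL M).image _ Complex.continuous_exp.continuousOn

/-- Rotating a nonzero point by any of all but countably many small angles moves it off the slits;
`0` is a limit of nonzero points. -/
lemma dense_compl_slitSet : Dense (slitSet L treeNodes)ᶜ := by
  have hnz : ∀ z : ℂ, z ≠ 0 → z ∈ closure (slitSet L treeNodes)ᶜ := by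
    intro z hz
    have hcont : Continuous fun y : ℝ => Complex.exp (Complex.log z + y * Complex.I) := by fun_prop
    have ht : Tendsto (fun y : ℝ => Complex.exp (Complex.log z + y * Complex.I)) (𝓝 0) (𝓝 z) := by
      have := hcont.tendsto 0
      simpa [Complex.exp_log hz] using this
    have hd : ∃ᶠ y in 𝓝 (0 : ℝ), (Complex.log z).im + y ∉ slitOrdinates := by
      have hcount : {y | (Complex.log z).im + y ∈ slitOrdinates}.Countable :=
        countable_slitOrdinates.preimage (add_right_injective _)
      exact mem_closure_iff_frequently.1 (hcount.dense_compl ℝ 0)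
    rw [mem_closure_iff_frequently]
    refine ht.frequently (hd.mono fun y hy => exp_notMem_slitSet ?_)
    simpa using hy
  intro z
  by_cases hz : z = 0
  · subst hz
    have h0 : (0 : ℂ) ∈ closure ({0}ᶜ : Set ℂ) := (dense_compl_singleton 0) 0
    exact closure_minimal (fun w hw => hnz w hw) isClosed_closure h0
  · exact hnz z hz

lemma coe_compl_slitSet_subset :
    (fun z : ℂ => (z : RiemannSphere)) '' (slitSet L treeNodes)ᶜ ⊆ slitDomain L := by
  rintro _ ⟨z, hz, rfl⟩
  exact coe_mem_slitDomain.2 hz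

lemma dense_coe_compl_slitSet :
    Dense ((fun z : ℂ => (z : RiemannSphere)) '' (slitSet L treeNodes)ᶜ) :=
  OnePoint.denseRange_coe.dense_image OnePoint.continuous_coe dense_compl_slitSet

lemma dense_slitDomain : Dense (slitDomain L) :=
  dense_coe_compl_slitSet.mono coe_compl_slitSet_subset

lemma isPreconnected_compl_slitSet (hL : 0 < L) : IsPreconnected (slitSet L treeNodes)ᶜ := by
  refine isPreconnected_of_forall_pair fun z hz w hw => ?_
  obtain ⟨n, hn⟩ := exists_nat_gt (max ‖z‖ ‖w‖)
  have hexp : (n : ℝ) < Real.exp n := by linarith [Real.add_one_le_exp (n : ℝ)]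
  refine ⟨_, fun v hv => hv.2, ?_, ?_, isPreconnected_ball_diff_slitSet hL n⟩
  · exact ⟨((le_max_left _ _).trans_lt hn).trans hexp, hz⟩
  · exact ⟨((le_max_right _ _).trans_lt hn).trans hexp, hw⟩

/-- The domain lies between a connected planar set and its closure, which is the whole sphere. -/
lemma isSphereDomain_slitDomain (hL : 0 < L) : IsSphereDomain (slitDomain L) := by
  refine ⟨isOpen_slitDomain hL, ⟨∞, infty_mem_slitDomain⟩, ?_⟩
  exact ((isPreconnected_compl_slitSet hL).image _
    OnePoint.continuous_coe.continuousOn).subset_closure coe_compl_slitSet_subset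
      fun w _ => dense_coe_compl_slitSet w

lemma isEllDomain_slitDomain {α : ℝ} (hα : 0 < α) (hL : 0 < L) (hLα : 1 ≤ α * L) :
    IsEllDomain α (slitDomain L) := by
  refine ⟨isSphereDomain_slitDomain hL, ?_, ?_⟩
  · rw [complComponents_slitDomain hL]
    have : Countable treeNodes := inferInstance
    exact countable_range _
  · have hsurj : ∀ p : complComponents (slitDomain L), ∃ i, slitComponent L i = p := by
      rintro ⟨p, hp⟩
      rwa [complComponents_slitDomain hL] at hp
    choose s hs using hsurj
    have hinj : Function.Injective s := fun p q h => Subtype.ext (by rw [← hs p, ← hs q, h])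
    refine ((summable_sphDiam_slitComponent hα hLα).comp_injective hinj).congr fun p => ?_
    simp [hs]

lemma zero_mem_pointComponents_slitDomain (hL : 0 < L) :
    {((0 : ℂ) : RiemannSphere)} ∈ pointComponents (slitDomain L) :=
  ⟨⟨_, zero_notMem_slitDomain, (connectedComponentIn_zero hL).symm⟩, by
    rw [sphDiam_singleton]
    exact lt_irrefl 0⟩

end RiemannSphere

namespace RiemannSphere

open Filter Set Topology

/-! ### Winding numbers of the images of circles under functions on an annulus -/

/-- The open annulus `1 < |ξ| < T`. -/
def annulus (T : ℝ) : Set ℂ := {ξ | 1 < ‖ξ‖ ∧ ‖ξ‖ < T}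

lemma isOpen_annulus (T : ℝ) : IsOpen (annulus T) :=
  (isOpen_lt continuous_const continuous_norm).inter (isOpen_lt continuous_norm continuous_const)

lemma sphere_subset_annulus {t T : ℝ} (h1 : 1 < t) (h2 : t < T) :
    Metric.sphere (0 : ℂ) t ⊆ annulus T := by
  intro ξ hξ
  rw [mem_sphere_zero_iff_norm] at hξ
  exact ⟨hξ ▸ h1, hξ ▸ h2⟩

lemma annulus_eq_image_exp {T : ℝ} (hT : 0 < T) :
    annulus T = Complex.exp '' (Complex.re ⁻¹' Ioo 0 (Real.log T)) := by
  ext ξ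
  constructor
  · rintro ⟨h1, h2⟩
    have h0 : ξ ≠ 0 := norm_pos_iff.1 (one_pos.trans h1)
    refine ⟨Complex.log ξ, ?_, Complex.exp_log h0⟩
    rw [mem_preimage, Complex.log_re]
    exact ⟨Real.log_pos h1, Real.log_lt_log (one_pos.trans h1) h2⟩
  · rintro ⟨ζ, ⟨h1, h2⟩, rfl⟩
    refine ⟨?_, ?_⟩
    · rw [Complex.norm_exp]
      exact Real.one_lt_exp_iff.2 h1
    · rw [Complex.norm_exp]
      exact (Real.lt_log_iff_exp_lt hT).1 h2

lemma isPreconnected_annulus {T : ℝ} (hT : 0 < T) : IsPreconnected (annulus T) := by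
  rw [annulus_eq_image_exp hT]
  refine IsPreconnected.image ?_ _ Complex.continuous_exp.continuousOn
  exact ((convex_Ioo _ _).linear_preimage Complex.reLm).isPreconnected

/-- `2πi` times the winding number around `w` of the image under `g` of the circle of radius `t`. -/
noncomputable def winding (g : ℂ → ℂ) (t : ℝ) (w : RiemannSphere) : ℂ :=
  w.elim 0 fun w => ∮ ξ in C(0, t), deriv g ξ / (g ξ - w)

lemma winding_coe (g : ℂ → ℂ) (t : ℝ) (w : ℂ) :
    winding g t w = ∮ ξ in C(0, t), deriv g ξ / (g ξ - w) := rfl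

lemma winding_infty (g : ℂ → ℂ) (t : ℝ) : winding g t ∞ = 0 := rfl

variable {g : ℂ → ℂ} {T : ℝ}

lemma _root_.DifferentiableOn.hasDerivAt_annulus (hg : DifferentiableOn ℂ g (annulus T)) {ξ : ℂ}
    (hξ : ξ ∈ annulus T) : HasDerivAt g (deriv g ξ) ξ :=
  (hg.differentiableAt ((isOpen_annulus T).mem_nhds hξ)).hasDerivAt

lemma continuousOn_winding_integrand (hg : DifferentiableOn ℂ g (annulus T)) {s : Set ℂ}
    (hs : s ⊆ annulus T) {w : ℂ} (hw : ∀ ξ ∈ s, g ξ ≠ w) :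
    ContinuousOn (fun ξ => deriv g ξ / (g ξ - w)) s :=
  ((hg.deriv (isOpen_annulus T)).continuousOn.mono hs).div
    ((hg.continuousOn.mono hs).sub continuousOn_const) fun ξ hξ => sub_ne_zero.2 (hw ξ hξ)

/-- The difference of the integrands is the logarithmic derivative of `(g - w) / (g - w₀)`. This
quotient stays within distance `1` of `1`, so the principal logarithm is a primitive along the
circle. -/
lemma winding_eq_of_norm_lt (hg : DifferentiableOn ℂ g (annulus T)) {t : ℝ} (h1 : 1 < t)
    (h2 : t < T) {w₀ w : ℂ} (hw : ∀ ξ ∈ Metric.sphere (0 : ℂ) t, ‖w - w₀‖ < ‖g ξ - w₀‖) :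
    winding g t w = winding g t w₀ := by
  have ht : 0 ≤ t := by linarith
  have hsub := sphere_subset_annulus h1 h2
  have hne₀ : ∀ ξ ∈ Metric.sphere (0 : ℂ) t, g ξ ≠ w₀ := fun ξ hξ h => by
    have := hw ξ hξ
    rw [h, sub_self, norm_zero] at this
    exact absurd this (not_lt.2 (norm_nonneg _))
  have hne : ∀ ξ ∈ Metric.sphere (0 : ℂ) t, g ξ ≠ w := fun ξ hξ h => by
    have := hw ξ hξ
    rw [h] at this
    exact lt_irrefl _ this
  rw [winding_coe, winding_coe, ← sub_eq_zero, ← circleIntegral.integral_sub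
    ((continuousOn_winding_integrand hg hsub hne).circleIntegrable ht)
    ((continuousOn_winding_integrand hg hsub hne₀).circleIntegrable ht)]
  refine circleIntegral.integral_eq_zero_of_hasDerivWithinAt
    (f := fun ξ => Complex.log ((g ξ - w) / (g ξ - w₀))) ht fun ξ hξ => ?_
  have hd := hg.hasDerivAt_annulus (hsub hξ)
  have hp : g ξ - w ≠ 0 := sub_ne_zero.2 (hne ξ hξ)
  have hp₀ : g ξ - w₀ ≠ 0 := sub_ne_zero.2 (hne₀ ξ hξ)
  have hslit : (g ξ - w) / (g ξ - w₀) ∈ Complex.slitPlane := by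
    have heq : (g ξ - w) / (g ξ - w₀) = 1 + -((w - w₀) / (g ξ - w₀)) := by
      field_simp
      ring
    rw [heq]
    refine Complex.mem_slitPlane_of_norm_lt_one ?_
    rw [norm_neg, norm_div, div_lt_one (norm_pos_iff.2 hp₀)]
    exact hw ξ hξ
  have hdiv : HasDerivAt (fun ξ => (g ξ - w) / (g ξ - w₀))
      ((deriv g ξ * (g ξ - w₀) - (g ξ - w) * deriv g ξ) / (g ξ - w₀) ^ 2) ξ :=
    (hd.sub_const w).div (hd.sub_const w₀) hp₀
  convert (hdiv.clog hslit).hasDerivWithinAt using 1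
  field_simp

/-- The integrand is the logarithmic derivative of `1 - g / w`, which stays within distance `1` of
`1`. -/
lemma winding_eq_zero_of_norm_lt (hg : DifferentiableOn ℂ g (annulus T)) {t : ℝ} (h1 : 1 < t)
    (h2 : t < T) {w : ℂ} (hw : ∀ ξ ∈ Metric.sphere (0 : ℂ) t, ‖g ξ‖ < ‖w‖) :
    winding g t w = 0 := by
  have ht : 0 ≤ t := by linarith
  have hsub := sphere_subset_annulus h1 h2
  rw [winding_coe]
  refine circleIntegral.integral_eq_zero_of_hasDerivWithinAt
    (f := fun ξ => Complex.log (1 + -(g ξ / w))) ht fun ξ hξ => ?_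
  have hd := hg.hasDerivAt_annulus (hsub hξ)
  have hw0 : 0 < ‖w‖ := (norm_nonneg _).trans_lt (hw ξ hξ)
  have hw0' : w ≠ 0 := norm_pos_iff.1 hw0
  have hp : g ξ - w ≠ 0 := by
    intro h
    have := hw ξ hξ
    rw [sub_eq_zero.1 h] at this
    exact lt_irrefl _ this
  have hslit : 1 + -(g ξ / w) ∈ Complex.slitPlane := by
    refine Complex.mem_slitPlane_of_norm_lt_one ?_
    rw [norm_neg, norm_div, div_lt_one hw0]
    exact hw ξ hξ
  have hsum : HasDerivAt (fun ξ => 1 + -(g ξ / w)) (-(deriv g ξ / w)) ξ :=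
    ((hd.div_const w).neg).const_add 1
  convert (hsum.clog hslit).hasDerivWithinAt using 1
  have hp2 : 1 + -(g ξ / w) ≠ 0 := Complex.slitPlane_ne_zero hslit
  have hp3 : w - g ξ ≠ 0 := fun h => hp (by rw [← neg_sub, h, neg_zero])
  have hfrac : 1 + -(g ξ / w) = -(g ξ - w) / w := by
    field_simp
    ring
  rw [hfrac]
  field_simp

/-- The winding number is locally constant off the image of the circle. -/
lemma eventually_winding_eq (hg : DifferentiableOn ℂ g (annulus T)) {t : ℝ} (h1 : 1 < t)
    (h2 : t < T) {w₀ : RiemannSphere}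
    (hw₀ : ∀ ξ ∈ Metric.sphere (0 : ℂ) t, (g ξ : RiemannSphere) ≠ w₀) :
    ∀ᶠ w in 𝓝 w₀, winding g t w = winding g t w₀ := by
  have hsub := sphere_subset_annulus h1 h2
  have hcont : ContinuousOn g (Metric.sphere (0 : ℂ) t) := hg.continuousOn.mono hsub
  have hne : (Metric.sphere (0 : ℂ) t).Nonempty := NormedSpace.sphere_nonempty.2 (by linarith)
  induction w₀ using OnePoint.rec with
  | coe w₀ =>
    rw [OnePoint.nhds_coe_eq, eventually_map]
    obtain ⟨ξ₀, hξ₀, hmin⟩ := (isCompact_sphere (0 : ℂ) t).exists_isMinOn hne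
      ((hcont.sub continuousOn_const).norm (E := ℂ) (f := fun ξ => g ξ - w₀))
    have hpos : 0 < ‖g ξ₀ - w₀‖ := by
      rw [norm_pos_iff, sub_ne_zero]
      exact fun h => hw₀ ξ₀ hξ₀ (by rw [h])
    filter_upwards [Metric.ball_mem_nhds w₀ hpos] with w hw
    rw [mem_ball_iff_norm] at hw
    exact winding_eq_of_norm_lt hg h1 h2 fun ξ hξ => hw.trans_le (hmin hξ)
  | infty =>
    -- The value `0` assigned to `∞` is the winding number around all points of large modulus, so
    -- local constancy extends to `∞`.
    rw [winding_infty, OnePoint.nhds_infty_eq, eventually_sup, eventually_map, eventually_pure]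
    refine ⟨?_, winding_infty g t⟩
    obtain ⟨ξ₀, hξ₀, hmax⟩ := (isCompact_sphere (0 : ℂ) t).exists_isMaxOn hne hcont.norm
    have : (Metric.closedBall (0 : ℂ) ‖g ξ₀‖)ᶜ ∈ coclosedCompact ℂ :=
      (isCompact_closedBall _ _).compl_mem_coclosedCompact_of_isClosed Metric.isClosed_closedBall
    filter_upwards [this] with w hw
    rw [mem_compl_iff, mem_closedBall_zero_iff, not_le] at hw
    exact winding_eq_zero_of_norm_lt hg h1 h2 fun ξ hξ => (hmax hξ : ‖g ξ‖ ≤ _).trans_lt hw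

lemma closedBall_diff_ball_subset_annulus {t t' : ℝ} (h1 : 1 < t) (h2 : t' < T) :
    Metric.closedBall (0 : ℂ) t' \ Metric.ball 0 t ⊆ annulus T := by
  rintro ξ ⟨h3, h4⟩
  rw [mem_closedBall_zero_iff] at h3
  rw [mem_ball_zero_iff, not_lt] at h4
  exact ⟨h1.trans_le h4, h3.trans_lt h2⟩

/-- The winding numbers of two circles around a point not in the image of the annulus between
them agree. -/
lemma winding_eq_winding (hg : DifferentiableOn ℂ g (annulus T)) {t t' : ℝ} (h1 : 1 < t)
    (h : t ≤ t') (h2 : t' < T) {w : RiemannSphere}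
    (hw : ∀ ξ : ℂ, t ≤ ‖ξ‖ → ‖ξ‖ ≤ t' → (g ξ : RiemannSphere) ≠ w) :
    winding g t' w = winding g t w := by
  induction w using OnePoint.rec with
  | infty => rfl
  | coe w =>
    have hsub := closedBall_diff_ball_subset_annulus (T := T) h1 h2
    have hw' : ∀ ξ ∈ Metric.closedBall (0 : ℂ) t' \ Metric.ball 0 t, g ξ ≠ w := by
      rintro ξ ⟨h3, h4⟩ heq
      rw [mem_closedBall_zero_iff] at h3
      rw [mem_ball_zero_iff, not_lt] at h4
      exact hw ξ h4 h3 (by rw [heq])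
    refine Complex.circleIntegral_eq_of_differentiable_on_annulus_off_countable (by linarith) h
      countable_empty (continuousOn_winding_integrand hg hsub hw') ?_
    rintro ξ ⟨⟨h3, h4⟩, -⟩
    have hξ : ξ ∈ Metric.closedBall (0 : ℂ) t' \ Metric.ball 0 t :=
      ⟨Metric.ball_subset_closedBall h3, fun h => h4 (Metric.ball_subset_closedBall h)⟩
    have hA := (isOpen_annulus T).mem_nhds (hsub hξ)
    exact ((hg.deriv (isOpen_annulus T)).differentiableAt hA).div
      ((hg.differentiableAt hA).sub_const w) (sub_ne_zero.2 (hw' ξ hξ))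

/-- The winding number jumps when the circle passes over a simple preimage of the point. -/
lemma winding_jump (hg : DifferentiableOn ℂ g (annulus T)) (hinj : InjOn g (annulus T)) {ξ₀ : ℂ}
    (hξ₀ : ξ₀ ∈ annulus T) (hd₀ : deriv g ξ₀ ≠ 0) {t t' : ℝ} (h1 : 1 < t) (ht : t < ‖ξ₀‖)
    (ht' : ‖ξ₀‖ < t') (h2 : t' < T) :
    winding g t' (g ξ₀) = winding g t (g ξ₀) + 2 * Real.pi * Complex.I := by
  have hA := isOpen_annulus T
  -- Write `g ξ - g ξ₀ = (ξ - ξ₀) * k ξ`. The factor `k` has no zero: off `ξ₀` by injectivity, at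
  -- `ξ₀` because `deriv g ξ₀ ≠ 0`. The logarithmic derivative splits accordingly, and only the
  -- linear factor produces a jump.
  set k := dslope g ξ₀ with hk
  have hkd : DifferentiableOn ℂ k (annulus T) :=
    (Complex.differentiableOn_dslope (hA.mem_nhds hξ₀)).2 hg
  have hgk : ∀ ξ, g ξ - g ξ₀ = (ξ - ξ₀) * k ξ := fun ξ => (sub_smul_dslope g ξ₀ ξ).symm
  have hk0 : ∀ ξ ∈ annulus T, k ξ ≠ 0 := by
    intro ξ hξ h
    by_cases hξξ : ξ = ξ₀
    · rw [hξξ, hk, dslope_same] at h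
      exact hd₀ h
    · have := hgk ξ
      rw [h, mul_zero, sub_eq_zero] at this
      exact hξξ (hinj hξ hξ₀ this)
  have hderiv : ∀ ξ ∈ annulus T, deriv g ξ = k ξ + (ξ - ξ₀) * deriv k ξ := by
    intro ξ hξ
    have h3 : HasDerivAt (fun ξ => (ξ - ξ₀) * k ξ) (1 * k ξ + (ξ - ξ₀) * deriv k ξ) ξ :=
      ((hasDerivAt_id ξ).sub_const ξ₀).mul (hkd.hasDerivAt_annulus hξ)
    have h4 : HasDerivAt (fun ξ => (ξ - ξ₀) * k ξ + g ξ₀) (1 * k ξ + (ξ - ξ₀) * deriv k ξ) ξ :=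
      h3.add_const _
    have h5 : (fun ξ => (ξ - ξ₀) * k ξ + g ξ₀) = g := by
      funext ξ
      rw [← hgk ξ, sub_add_cancel]
    rw [h5] at h4
    rw [h4.deriv, one_mul]
  have hsplit : ∀ s, 1 < s → s < T → s ≠ ‖ξ₀‖ →
      winding g s (g ξ₀) = (∮ ξ in C(0, s), (ξ - ξ₀)⁻¹) + ∮ ξ in C(0, s), deriv k ξ / k ξ := by
    intro s hs1 hs2 hs
    have hs0 : 0 ≤ s := by linarith
    have hsub := sphere_subset_annulus hs1 hs2
    have hne : ∀ ξ ∈ Metric.sphere (0 : ℂ) s, ξ - ξ₀ ≠ 0 := by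
      intro ξ hξ h
      rw [sub_eq_zero.1 h, mem_sphere_zero_iff_norm] at hξ
      exact hs hξ.symm
    rw [winding_coe, ← circleIntegral.integral_add]
    · refine circleIntegral.integral_congr hs0 fun ξ hξ => ?_
      have hn := hne ξ hξ
      have hkn := hk0 ξ (hsub hξ)
      change deriv g ξ / (g ξ - g ξ₀) = (ξ - ξ₀)⁻¹ + deriv k ξ / k ξ
      rw [hderiv ξ (hsub hξ), hgk]
      field_simp
    · exact ((continuousOn_id.sub continuousOn_const).inv₀ hne).circleIntegrable hs0
    · exact (((hkd.deriv hA).continuousOn.mono hsub).div (hkd.continuousOn.mono hsub)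
        fun ξ hξ => hk0 ξ (hsub hξ)).circleIntegrable hs0
  have h3 : (∮ ξ in C(0, t'), (ξ - ξ₀)⁻¹) = 2 * Real.pi * Complex.I :=
    circleIntegral.integral_sub_inv_of_mem_ball (by simpa using ht')
  have h4 : (∮ ξ in C(0, t), (ξ - ξ₀)⁻¹) = 0 := by
    have hne : ∀ ξ ∈ Metric.closedBall (0 : ℂ) t, ξ - ξ₀ ≠ 0 := by
      intro ξ hξ h
      rw [sub_eq_zero.1 h, mem_closedBall_zero_iff] at hξ
      exact absurd ht (not_lt.2 hξ)
    refine Complex.circleIntegral_eq_zero_of_differentiable_on_off_countable (by linarith)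
      countable_empty ((continuousOn_id.sub continuousOn_const).inv₀ hne) ?_
    rintro ξ ⟨hξ, -⟩
    exact (differentiableAt_id.sub_const _).inv (hne ξ (Metric.ball_subset_closedBall hξ))
  have h5 : (∮ ξ in C(0, t'), deriv k ξ / k ξ) = ∮ ξ in C(0, t), deriv k ξ / k ξ := by
    have hsub := closedBall_diff_ball_subset_annulus (T := T) h1 h2
    refine Complex.circleIntegral_eq_of_differentiable_on_annulus_off_countable (by linarith)
      (ht.trans ht').le countable_empty (((hkd.deriv hA).continuousOn.mono hsub).div
        (hkd.continuousOn.mono hsub) fun ξ hξ => hk0 ξ (hsub hξ)) ?_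
    rintro ξ ⟨⟨hξ, hξ'⟩, -⟩
    have hmem : ξ ∈ annulus T :=
      hsub ⟨Metric.ball_subset_closedBall hξ, fun h => hξ' (Metric.ball_subset_closedBall h)⟩
    exact ((hkd.deriv hA).differentiableAt (hA.mem_nhds hmem)).div
      (hkd.differentiableAt (hA.mem_nhds hmem)) (hk0 ξ hmem)
  rw [hsplit t' (h1.trans (ht.trans ht')) h2 ht'.ne',
    hsplit t h1 ((ht.trans ht').trans h2) ht.ne, h3, h4, h5]
  ring

/-- An injective holomorphic function on an annulus has simple points in every open set. -/
lemma exists_deriv_ne_zero (hg : DifferentiableOn ℂ g (annulus T)) (hinj : InjOn g (annulus T))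
    {U : Set ℂ} (hU : IsOpen U) {ξ : ℂ} (hξ : ξ ∈ U) (hξA : ξ ∈ annulus T) :
    ∃ ξ' ∈ U ∩ annulus T, deriv g ξ' ≠ 0 := by
  by_contra! hcon
  obtain ⟨r, hr, hball⟩ := Metric.isOpen_iff.1 (hU.inter (isOpen_annulus T)) ξ ⟨hξ, hξA⟩
  have hdiff : DifferentiableOn ℂ g (Metric.ball ξ r) := hg.mono fun z hz => (hball hz).2
  -- If the derivative vanished throughout, `g` would be constant on a small disk, against
  -- injectivity.
  have hconst := fun z hz => Metric.isOpen_ball.is_const_of_deriv_eq_zero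
    (convex_ball ξ r).isPreconnected hdiff
    (fun w hw => hcon w (hball hw)) (Metric.mem_ball_self hr) (y := z) hz
  have hmem : ξ + (r / 2 : ℝ) ∈ Metric.ball ξ r := by
    rw [mem_ball_iff_norm, add_sub_cancel_left, Complex.norm_real, Real.norm_of_nonneg (by linarith)]
    linarith
  have h := hinj hξA (hball hmem).2 (hconst _ hmem)
  have : ((r / 2 : ℝ) : ℂ) = 0 := by
    have h' : ξ + ((r / 2 : ℝ) : ℂ) = ξ + 0 := by rw [add_zero]; exact h.symm
    exact add_left_cancel h'
  rw [Complex.ofReal_eq_zero] at this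
  linarith

end RiemannSphere

namespace RiemannSphere

open Filter Set Topology

/-! ### Collars of the slits -/

/-- The Joukowski map with foci `c ± d`. -/
noncomputable def joukowski (c : ℂ) (d : ℝ) (ξ : ℂ) : ℂ := c + d / 2 * (ξ + ξ⁻¹)

/-- The sum of the distances to the foci `c ± d`. -/
noncomputable def focalSum (c : ℂ) (d : ℝ) (z : ℂ) : ℝ := ‖z - c - d‖ + ‖z - c + d‖

lemma continuous_focalSum (c : ℂ) (d : ℝ) : Continuous (focalSum c d) := by
  unfold focalSum
  fun_prop

/-- Circles centred at `0` go to ellipses with foci `c ± d`. The two distances are multiples of `‖ξ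
∓ 1‖ ^ 2 / ‖ξ‖`, and the parallelogram law adds them up. -/
lemma focalSum_joukowski {c : ℂ} {d : ℝ} (hd : 0 < d) {ξ : ℂ} (hξ : ξ ≠ 0) :
    focalSum c d (joukowski c d ξ) = d * (‖ξ‖ + ‖ξ‖⁻¹) := by
  have hn : 0 < ‖ξ‖ := norm_pos_iff.2 hξ
  have h1 : joukowski c d ξ - c - d = d / 2 * ((ξ - 1) ^ 2 / ξ) := by
    unfold joukowski
    field_simp
    ring
  have h2 : joukowski c d ξ - c + d = d / 2 * ((ξ + 1) ^ 2 / ξ) := by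
    unfold joukowski
    field_simp
    ring
  have h3 : ‖(d : ℂ) / 2‖ = d / 2 := by
    rw [norm_div, Complex.norm_real, Real.norm_of_nonneg hd.le, Complex.norm_two]
  have hpar : ‖ξ - 1‖ ^ 2 + ‖ξ + 1‖ ^ 2 = 2 * (‖ξ‖ ^ 2 + 1) := by
    have h := parallelogram_law_with_norm ℝ ξ 1
    rw [norm_one] at h
    nlinarith
  unfold focalSum
  rw [h1, h2, norm_mul, norm_mul, h3, norm_div, norm_div, norm_pow, norm_pow]
  have : d / 2 * (‖ξ - 1‖ ^ 2 / ‖ξ‖) + d / 2 * (‖ξ + 1‖ ^ 2 / ‖ξ‖) =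
      d / 2 * ((‖ξ - 1‖ ^ 2 + ‖ξ + 1‖ ^ 2) / ‖ξ‖) := by ring
  rw [this, hpar]
  field_simp

lemma add_inv_lt_add_inv_iff {a b : ℝ} (ha : 1 ≤ a) (hb : 1 ≤ b) :
    a + a⁻¹ < b + b⁻¹ ↔ a < b := by
  have key : ∀ {a b : ℝ}, 1 ≤ a → a < b → a + a⁻¹ < b + b⁻¹ := by
    intro a b ha hab
    have h1 : 0 < a := by linarith
    have h2 : 0 < b := by linarith
    have h3 : 1 < a * b := by nlinarith
    have h4 : b + b⁻¹ - (a + a⁻¹) = (b - a) * (a * b - 1) / (a * b) := by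
      field_simp
      ring
    have h5 : 0 < (b - a) * (a * b - 1) / (a * b) :=
      div_pos (mul_pos (by linarith) (by linarith)) (by positivity)
    linarith
  refine ⟨fun h => ?_, key ha⟩
  by_contra hc
  rcases (not_lt.1 hc).eq_or_lt with rfl | hlt
  · exact lt_irrefl _ h
  · exact absurd h (not_lt.2 (key hb hlt).le)

/-- The two solutions of the quadratic equation have product `1`, so one of them has norm at least
`1`. -/
lemma exists_joukowski_eq {c : ℂ} {d : ℝ} (hd : 0 < d) (z : ℂ) :
    ∃ ξ : ℂ, 1 ≤ ‖ξ‖ ∧ joukowski c d ξ = z := by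
  have hd' : (d : ℂ) ≠ 0 := Complex.ofReal_ne_zero.2 hd.ne'
  set w := (z - c) / d with hw
  obtain ⟨s, hs⟩ := IsAlgClosed.exists_pow_nat_eq (w ^ 2 - 1) (n := 2) (by norm_num)
  have hprod : (w + s) * (w - s) = 1 := by linear_combination -hs
  have hmain : ∀ ξ η : ℂ, ξ * η = 1 → ξ + η = 2 * w → joukowski c d ξ = z := by
    intro ξ η h1 h2
    have h3 : ξ⁻¹ = η := inv_eq_of_mul_eq_one_right h1
    unfold joukowski
    rw [h3, h2, hw]
    field_simp
    ring
  rcases le_total 1 ‖w + s‖ with h | h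
  · exact ⟨w + s, h, hmain _ _ hprod (by ring)⟩
  · refine ⟨w - s, ?_, hmain (w - s) (w + s) (by rw [mul_comm]; exact hprod) (by ring)⟩
    have := congrArg norm hprod
    rw [norm_mul, norm_one] at this
    nlinarith [norm_nonneg (w - s), norm_nonneg (w + s)]

/-- Equal values mean `(ξ - η) * (ξ * η - 1) = 0`, and the second factor cannot vanish when both
norms exceed `1`. -/
lemma injOn_joukowski {c : ℂ} {d : ℝ} (hd : 0 < d) : InjOn (joukowski c d) {ξ | 1 < ‖ξ‖} := by
  intro ξ hξ η hη h
  have hξ' : 1 < ‖ξ‖ := hξ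
  have hη' : 1 < ‖η‖ := hη
  have hξ0 : ξ ≠ 0 := norm_pos_iff.1 (one_pos.trans hξ')
  have hη0 : η ≠ 0 := norm_pos_iff.1 (one_pos.trans hη')
  have hd' : (d : ℂ) / 2 ≠ 0 := div_ne_zero (Complex.ofReal_ne_zero.2 hd.ne') two_ne_zero
  unfold joukowski at h
  have h1 : ξ + ξ⁻¹ = η + η⁻¹ := mul_left_cancel₀ hd' (add_left_cancel h)
  have h2 : (ξ - η) * (ξ * η - 1) = 0 := by
    field_simp at h1
    linear_combination h1
  rcases mul_eq_zero.1 h2 with h3 | h3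
  · exact sub_eq_zero.1 h3
  · have h4 := congrArg norm (sub_eq_zero.1 h3)
    rw [norm_mul, norm_one] at h4
    nlinarith

lemma differentiableAt_joukowski (c : ℂ) (d : ℝ) {ξ : ℂ} (hξ : ξ ≠ 0) :
    DifferentiableAt ℂ (joukowski c d) ξ := by
  unfold joukowski
  exact ((differentiableAt_id.add (differentiableAt_inv hξ)).const_mul _).const_add _

lemma focalSum_lt_eq {c : ℂ} {d : ℝ} (hd : 0 < d) {t : ℝ} (ht : 1 < t) :
    {z | focalSum c d z < d * (t + t⁻¹)} =
      {z | focalSum c d z ≤ 2 * d} ∪ joukowski c d '' annulus t := by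
  have h2 : 2 < t + t⁻¹ := by
    have := (add_inv_lt_add_inv_iff le_rfl ht.le).2 ht
    norm_num at this ⊢
    linarith
  ext z
  constructor
  · intro hz
    obtain ⟨ξ, hξ, rfl⟩ := exists_joukowski_eq (c := c) hd z
    have hξ0 : ξ ≠ 0 := norm_pos_iff.1 (one_pos.trans_le hξ)
    have hz' : focalSum c d (joukowski c d ξ) < d * (t + t⁻¹) := hz
    rw [focalSum_joukowski hd hξ0, mul_lt_mul_iff_right₀ hd,
      add_inv_lt_add_inv_iff hξ ht.le] at hz'
    rcases hξ.eq_or_lt with h | h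
    · left
      change focalSum c d (joukowski c d ξ) ≤ 2 * d
      rw [focalSum_joukowski hd hξ0, ← h]
      linarith
    · exact Or.inr ⟨ξ, ⟨h, hz'⟩, rfl⟩
  · rintro (hz | ⟨ξ, ⟨h1, h3⟩, rfl⟩)
    · have hz' : focalSum c d z ≤ 2 * d := hz
      change focalSum c d z < d * (t + t⁻¹)
      nlinarith
    · change focalSum c d (joukowski c d ξ) < d * (t + t⁻¹)
      rw [focalSum_joukowski hd (norm_pos_iff.1 (one_pos.trans h1)), mul_lt_mul_iff_right₀ hd,
        add_inv_lt_add_inv_iff h1.le ht.le]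
      exact h3

lemma focalSum_le_eq {c : ℂ} {d : ℝ} (hd : 0 < d) {t : ℝ} (ht : 1 < t) :
    {z | focalSum c d z ≤ d * (t + t⁻¹)} =
      {z | focalSum c d z ≤ 2 * d} ∪ joukowski c d '' {ξ | 1 < ‖ξ‖ ∧ ‖ξ‖ ≤ t} := by
  have h2 : 2 < t + t⁻¹ := by
    have := (add_inv_lt_add_inv_iff le_rfl ht.le).2 ht
    norm_num at this ⊢
    linarith
  ext z
  constructor
  · intro hz
    obtain ⟨ξ, hξ, rfl⟩ := exists_joukowski_eq (c := c) hd z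
    have hξ0 : ξ ≠ 0 := norm_pos_iff.1 (one_pos.trans_le hξ)
    have hz' : focalSum c d (joukowski c d ξ) ≤ d * (t + t⁻¹) := hz
    rw [focalSum_joukowski hd hξ0, mul_le_mul_iff_right₀ hd, ← not_lt,
      add_inv_lt_add_inv_iff ht.le hξ, not_lt] at hz'
    rcases hξ.eq_or_lt with h | h
    · left
      change focalSum c d (joukowski c d ξ) ≤ 2 * d
      rw [focalSum_joukowski hd hξ0, ← h]
      linarith
    · exact Or.inr ⟨ξ, ⟨h, hz'⟩, rfl⟩
  · rintro (hz | ⟨ξ, ⟨h1, h3⟩, rfl⟩)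
    · have hz' : focalSum c d z ≤ 2 * d := hz
      change focalSum c d z ≤ d * (t + t⁻¹)
      nlinarith
    · change focalSum c d (joukowski c d ξ) ≤ d * (t + t⁻¹)
      rw [focalSum_joukowski hd (norm_pos_iff.1 (one_pos.trans h1)), mul_le_mul_iff_right₀ hd,
        ← not_lt, add_inv_lt_add_inv_iff ht.le h1.le, not_lt]
      exact h3

/-- The sublevel set of the focal sum is the segment between the foci. -/
lemma focalSum_le_two_mul_iff {c : ℂ} {d : ℝ} (hd : 0 < d) (z : ℂ) :
    focalSum c d z ≤ 2 * d ↔ z.im = c.im ∧ c.re - d ≤ z.re ∧ z.re ≤ c.re + d := by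
  constructor
  · intro hz
    obtain ⟨ξ, hξ, rfl⟩ := exists_joukowski_eq (c := c) hd z
    have hξ0 : ξ ≠ 0 := norm_pos_iff.1 (one_pos.trans_le hξ)
    have hξ1 : ‖ξ‖ = 1 := by
      refine (hξ.eq_or_lt.resolve_right fun h => ?_).symm
      rw [focalSum_joukowski hd hξ0, mul_comm 2, mul_le_mul_iff_right₀ hd] at hz
      have := (add_inv_lt_add_inv_iff le_rfl hξ).2 h
      norm_num at this
      linarith
    have hinv : ξ⁻¹ = (starRingEnd ℂ) ξ := by
      rw [Complex.inv_def, Complex.normSq_eq_norm_sq, hξ1]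
      simp
    have hJ : joukowski c d ξ = c + ((d * ξ.re : ℝ) : ℂ) := by
      unfold joukowski
      rw [hinv, Complex.add_conj]
      push_cast
      ring
    have hre : |ξ.re| ≤ 1 := hξ1 ▸ Complex.abs_re_le_norm ξ
    rw [abs_le] at hre
    rw [hJ]
    refine ⟨by simp, ?_, ?_⟩
    · rw [Complex.add_re, Complex.ofReal_re]
      nlinarith
    · rw [Complex.add_re, Complex.ofReal_re]
      nlinarith
  · rintro ⟨h1, h2, h3⟩
    have hz : z - c = ((z.re - c.re : ℝ) : ℂ) := Complex.ext (by simp) (by simp [h1])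
    unfold focalSum
    rw [hz, ← Complex.ofReal_sub, ← Complex.ofReal_add, Complex.norm_real, Complex.norm_real,
      Real.norm_of_nonpos (by linarith), Real.norm_of_nonneg (by linarith)]
    linarith

lemma isCompact_focalSum_le (c : ℂ) (d r : ℝ) : IsCompact {z | focalSum c d z ≤ r} := by
  refine Metric.isCompact_of_isClosed_isBounded
    (isClosed_le (continuous_focalSum c d) continuous_const)
    ((Metric.isBounded_closedBall (x := c + d) (r := r)).subset fun z hz => ?_)
  have hz' : focalSum c d z ≤ r := hz
  rw [mem_closedBall_iff_norm, ← sub_sub]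
  unfold focalSum at hz'
  linarith [norm_nonneg (z - c + d)]

/-- The filled confocal ellipses shrink to the focal segment as `T` decreases to `1`: on the compact
part of a large ellipse outside `O` the focal sum has a minimum above `2 * d`. -/
lemma exists_focalSum_le_subset {c : ℂ} {d : ℝ} (hd : 0 < d) {O : Set ℂ} (hO : IsOpen O)
    (h : {z | focalSum c d z ≤ 2 * d} ⊆ O) :
    ∃ T, 1 < T ∧ {z | focalSum c d z ≤ d * (T + T⁻¹)} ⊆ O := by
  have hK : IsCompact ({z | focalSum c d z ≤ d * (2 + 2⁻¹)} \ O) :=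
    (isCompact_focalSum_le c d _).diff hO
  have hlt : ∃ r, 2 * d < r ∧ ∀ z ∈ {z | focalSum c d z ≤ d * (2 + 2⁻¹)} \ O,
      r ≤ focalSum c d z := by
    rcases ({z | focalSum c d z ≤ d * (2 + 2⁻¹)} \ O).eq_empty_or_nonempty with h0 | h0
    · exact ⟨2 * d + 1, by linarith, by rw [h0]; simp⟩
    · obtain ⟨z₀, hz₀, hmin⟩ := hK.exists_isMinOn h0 (continuous_focalSum c d).continuousOn
      refine ⟨focalSum c d z₀, ?_, fun z hz => hmin hz⟩
      by_contra hc
      exact hz₀.2 (h (not_lt.1 hc))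
  obtain ⟨r, hr, hrO⟩ := hlt
  have hcont : Tendsto (fun T : ℝ => d * (T + T⁻¹)) (𝓝[>] 1) (𝓝 (2 * d)) := by
    have h1 : ContinuousAt (fun T : ℝ => d * (T + T⁻¹)) 1 :=
      (continuousAt_id.add (continuousAt_inv₀ one_ne_zero)).const_mul d
    have h2 : Tendsto (fun T : ℝ => d * (T + T⁻¹)) (𝓝 1) (𝓝 (d * (1 + 1⁻¹))) := h1.tendsto
    have h3 : d * (1 + 1⁻¹) = 2 * d := by norm_num; ring
    rw [h3] at h2
    exact h2.mono_left nhdsWithin_le_nhds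
  have hev := (hcont.eventually_lt_const (lt_min hr (by linarith : 2 * d < d * (2 + 2⁻¹)))).and
    (self_mem_nhdsWithin : ∀ᶠ T : ℝ in 𝓝[>] 1, T ∈ Ioi 1)
  obtain ⟨T, hT, hT1⟩ := hev.exists
  refine ⟨T, hT1, fun z hz => ?_⟩
  have hz' : focalSum c d z ≤ d * (T + T⁻¹) := hz
  by_contra hzO
  have h1 : z ∈ {z | focalSum c d z ≤ d * (2 + 2⁻¹)} :=
    hz'.trans (hT.le.trans (min_le_right _ _))
  have h2 := hrO z ⟨h1, hzO⟩
  have h3 := hT.trans_le (min_le_left _ _)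
  linarith

/-- `E` maps the annulus `1 < |ξ| < T` conformally onto a one-sided neighbourhood of the
continuum `p`. -/
structure IsCollar (p W : Set ℂ) (E : ℂ → ℂ) (T : ℝ) : Prop where
  one_lt : 1 < T
  differentiableOn : DifferentiableOn ℂ E (annulus T)
  injOn : InjOn E (annulus T)
  mapsTo : MapsTo E (annulus T) W
  isOpen : ∀ t, 1 < t → t ≤ T → IsOpen (p ∪ E '' annulus t)
  isCompact : ∀ t, 1 < t → t < T → IsCompact (p ∪ E '' {ξ | 1 < ‖ξ‖ ∧ ‖ξ‖ ≤ t})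
  small : ∀ O, IsOpen O → p ⊆ O → ∃ t, 1 < t ∧ t ≤ T ∧ E '' annulus t ⊆ O

lemma annulus_mono {t T : ℝ} (h : t ≤ T) : annulus t ⊆ annulus T :=
  fun _ hξ => ⟨hξ.1, hξ.2.trans_le h⟩

lemma IsCollar.mono {p W : Set ℂ} {E : ℂ → ℂ} {T T' : ℝ} (h : IsCollar p W E T) (h1 : 1 < T')
    (h2 : T' ≤ T) : IsCollar p W E T' where
  one_lt := h1
  differentiableOn := h.differentiableOn.mono (annulus_mono h2)
  injOn := h.injOn.mono (annulus_mono h2)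
  mapsTo := h.mapsTo.mono_left (annulus_mono h2)
  isOpen t ht ht' := h.isOpen t ht (ht'.trans h2)
  isCompact t ht ht' := h.isCompact t ht (ht'.trans_le h2)
  small O hO hpO := by
    obtain ⟨t, ht1, -, htO⟩ := h.small O hO hpO
    exact ⟨min t T', lt_min ht1 h1, min_le_right _ _,
      (image_mono (annulus_mono (min_le_left _ _))).trans htO⟩

/-- The collar is the exponential of a confocal elliptic annulus around the logarithmic slit, chosen
so thin that it stays in the strip where `exp` is injective and avoids all other slits. -/
lemma exists_isCollar_slit {L : ℝ} (hL : 0 < L) {x : ℕ × ℕ} (hx : x ∈ treeNodes) :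
    ∃ E T, IsCollar (slit L x) (slitSet L treeNodes)ᶜ E T := by
  -- `d` is half the length of the logarithmic slit and `c` is its midpoint, so that the focal
  -- segment is the slit.
  set d : ℝ := (L + 1) / 2 with hd_def
  have hd : 0 < d := by rw [hd_def]; linarith
  set c : ℂ := ⟨(-L * (x.1 + 1) + (-L * x.1 + 1)) / 2, treeAngle x.1 x.2⟩ with hc
  have hseg : {z | focalSum c d z ≤ 2 * d} = logSlit L x := by
    ext z
    change focalSum c d z ≤ 2 * d ↔ _
    rw [focalSum_le_two_mul_iff hd]
    have h1 : c.re - d = -L * (x.1 + 1) := by rw [hc, hd_def]; ring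
    have h2 : c.re + d = -L * x.1 + 1 := by rw [hc, hd_def]; ring
    rw [h1, h2]
    rfl
  have hstrip : IsOpen {ζ : ℂ | 0 < ζ.im ∧ ζ.im < 1} :=
    (isOpen_lt continuous_const Complex.continuous_im).inter
      (isOpen_lt Complex.continuous_im continuous_const)
  have hO : IsOpen ({ζ : ℂ | 0 < ζ.im ∧ ζ.im < 1} ∩
      Complex.exp ⁻¹' (slitSet L (treeNodes \ {x}))ᶜ) :=
    hstrip.inter ((isClosed_slitSet hL sdiff_subset).isOpen_compl.preimage Complex.continuous_exp)
  obtain ⟨T, hT, hTO⟩ := exists_focalSum_le_subset (c := c) hd hO (by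
    rw [hseg]
    refine fun ζ hζ => ⟨logSlit_subset_strip hx hζ, fun hmem => ?_⟩
    rcases mem_slitSet.1 hmem with h | ⟨y, ⟨hy, hyx⟩, hζy⟩
    · exact Complex.exp_ne_zero ζ h
    · exact hyx (eq_of_mem_slit hy hx hζy ⟨ζ, hζ, rfl⟩))
  have hJ : ∀ ξ ∈ annulus T, joukowski c d ξ ∈ {z | focalSum c d z ≤ d * (T + T⁻¹)} := by
    intro ξ hξ
    rw [focalSum_le_eq hd hT]
    exact Or.inr ⟨ξ, ⟨hξ.1, hξ.2.le⟩, rfl⟩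
  have hJinj := injOn_joukowski (c := c) hd
  have hopen : IsOpenMap Complex.exp := Complex.isOpenMap_exp
  refine ⟨fun ξ => Complex.exp (joukowski c d ξ), T, hT, ?_, ?_, ?_, ?_, ?_, ?_⟩
  · intro ξ hξ
    have hξ0 : ξ ≠ 0 := norm_pos_iff.1 (one_pos.trans hξ.1)
    exact (differentiableAt_joukowski c d hξ0).cexp.differentiableWithinAt
  · intro ξ hξ η hη h
    exact hJinj hξ.1 hη.1 (injOn_exp_strip (hTO (hJ ξ hξ)).1 (hTO (hJ η hη)).1 h)
  · intro ξ hξ hmem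
    rcases mem_slitSet.1 hmem with h | ⟨y, hy, hζy⟩
    · exact Complex.exp_ne_zero _ h
    · by_cases hyx : y = x
      · subst hyx
        obtain ⟨ζ, hζ, hζe⟩ := hζy
        have h1 := injOn_exp_strip (logSlit_subset_strip hy hζ) (hTO (hJ ξ hξ)).1 hζe
        rw [← hseg, h1] at hζ
        have h2 : focalSum c d (joukowski c d ξ) ≤ 2 * d := hζ
        rw [focalSum_joukowski hd (norm_pos_iff.1 (one_pos.trans hξ.1)), mul_comm 2,
          mul_le_mul_iff_right₀ hd] at h2
        have h3 := (add_inv_lt_add_inv_iff le_rfl hξ.1.le).2 hξ.1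
        norm_num at h3
        linarith
      · exact (hTO (hJ ξ hξ)).2 (mem_slitSet.2 (Or.inr ⟨y, ⟨hy, hyx⟩, hζy⟩))
  · intro t ht _
    have h1 : slit L x ∪ (fun ξ => Complex.exp (joukowski c d ξ)) '' annulus t =
        Complex.exp '' {z | focalSum c d z < d * (t + t⁻¹)} := by
      rw [focalSum_lt_eq hd ht, image_union, hseg, image_image]
      rfl
    rw [h1]
    exact hopen _ (isOpen_lt (continuous_focalSum c d) continuous_const)
  · intro t ht _
    have h1 : slit L x ∪ (fun ξ => Complex.exp (joukowski c d ξ)) '' {ξ | 1 < ‖ξ‖ ∧ ‖ξ‖ ≤ t} =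
        Complex.exp '' {z | focalSum c d z ≤ d * (t + t⁻¹)} := by
      rw [focalSum_le_eq hd ht, image_union, hseg, image_image]
      rfl
    rw [h1]
    exact (isCompact_focalSum_le c d _).image Complex.continuous_exp
  · intro O hO hpO
    obtain ⟨t, ht, htO⟩ := exists_focalSum_le_subset (c := c) hd
      (hO.preimage Complex.continuous_exp) (by
        rw [hseg]
        exact fun ζ hζ => hpO ⟨ζ, hζ, rfl⟩)
    refine ⟨min t T, lt_min ht hT, min_le_right _ _, ?_⟩
    rintro _ ⟨ξ, hξ, rfl⟩
    refine htO ?_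
    rw [focalSum_le_eq hd ht]
    exact Or.inr ⟨ξ, ⟨hξ.1, (hξ.2.trans_le (min_le_left _ _)).le⟩, rfl⟩

end RiemannSphere

namespace RiemannSphere

open Filter Set Topology

/-! ### Conformal maps near a collar -/

lemma differentiableAt_affine {f : RiemannSphere → RiemannSphere} {z : ℂ}
    (hf : ComplexDifferentiableAt f z) (hz : f z ≠ ∞) :
    DifferentiableAt ℂ (fun ζ : ℂ => affine (f ζ)) z := by
  obtain ⟨v, hv⟩ := OnePoint.ne_infty_iff_exists.1 hz
  unfold ComplexDifferentiableAt at hf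
  rw [← hv] at hf
  have h : ∀ w, coord (v : RiemannSphere) w = affine w := by
    intro w
    induction w using OnePoint.rec <;> rfl
  simp only [h] at hf
  exact hf

lemma eq_of_eventually_eq {X Y : Type*} [TopologicalSpace X] {s : Set X} (hs : IsPreconnected s)
    {F : X → Y} (hF : ∀ x ∈ s, ∀ᶠ y in 𝓝 x, y ∈ s → F y = F x) {x y : X} (hx : x ∈ s) (hy : y ∈ s) :
    F x = F y := by
  refine hs.induction₂' (fun x y => F x = F y) (fun x hx => ?_) ?_ hx hy
  · have := hF x hx
    rw [eventually_nhdsWithin_iff]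
    exact this.mono fun y h hy => ⟨(h hy).symm, h hy⟩
  · exact fun x y z _ _ _ h1 h2 => h1.trans h2

variable {Ω D : Set RiemannSphere} {f : OpenPartialHomeomorph RiemannSphere RiemannSphere}

/-- A thin enough collar together with `p` is a compact set that misses `z`, so it misses a
neighbourhood of `z`. -/
lemma IsCollar.exists_disjoint_nhds {p W : Set ℂ} {E : ℂ → ℂ} {T : ℝ} (h : IsCollar p W E T)
    {z : RiemannSphere} (hz : z ∉ (fun v : ℂ => (v : RiemannSphere)) '' p) :
    ∃ t, 1 < t ∧ t < T ∧ ∀ᶠ z' in 𝓝 z, ∀ ξ ∈ annulus t, z' ≠ (E ξ : RiemannSphere) := by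
  have hE : ∃ t, 1 < t ∧ t ≤ T ∧ ∀ ξ ∈ annulus t, z ≠ (E ξ : RiemannSphere) := by
    induction z using OnePoint.rec with
    | infty => exact ⟨T, h.one_lt, le_rfl, fun ξ _ => OnePoint.infty_ne_coe _⟩
    | coe z =>
      obtain ⟨t, h1, h2, h3⟩ := h.small {z}ᶜ isOpen_compl_singleton (by
        rintro v hv rfl
        exact hz ⟨v, hv, rfl⟩)
      refine ⟨t, h1, h2, fun ξ hξ heq => h3 ⟨ξ, hξ, rfl⟩ ?_⟩
      exact (OnePoint.coe_injective heq).symm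
  obtain ⟨t, h1, h2, h3⟩ := hE
  obtain ⟨s, hs1, hs2⟩ := exists_between h1
  refine ⟨s, hs1, hs2.trans_le h2, ?_⟩
  have hcl : IsClosed ((fun v : ℂ => (v : RiemannSphere)) ''
      (p ∪ E '' {ξ | 1 < ‖ξ‖ ∧ ‖ξ‖ ≤ s})) :=
    ((h.isCompact s hs1 (hs2.trans_le h2)).image OnePoint.continuous_coe).isClosed
  have hnot : z ∉ (fun v : ℂ => (v : RiemannSphere)) '' (p ∪ E '' {ξ | 1 < ‖ξ‖ ∧ ‖ξ‖ ≤ s}) := by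
    rintro ⟨v, hv | ⟨ξ, hξ, rfl⟩, rfl⟩
    · exact hz ⟨v, hv, rfl⟩
    · exact h3 ξ ⟨hξ.1, hξ.2.trans_lt hs2⟩ rfl
  filter_upwards [hcl.isOpen_compl.mem_nhds hnot] with z' hz' ξ hξ heq
  exact hz' ⟨E ξ, Or.inr ⟨ξ, ⟨hξ.1, hξ.2.le⟩, rfl⟩, heq.symm⟩

/-- A conformal map cannot push a collared complementary component and another part of the
complement into the same connected subset of the complement of the image. -/
theorem not_same_component (hΩ : IsSphereDomain Ω) (hf : IsConformalHomeo f Ω D)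
    {p : Set ℂ} {E : ℂ → ℂ} {T : ℝ} (hE : IsCollar p ((fun v : ℂ => (v : RiemannSphere)) ⁻¹' Ω) E T)
    (hpΩ : Disjoint ((fun v : ℂ => (v : RiemannSphere)) '' p) Ω)
    {l : Filter RiemannSphere} (hlΩ : Ω ∈ l)
    (hlp : ∀ O : Set ℂ, IsOpen O → p ⊆ O → (fun v : ℂ => (v : RiemannSphere)) '' O ∈ l)
    {z₁ : RiemannSphere} (hz₁ : z₁ ∉ (fun v : ℂ => (v : RiemannSphere)) '' p)
    {q : Set RiemannSphere} (hq : IsPreconnected q) (hqD : Disjoint q D)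
    {w w₁ : RiemannSphere} (hw : w ∈ q) (hw₁ : w₁ ∈ q) (hwl : ClusterPt w (map f l))
    (hwl₁ : ClusterPt w₁ (map f (𝓝[Ω] z₁))) : False := by
  obtain ⟨rfl, rfl, hdiff⟩ := hf
  wlog hfin : ∀ ξ ∈ annulus T, f (E ξ) ≠ ∞ generalizing T
  -- The possible pole of `f` in `Ω` does not lie in `p`, so a thinner collar avoids it.
  · by_cases hinf : ∞ ∈ f.target
    · have hz : f.symm ∞ ∉ (fun v : ℂ => (v : RiemannSphere)) '' p :=
        fun h => Set.disjoint_left.1 hpΩ h (f.map_target hinf)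
      obtain ⟨t, h1, h2, h3⟩ := hE.exists_disjoint_nhds hz
      refine this (hE.mono h1 h2.le) fun ξ hξ heq => ?_
      refine h3.self_of_nhds ξ hξ ?_
      rw [← heq, f.left_inv (hE.mapsTo (annulus_mono h2.le hξ))]
    · exact hfin fun ξ hξ heq => hinf (heq ▸ f.map_source (hE.mapsTo hξ))
  have hA := isOpen_annulus T
  set g : ℂ → ℂ := fun ξ => affine (f (E ξ)) with hg_def
  have hgf : ∀ ξ ∈ annulus T, (g ξ : RiemannSphere) = f (E ξ) :=
    fun ξ hξ => coe_affine (hfin ξ hξ)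
  have hg : DifferentiableOn ℂ g (annulus T) := by
    intro ξ hξ
    have h1 := differentiableAt_affine (hdiff _ (hE.mapsTo hξ)) (hfin ξ hξ)
    have h2 := hE.differentiableOn.differentiableAt (hA.mem_nhds hξ)
    exact (DifferentiableAt.comp ξ h1 h2).differentiableWithinAt
  have hginj : InjOn g (annulus T) := by
    intro ξ hξ η hη h
    have h1 : f (E ξ) = f (E η) := by rw [← hgf ξ hξ, ← hgf η hη, h]
    exact hE.injOn hξ hη
      (OnePoint.coe_injective (f.injOn (hE.mapsTo hξ) (hE.mapsTo hη) h1))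
  -- far from the collar all winding numbers with a small radius agree
  have hfar : ∀ {t s : ℝ} {z : RiemannSphere}, 1 < s → s ≤ t → t < T → z ∈ f.source →
      (∀ ξ : ℂ, s ≤ ‖ξ‖ → ‖ξ‖ ≤ t → z ≠ (E ξ : RiemannSphere)) →
      winding g t (f z) = winding g s (f z) := by
    intro t s z h1 h2 h3 hz hne
    refine winding_eq_winding hg h1 h2 h3 fun ξ h4 h5 heq => hne ξ h4 h5 ?_
    have hξ : ξ ∈ annulus T := ⟨h1.trans_le h4, h5.trans_lt h3⟩
    rw [hgf ξ hξ] at heq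
    exact (f.injOn (hE.mapsTo hξ) hz heq).symm
  -- For circles close to `p` the winding number around `f z` stabilises, and the limit is locally
  -- constant in `z`. As `Ω` is connected, the limit `c z` is the same for all `z`.
  have hloc : ∀ z ∈ f.source, ∃ c, ∀ᶠ z' in 𝓝 z, z' ∈ f.source →
      ∀ᶠ s in 𝓝[>] (1 : ℝ), winding g s (f z') = c := by
    intro z hz
    have hzp : z ∉ (fun v : ℂ => (v : RiemannSphere)) '' p :=
      fun h => Set.disjoint_left.1 hpΩ h hz
    obtain ⟨t, h1, h2, h3⟩ := hE.exists_disjoint_nhds hzp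
    obtain ⟨r, hr1, hr2⟩ := exists_between h1
    have hne : ∀ ξ ∈ Metric.sphere (0 : ℂ) r, (g ξ : RiemannSphere) ≠ f z := by
      intro ξ hξ heq
      rw [mem_sphere_zero_iff_norm] at hξ
      have hξT : ξ ∈ annulus T := ⟨hξ ▸ hr1, hξ ▸ hr2.trans h2⟩
      rw [hgf ξ hξT] at heq
      exact h3.self_of_nhds ξ ⟨hξ ▸ hr1, hξ ▸ hr2⟩ (f.injOn (hE.mapsTo hξT) hz heq).symm
    have hev := (f.continuousAt hz).eventually (eventually_winding_eq hg hr1 (hr2.trans h2) hne)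
    refine ⟨winding g r (f z), ?_⟩
    filter_upwards [hev, h3] with z' hz' hz'' hzs
    filter_upwards [Ioo_mem_nhdsGT hr1] with s hs
    rw [← hz']
    refine (hfar hs.1 hs.2.le (hr2.trans h2) hzs fun ξ h4 h5 => ?_).symm
    exact hz'' ξ ⟨hs.1.trans_le h4, h5.trans_lt hr2⟩
  choose! c hc using hloc
  have hcz : ∀ z ∈ f.source, ∀ᶠ s in 𝓝[>] (1 : ℝ), winding g s (f z) = c z :=
    fun z hz => (hc z hz).self_of_nhds hz
  have hconst : ∀ z ∈ f.source, ∀ z' ∈ f.source, c z = c z' := by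
    intro z hz z' hz'
    refine eq_of_eventually_eq hΩ.2.isPreconnected (fun x hx => ?_) hz hz'
    filter_upwards [hc x hx] with y hy hys
    obtain ⟨s, hs1, hs2⟩ := ((hy hys).and (hcz y hys)).exists
    exact hs2.symm.trans hs1
  -- the values on both sides of a circle
  obtain ⟨t₀, ht₀, ht₀T, hfar₁⟩ := hE.exists_disjoint_nhds hz₁
  obtain ⟨t, ht1, htt₀⟩ := exists_between ht₀
  have htT : t < T := htt₀.trans ht₀T
  have hqt : ∀ v ∈ q, ∀ ξ ∈ Metric.sphere (0 : ℂ) t, (g ξ : RiemannSphere) ≠ v := by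
    intro v hv ξ hξ heq
    have hξT := sphere_subset_annulus ht1 htT hξ
    rw [hgf ξ hξT] at heq
    exact Set.disjoint_left.1 hqD hv (heq ▸ f.map_source (hE.mapsTo hξT))
  -- The image of the circle lies in `D` and so misses `q`; hence the winding number is constant on
  -- the connected set `q`.
  have hqconst : winding g t w = winding g t w₁ :=
    eq_of_eventually_eq hq (fun v hv =>
      (eventually_winding_eq hg ht1 htT (hqt v hv)).mono fun _ h _ => h) hw hw₁
  -- Points near `z₁` lie outside the collar up to radius `t`, so shrinking the circle does not
  -- change the winding number around their images.
  have hout : ∃ z ∈ f.source, winding g t w₁ = c z := by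
    have h1 := hwl₁.frequently (eventually_winding_eq hg ht1 htT (hqt w₁ hw₁))
    rw [frequently_map] at h1
    obtain ⟨z, hz, hz', hzs⟩ := (h1.and_eventually
      ((hfar₁.filter_mono nhdsWithin_le_nhds).and self_mem_nhdsWithin)).exists
    refine ⟨z, hzs, ?_⟩
    obtain ⟨s, hs, hs'⟩ := ((hcz z hzs).and (Ioo_mem_nhdsGT ht1)).exists
    rw [← hz, ← hs]
    refine hfar hs'.1 hs'.2.le htT hzs fun ξ h4 h5 => ?_
    exact hz' ξ ⟨hs'.1.trans_le h4, h5.trans_lt htt₀⟩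
  -- Near `w` there are images of points of the collar inside the circle of radius `t`. Shrinking
  -- the circle past such a point, moved slightly to make it simple, costs `2πi`.
  have hin : ∃ z ∈ f.source, winding g t w = c z + 2 * Real.pi * Complex.I := by
    obtain ⟨N, hN, hNo, hwN⟩ := eventually_nhds_iff.1
      (eventually_winding_eq hg ht1 htT (hqt w hw))
    have h1 : ∃ᶠ z in l, f z ∈ N := hwl.frequently (hNo.mem_nhds hwN : ∀ᶠ v in 𝓝 w, v ∈ N)
    have h2 : ∀ᶠ z in l, z ∈ (fun v : ℂ => (v : RiemannSphere)) '' (p ∪ E '' annulus t) :=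
      hlp _ (hE.isOpen t ht1 htT.le) subset_union_left
    obtain ⟨z, hzN, ⟨v, hv, rfl⟩, hzs⟩ := (h1.and_eventually
      (h2.and hlΩ)).exists
    rcases hv with hv | ⟨ξ, hξ, rfl⟩
    · exact absurd hzs (Set.disjoint_left.1 hpΩ ⟨v, hv, rfl⟩)
    have hξT := annulus_mono htT.le hξ
    have hU : IsOpen (annulus t ∩ (fun ξ => (g ξ : RiemannSphere)) ⁻¹' N) := by
      refine ContinuousOn.isOpen_inter_preimage ?_ (isOpen_annulus t) hNo
      exact OnePoint.continuous_coe.comp_continuousOn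
        (hg.continuousOn.mono (annulus_mono htT.le))
    obtain ⟨ξ', ⟨⟨hξ't, hξ'N⟩, hξ'T⟩, hd⟩ := exists_deriv_ne_zero hg hginj hU
      (ξ := ξ) ⟨hξ, by rw [mem_preimage, hgf ξ hξT]; exact hzN⟩ hξT
    have hsrc : (E ξ' : RiemannSphere) ∈ f.source := hE.mapsTo hξ'T
    refine ⟨E ξ', hsrc, ?_⟩
    obtain ⟨s, hs, hs'⟩ := ((hcz _ hsrc).and (Ioo_mem_nhdsGT hξ'T.1)).exists
    rw [← hN _ hξ'N, ← hs, ← hgf ξ' hξ'T]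
    exact winding_jump hg hginj hξ'T hd hs'.1 hs'.2 hξ't.2 htT
  obtain ⟨z, hz, hzc⟩ := hout
  obtain ⟨z', hz', hzc'⟩ := hin
  rw [hzc, hzc', hconst z' hz' z hz, add_eq_left] at hqconst
  exact Complex.two_pi_I_ne_zero hqconst

/-! ### The extension to the decomposition spaces -/

lemma exists_preconnected_nhds {w : RiemannSphere} {V : Set RiemannSphere} (hV : V ∈ 𝓝 w) :
    ∃ U ∈ 𝓝 w, U ⊆ V ∧ IsPreconnected U := by
  have hfin : ∀ (z : ℂ), ∀ V ∈ 𝓝 (z : RiemannSphere), ∃ U ∈ 𝓝 (z : RiemannSphere),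
      U ⊆ V ∧ IsPreconnected U := by
    intro z V hV
    rw [OnePoint.nhds_coe_eq, mem_map] at hV
    obtain ⟨r, hr, hrV⟩ := Metric.mem_nhds_iff.1 hV
    refine ⟨(fun v : ℂ => (v : RiemannSphere)) '' Metric.ball z r, ?_, image_subset_iff.2 hrV,
      (convex_ball z r).isPreconnected.image _ OnePoint.continuous_coe.continuousOn⟩
    exact (OnePoint.isOpenMap_coe _ Metric.isOpen_ball).mem_nhds ⟨z, Metric.mem_ball_self hr, rfl⟩
  induction w using OnePoint.rec with
  | coe z => exact hfin z V hV
  | infty =>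
    have h1 : inversion ⁻¹' V ∈ 𝓝 ((0 : ℂ) : RiemannSphere) :=
      continuous_inversion.continuousAt.preimage_mem_nhds (by rwa [inversion_zero])
    obtain ⟨U, hU, hUV, hUc⟩ := hfin 0 _ h1
    refine ⟨inversion '' U, ?_, image_subset_iff.2 hUV,
      hUc.image _ continuous_inversion.continuousOn⟩
    have := inversionHomeomorph.isOpenMap.image_mem_nhds hU
    rwa [show inversionHomeomorph ((0 : ℂ) : RiemannSphere) = ∞ from inversion_zero] at this

/-- Every complementary component of a nonempty open set touches its closure. -/
lemma connectedComponentIn_inter_closure_nonempty (hD : IsOpen D) (hne : D.Nonempty)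
    {w : RiemannSphere} (hw : w ∉ D) :
    (connectedComponentIn Dᶜ w ∩ closure D).Nonempty := by
  by_contra hcon
  have hempty := not_nonempty_iff_eq_empty.1 hcon
  -- A component disjoint from the closure of `D` would be open by local connectedness. It is also
  -- closed, and the sphere is connected.
  have hopen : IsOpen (connectedComponentIn Dᶜ w) := by
    rw [isOpen_iff_mem_nhds]
    intro v hv
    have hv' : v ∉ closure D := fun h => by
      have : v ∈ connectedComponentIn Dᶜ w ∩ closure D := ⟨hv, h⟩
      rw [hempty] at this
      exact this
    obtain ⟨U, hU, hUV, hUc⟩ := exists_preconnected_nhds (isClosed_closure.isOpen_compl.mem_nhds hv')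
    refine mem_of_superset hU ?_
    rw [connectedComponentIn_eq hv]
    exact hUc.subset_connectedComponentIn (mem_of_mem_nhds hU)
      (hUV.trans (compl_subset_compl.2 subset_closure))
  have hclosed : IsClosed (connectedComponentIn Dᶜ w) := by
    refine isClosed_of_closure_subset ?_
    exact isPreconnected_connectedComponentIn.closure.subset_connectedComponentIn
      (subset_closure (mem_connectedComponentIn hw))
      (closure_minimal (connectedComponentIn_subset _ _) hD.isClosed_compl)
  rcases isClopen_iff.1 ⟨hclosed, hopen⟩ with h | h
  · have := mem_connectedComponentIn (F := Dᶜ) hw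
    rw [h] at this
    exact this
  · obtain ⟨v, hv⟩ := hne
    have : v ∈ connectedComponentIn Dᶜ w := h ▸ mem_univ v
    exact connectedComponentIn_subset _ _ this hv

variable {L : ℝ}

/-- The images of thin annuli under the collar map form a connected basis of the filter of approach
to the slit, as `exists_tendsto_quotMap` requires. -/
lemma exists_tendsto_sphereSlit (hL : 0 < L) (hf : IsConformalHomeo f (slitDomain L) D)
    {x : ℕ × ℕ} (hx : x ∈ treeNodes) :
    ∃ w ∉ D, Tendsto (fun z => quotMap D (f z)) (𝓝ˢ (sphereSlit L x) ⊓ 𝓟 (slitDomain L))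
      (𝓝 (quotMap D w)) := by
  obtain ⟨E, T, hE⟩ := exists_isCollar_slit hL hx
  have hEmem : ∀ t, 1 < t → t ≤ T → ∀ ξ ∈ annulus t, (E ξ : RiemannSphere) ∈ slitDomain L :=
    fun t _ h2 ξ hξ => coe_mem_slitDomain.2 (hE.mapsTo (annulus_mono h2 hξ))
  have hbasis : ∀ s ∈ 𝓝ˢ (sphereSlit L x) ⊓ 𝓟 (slitDomain L),
      ∃ t, 1 < t ∧ t ≤ T ∧ (fun v : ℂ => (v : RiemannSphere)) '' (E '' annulus t) ⊆ s := by
    intro s hs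
    rw [mem_inf_principal] at hs
    obtain ⟨O, hO, hpO, hOs⟩ := mem_nhdsSet_iff_exists.1 hs
    obtain ⟨t, h1, h2, h3⟩ := hE.small _ (hO.preimage OnePoint.continuous_coe)
      (fun v hv => hpO ⟨v, hv, rfl⟩)
    refine ⟨t, h1, h2, ?_⟩
    rintro _ ⟨_, ⟨ξ, hξ, rfl⟩, rfl⟩
    exact hOs (h3 ⟨ξ, hξ, rfl⟩) (hEmem t h1 h2 ξ hξ)
  have hmem : ∀ t, 1 < t → t ≤ T → (fun v : ℂ => (v : RiemannSphere)) '' (E '' annulus t) ∈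
      𝓝ˢ (sphereSlit L x) ⊓ 𝓟 (slitDomain L) := by
    intro t h1 h2
    rw [mem_inf_principal, mem_nhdsSet_iff_exists]
    refine ⟨_, OnePoint.isOpenMap_coe _ (hE.isOpen t h1 h2), image_mono subset_union_left, ?_⟩
    rintro _ ⟨v, hv | hv, rfl⟩ hvΩ
    · exact absurd hvΩ (sphereSlit_subset_compl hx ⟨v, hv, rfl⟩)
    · exact ⟨v, hv, rfl⟩
  have : NeBot (𝓝ˢ (sphereSlit L x) ⊓ 𝓟 (slitDomain L)) := by
    rw [← forall_mem_nonempty_iff_neBot]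
    intro s hs
    obtain ⟨t, h1, -, h3⟩ := hbasis s hs
    obtain ⟨r, hr1, hr2⟩ := exists_between h1
    refine ⟨_, h3 ⟨_, ⟨(r : ℂ), ⟨?_, ?_⟩, rfl⟩, rfl⟩⟩
    · rwa [Complex.norm_real, Real.norm_of_nonneg (by linarith)]
    · rwa [Complex.norm_real, Real.norm_of_nonneg (by linarith)]
  refine exists_tendsto_quotMap (hf.2.1 ▸ f.open_target) f hf.2.1 (fun s hs => ?_) ?_ ?_
  · obtain ⟨t, h1, h2, h3⟩ := hbasis s hs
    refine ⟨_, hmem t h1 h2, h3, ?_⟩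
    exact ((isPreconnected_annulus (by linarith)).image _
      (hE.differentiableOn.continuousOn.mono (annulus_mono h2))).image _
        OnePoint.continuous_coe.continuousOn
  · rw [hf.1]
    exact mem_inf_of_right (mem_principal_self _)
  · intro C hC hCs
    rw [hf.1] at hCs
    refine mem_inf_of_left (hC.isClosed.isOpen_compl.mem_nhdsSet.2 ?_)
    exact fun w hw hwC => sphereSlit_subset_compl hx hw (hCs hwC)

/-- No collar is available at `0`, but small disks around `0` minus the slits are connected. -/
lemma exists_tendsto_zero (hL : 0 < L) (hf : IsConformalHomeo f (slitDomain L) D) :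
    ∃ w ∉ D, Tendsto (fun z => quotMap D (f z)) (𝓝[slitDomain L] ((0 : ℂ) : RiemannSphere))
      (𝓝 (quotMap D w)) := by
  have : NeBot (𝓝[slitDomain L] ((0 : ℂ) : RiemannSphere)) :=
    mem_closure_iff_nhdsWithin_neBot.1 (dense_slitDomain _)
  refine exists_tendsto_quotMap (hf.2.1 ▸ f.open_target) f hf.2.1 (fun s hs => ?_) ?_ ?_
  · obtain ⟨O, hO, h0O, hOs⟩ := mem_nhdsWithin.1 hs
    obtain ⟨r, hr, hrO⟩ := Metric.isOpen_iff.1 (hO.preimage OnePoint.continuous_coe) 0 h0O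
    refine ⟨(fun v : ℂ => (v : RiemannSphere)) ''
      {z : ℂ | ‖z‖ < Real.exp (Real.log r) ∧ z ∉ slitSet L treeNodes}, ?_, ?_,
      (isPreconnected_ball_diff_slitSet hL _).image _ OnePoint.continuous_coe.continuousOn⟩
    · rw [Real.exp_log hr]
      refine mem_nhdsWithin.2 ⟨_, OnePoint.isOpenMap_coe _ (Metric.isOpen_ball (x := (0 : ℂ)) (ε := r)),
        ⟨0, Metric.mem_ball_self hr, rfl⟩, ?_⟩
      rintro _ ⟨⟨z, hz, rfl⟩, hzΩ⟩
      exact ⟨z, ⟨mem_ball_zero_iff.1 hz, coe_mem_slitDomain.1 hzΩ⟩, rfl⟩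
    · rw [Real.exp_log hr]
      rintro _ ⟨z, ⟨hz, hzK⟩, rfl⟩
      exact hOs ⟨hrO (mem_ball_zero_iff.2 hz), coe_mem_slitDomain.2 hzK⟩
  · rw [hf.1]
    exact self_mem_nhdsWithin
  · intro C hC hCs
    rw [hf.1] at hCs
    exact mem_nhdsWithin_of_mem_nhds
      (hC.isClosed.isOpen_compl.mem_nhds fun h => zero_notMem_slitDomain (hCs h))

/-- A conformal map of the slit domain extends to a homeomorphism of the decomposition spaces. -/
theorem exists_isHatExtension (hL : 0 < L) (hf : IsConformalHomeo f (slitDomain L) D) :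
    ∃ F : DecompositionSpace (slitDomain L) ≃ₜ DecompositionSpace D, IsHatExtension f F := by
  have hDo : IsOpen D := hf.2.1 ▸ f.open_target
  have hmaps : ∀ z ∈ slitDomain L, f z ∈ D := fun z hz =>
    hf.2.1 ▸ f.map_source (hf.1.symm ▸ hz)
  have := t2Space_decompositionSpace hDo
  set φ : RiemannSphere → DecompositionSpace D := fun z => quotMap D (f z) with hφ
  have hφΩ : ∀ z ∈ slitDomain L, Tendsto φ (𝓝[slitDomain L] z) (𝓝 (φ z)) := by
    intro z hz
    have h1 : ContinuousAt f z := f.continuousAt (hf.1.symm ▸ hz)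
    exact (continuous_quotMap.continuousAt.comp h1).tendsto.mono_left nhdsWithin_le_nhds
  have hslit : ∀ x ∈ treeNodes, ∃ w ∉ D, ∀ z ∈ sphereSlit L x,
      Tendsto φ (𝓝[slitDomain L] z) (𝓝 (quotMap D w)) := by
    intro x hx
    obtain ⟨w, hwD, hw⟩ := exists_tendsto_sphereSlit hL hf hx
    exact ⟨w, hwD, fun z hz => hw.mono_left (inf_le_inf_right _ (nhds_le_nhdsSet hz))⟩
  have hcompl : ∀ z ∉ slitDomain L, ∃ w ∉ D, Tendsto φ (𝓝[slitDomain L] z) (𝓝 (quotMap D w)) := by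
    intro z hz
    rcases notMem_slitDomain hz with rfl | ⟨x, hx, hzx⟩
    · exact exists_tendsto_zero hL hf
    · obtain ⟨w, hwD, hw⟩ := hslit x hx
      exact ⟨w, hwD, hw z hzx⟩
  have hlim : ∀ z, ∃ y, Tendsto φ (𝓝[slitDomain L] z) (𝓝 y) := by
    intro z
    by_cases hz : z ∈ slitDomain L
    · exact ⟨_, hφΩ z hz⟩
    · obtain ⟨w, -, hw⟩ := hcompl z hz
      exact ⟨_, hw⟩
  -- The domain is dense, and the limits taken in the decomposition space of `D` exist at every
  -- point, so they define a continuous map on the sphere.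
  set Φ := extendFrom (slitDomain L) φ with hΦ
  have hΦc : Continuous Φ := continuous_extendFrom dense_slitDomain hlim
  have hΦeq : ∀ {z y}, Tendsto φ (𝓝[slitDomain L] z) (𝓝 y) → Φ z = y :=
    fun h => extendFrom_eq (dense_slitDomain _) h
  have hΦΩ : ∀ z ∈ slitDomain L, Φ z = quotMap D (f z) := fun z hz => hΦeq (hφΩ z hz)
  have hΦtend : ∀ z, Tendsto φ (𝓝[slitDomain L] z) (𝓝 (Φ z)) := by
    intro z
    obtain ⟨y, hy⟩ := hlim z
    rwa [hΦeq hy]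
  have hΦcompl : ∀ z ∉ slitDomain L, ∃ w ∉ D, Φ z = quotMap D w := by
    intro z hz
    obtain ⟨w, hwD, hw⟩ := hcompl z hz
    exact ⟨w, hwD, hΦeq hw⟩
  have hΦslit : ∀ x ∈ treeNodes, ∀ z ∈ sphereSlit L x, ∀ z' ∈ sphereSlit L x, Φ z = Φ z' := by
    intro x hx z hz z' hz'
    obtain ⟨w, -, hw⟩ := hslit x hx
    rw [hΦeq (hw z hz), hΦeq (hw z' hz')]
  have hcluster : ∀ {l : Filter RiemannSphere} {w : RiemannSphere} {a : DecompositionSpace D},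
      Tendsto φ l (𝓝 a) → ClusterPt w (map f l) → quotMap D w = a := by
    intro l w a hl hw
    have h1 : ClusterPt (quotMap D w) (map φ l) := by
      have h2 : map φ l = map (quotMap D) (map f l) := by
        rw [map_map]
        rfl
      rw [h2]
      exact hw.map continuous_quotMap.continuousAt tendsto_map
    exact (eq_of_nhds_neBot (h1.mono hl)).trans rfl
  have hresp : ∀ z z', decompositionSetoid (slitDomain L) z z' → Φ z = Φ z' := by
    rintro z z' (rfl | ⟨p, hp, hz, hz'⟩)
    · rfl
    · rw [complComponents_slitDomain hL] at hp
      obtain ⟨_ | ⟨x, hx⟩, rfl⟩ := hp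
      · rw [mem_singleton_iff.1 hz, mem_singleton_iff.1 hz']
      · exact hΦslit x hx z hz z' hz'
  let F : DecompositionSpace (slitDomain L) → DecompositionSpace D := Quotient.lift Φ hresp
  have hF : ∀ z, F (quotMap (slitDomain L) z) = Φ z := fun z => rfl
  have hFc : Continuous F := hΦc.quotient_lift hresp
  -- Two complementary points with the same image would yield cluster points of `f` in one component
  -- of `Dᶜ`. `not_same_component` needs a collar for only one of them, so the slits are also
  -- separated from `0`.
  have hsep : ∀ x ∈ treeNodes, ∀ z ∈ sphereSlit L x, ∀ z' ∉ sphereSlit L x, z' ∉ slitDomain L →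
      Φ z ≠ Φ z' := by
    intro x hx z hz z' hz' hz'Ω heq
    obtain ⟨w, hwD, hw⟩ := exists_tendsto_sphereSlit hL hf hx
    have hΦz : Φ z = quotMap D w :=
      hΦeq (hw.mono_left (inf_le_inf_right _ (nhds_le_nhdsSet hz)))
    obtain ⟨E, T, hE⟩ := exists_isCollar_slit hL hx
    have hne : NeBot (𝓝[slitDomain L] z) := mem_closure_iff_nhdsWithin_neBot.1 (dense_slitDomain _)
    have hne' : NeBot (𝓝[slitDomain L] z') :=
      mem_closure_iff_nhdsWithin_neBot.1 (dense_slitDomain _)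
    have hne'' : NeBot (𝓝ˢ (sphereSlit L x) ⊓ 𝓟 (slitDomain L)) :=
      hne.mono (inf_le_inf_right _ (nhds_le_nhdsSet hz))
    obtain ⟨v, hv⟩ := exists_clusterPt_of_compactSpace
      (map f (𝓝ˢ (sphereSlit L x) ⊓ 𝓟 (slitDomain L)))
    obtain ⟨v', hv'⟩ := exists_clusterPt_of_compactSpace (map f (𝓝[slitDomain L] z'))
    have hvq : v ∈ connectedComponentIn Dᶜ w := by
      rw [← preimage_quotMap_singleton hwD]
      exact hcluster hw hv
    have hv'q : v' ∈ connectedComponentIn Dᶜ w := by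
      rw [← preimage_quotMap_singleton hwD, mem_preimage, mem_singleton_iff,
        hcluster (hΦtend z') hv', ← heq, hΦz]
    have hW : (fun v : ℂ => (v : RiemannSphere)) ⁻¹' slitDomain L = (slitSet L treeNodes)ᶜ := by
      ext v
      exact coe_mem_slitDomain
    refine not_same_component (isSphereDomain_slitDomain hL) hf (hW ▸ hE)
      (Set.disjoint_left.2 fun v hv => sphereSlit_subset_compl hx hv)
      (mem_inf_of_right (mem_principal_self _)) (fun O hO hpO => mem_inf_of_left
        ((OnePoint.isOpenMap_coe _ hO).mem_nhdsSet.2 (image_mono hpO))) hz'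
      isPreconnected_connectedComponentIn
      (Set.disjoint_left.2 fun v hv => connectedComponentIn_subset _ _ hv) hvq hv'q hv hv'
  have hFinj : Function.Injective F := by
    intro a b hab
    obtain ⟨z, rfl⟩ := surjective_quotMap a
    obtain ⟨z', rfl⟩ := surjective_quotMap b
    rw [hF, hF] at hab
    have hmixed : ∀ z ∈ slitDomain L, ∀ z' ∉ slitDomain L, Φ z ≠ Φ z' := by
      intro z hz z' hz' heq
      obtain ⟨w, hwD, hw⟩ := hΦcompl z' hz'
      rw [hΦΩ z hz, hw, eq_comm, quotMap_eq_iff_of_mem (hmaps z hz)] at heq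
      exact hwD (heq ▸ hmaps z hz)
    by_cases hz : z ∈ slitDomain L
    · by_cases hz' : z' ∈ slitDomain L
      · rw [hΦΩ z hz, hΦΩ z' hz', quotMap_eq_iff_of_mem (hmaps z' hz')] at hab
        rw [f.injOn (hf.1.symm ▸ hz) (hf.1.symm ▸ hz') hab]
      · exact absurd hab (hmixed z hz z' hz')
    · by_cases hz' : z' ∈ slitDomain L
      · exact absurd hab.symm (hmixed z' hz' z hz)
      · have hsame : ∀ x ∈ treeNodes, ∀ z ∈ sphereSlit L x, ∀ z' ∈ sphereSlit L x,
            quotMap (slitDomain L) z = quotMap (slitDomain L) z' := by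
          intro x hx z hz z' hz'
          rw [quotMap_eq_iff]
          refine Or.inr ⟨sphereSlit_subset_compl hx hz', ?_⟩
          rwa [connectedComponentIn_of_mem_sphereSlit hL hx hz']
        rcases notMem_slitDomain hz with rfl | ⟨x, hx, hzx⟩
        · rcases notMem_slitDomain hz' with rfl | ⟨x', hx', hzx'⟩
          · rfl
          · exact absurd hab.symm (hsep x' hx' z' hzx' _ (zero_notMem_sphereSlit x') hz)
        · by_cases hz'x : z' ∈ sphereSlit L x
          · exact hsame x hx z hzx z' hz'x
          · exact absurd hab (hsep x hx z hzx z' hz'x hz')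
  -- The range is compact, hence closed, and contains the classes of points of `D`. Every
  -- complementary component of `D` touches the closure of `D`.
  have hFsurj : Function.Surjective F := by
    have hcl : IsClosed (range F) := (isCompact_range hFc).isClosed
    have hDsub : D ⊆ quotMap D ⁻¹' range F := by
      intro v hv
      have hvs : f.symm v ∈ slitDomain L := hf.1 ▸ f.map_target (hf.2.1.symm ▸ hv)
      refine ⟨quotMap _ (f.symm v), ?_⟩
      rw [hF, hΦΩ _ hvs, f.right_inv (hf.2.1.symm ▸ hv)]
    have hclD : closure D ⊆ quotMap D ⁻¹' range F :=
      closure_minimal hDsub (hcl.preimage continuous_quotMap)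
    have hDne : D.Nonempty := ⟨_, hmaps ∞ infty_mem_slitDomain⟩
    intro a
    obtain ⟨w, rfl⟩ := surjective_quotMap a
    by_cases hw : w ∈ D
    · exact hDsub hw
    · obtain ⟨v, hv, hvD⟩ := connectedComponentIn_inter_closure_nonempty hDo hDne hw
      have h1 : quotMap D v = quotMap D w := quotMap_eq_iff.2 (Or.inr ⟨hw, hv⟩)
      exact h1 ▸ hclD hvD
  let e : DecompositionSpace (slitDomain L) ≃ DecompositionSpace D :=
    Equiv.ofBijective F ⟨hFinj, hFsurj⟩
  have hec : Continuous e := hFc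
  exact ⟨hec.homeoOfEquivCompactToT2, fun z hz => hΦΩ z hz⟩

end RiemannSphere

namespace RiemannSphere

open Filter Set Topology MeasureTheory

/-! ### Cut-off functions of small energy -/

/-- A standard smooth bump function: it is `1` on the unit disk and vanishes off the disk of
radius `2`. -/
noncomputable def unitBump : ContDiffBump (0 : ℂ) := ⟨1, 2, one_pos, one_lt_two⟩

/-- The bump function which is `1` on the disk of radius `t` around `w₀` and vanishes off the disk
of radius `2t`. -/
noncomputable def scaledBump (w₀ : ℂ) (t : ℝ) (w : ℂ) : ℝ := unitBump (t⁻¹ • (w - w₀))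

lemma exists_lipschitz_unitBump : ∃ C : NNReal, 1 ≤ C ∧ LipschitzWith C unitBump := by
  obtain ⟨C, hC⟩ := (unitBump.contDiff (n := 1)).lipschitzWith_of_hasCompactSupport
    unitBump.hasCompactSupport one_ne_zero
  exact ⟨max C 1, le_max_right _ _, hC.weaken (le_max_left _ _)⟩

section scaledBump

variable {w₀ : ℂ} {t : ℝ}

lemma contDiff_scaledBump (w₀ : ℂ) (t : ℝ) : ContDiff ℝ 1 (scaledBump w₀ t) :=
  unitBump.contDiff.comp (ContDiff.const_smul t⁻¹ (contDiff_id.sub contDiff_const))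

lemma scaledBump_eq_one (ht : 0 < t) {w : ℂ} (hw : ‖w - w₀‖ ≤ t) : scaledBump w₀ t w = 1 := by
  refine unitBump.one_of_mem_closedBall ?_
  rw [mem_closedBall_zero_iff, norm_smul, norm_inv, Real.norm_of_nonneg ht.le]
  change t⁻¹ * ‖w - w₀‖ ≤ 1
  rwa [inv_mul_le_one₀ ht]

lemma scaledBump_eq_zero (ht : 0 < t) {w : ℂ} (hw : 2 * t ≤ ‖w - w₀‖) : scaledBump w₀ t w = 0 := by
  refine unitBump.zero_of_le_dist ?_
  rw [dist_zero_right, norm_smul, norm_inv, Real.norm_of_nonneg ht.le]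
  change 2 ≤ t⁻¹ * ‖w - w₀‖
  rw [inv_mul_eq_div, le_div_iff₀ ht]
  exact hw

lemma scaledBump_nonneg (w : ℂ) : 0 ≤ scaledBump w₀ t w := unitBump.nonneg

lemma scaledBump_le_one (w : ℂ) : scaledBump w₀ t w ≤ 1 := unitBump.le_one

lemma abs_scaledBump_sub_le {C : NNReal} (hC : LipschitzWith C unitBump) (ht : 0 < t) (x y : ℂ) :
    |scaledBump w₀ t x - scaledBump w₀ t y| ≤ C / t * ‖x - y‖ := by
  have h := hC.dist_le_mul (t⁻¹ • (x - w₀)) (t⁻¹ • (y - w₀))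
  rw [Real.dist_eq, dist_eq_norm, ← smul_sub, sub_sub_sub_cancel_right, norm_smul, norm_inv,
    Real.norm_of_nonneg ht.le] at h
  refine h.trans_eq ?_
  ring

lemma norm_fderiv_scaledBump_le {C : NNReal} (hC : LipschitzWith C unitBump) (ht : 0 < t) (w : ℂ) :
    ‖fderiv ℝ (scaledBump w₀ t) w‖ ≤ C / t := by
  have h : LipschitzWith (C / ⟨t, ht.le⟩) (scaledBump w₀ t) :=
    LipschitzWith.of_dist_le_mul fun x y => by
      rw [Real.dist_eq, dist_eq_norm]
      exact abs_scaledBump_sub_le hC ht x y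
  exact norm_fderiv_le_of_lipschitz ℝ h

end scaledBump

lemma fderiv_scaledBump_eq_zero {w₀ : ℂ} {t : ℝ} (ht : 0 < t) {w : ℂ}
    (hw : ¬ (t ≤ ‖w - w₀‖ ∧ ‖w - w₀‖ ≤ 2 * t)) : fderiv ℝ (scaledBump w₀ t) w = 0 := by
  have hcont : Continuous fun w : ℂ => ‖w - w₀‖ := by fun_prop
  rcases lt_or_ge ‖w - w₀‖ t with h | h
  · have : scaledBump w₀ t =ᶠ[𝓝 w] fun _ => 1 :=
      (hcont.continuousAt.eventually_lt_const h).mono fun v hv => scaledBump_eq_one ht hv.le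
    rw [this.fderiv_eq, fderiv_const_apply]
  · have h' : 2 * t < ‖w - w₀‖ := by
      by_contra hc
      exact hw ⟨h, not_lt.1 hc⟩
    have : scaledBump w₀ t =ᶠ[𝓝 w] fun _ => 0 :=
      (hcont.continuousAt.eventually_const_lt h').mono fun v hv => scaledBump_eq_zero ht hv.le
    rw [this.fderiv_eq, fderiv_const_apply]

/-- The closed round annulus `t ≤ |w - w₀| ≤ 2t`. -/
def closedRing (w₀ : ℂ) (t : ℝ) : Set ℂ := {w | t ≤ ‖w - w₀‖ ∧ ‖w - w₀‖ ≤ 2 * t}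

/-- A bump function is constant on preconnected sets which do not meet the ring in which it
changes. -/
lemma scaledBump_eq_of_disjoint {w₀ : ℂ} {t : ℝ} (ht : 0 < t) {q : Set ℂ} (hq : IsPreconnected q)
    (h : ¬ (q ∩ closedRing w₀ t).Nonempty) {x y : ℂ} (hx : x ∈ q) (hy : y ∈ q) :
    scaledBump w₀ t x = scaledBump w₀ t y := by
  have hcont : Continuous fun w : ℂ => ‖w - w₀‖ := by fun_prop
  have hcover : q ⊆ {w | ‖w - w₀‖ < t} ∪ {w | 2 * t < ‖w - w₀‖} := by
    intro w hw
    rcases lt_or_ge ‖w - w₀‖ t with h1 | h1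
    · exact Or.inl h1
    · right
      by_contra hc
      exact h ⟨w, hw, h1, not_lt.1 hc⟩
  have hdisj : Disjoint {w | ‖w - w₀‖ < t} {w | 2 * t < ‖w - w₀‖} := by
    refine Set.disjoint_left.2 fun w h1 h2 => ?_
    have h1' : ‖w - w₀‖ < t := h1
    have h2' : 2 * t < ‖w - w₀‖ := h2
    linarith
  rcases hq.subset_or_subset (isOpen_lt hcont continuous_const) (isOpen_lt continuous_const hcont)
    hdisj hcover with h1 | h1
  · rw [scaledBump_eq_one ht (le_of_lt (h1 hx)), scaledBump_eq_one ht (le_of_lt (h1 hy))]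
  · rw [scaledBump_eq_zero ht (le_of_lt (h1 hx)), scaledBump_eq_zero ht (le_of_lt (h1 hy))]

/-- Fatness of disks: disjoint disks which meet a ring at scale `t` have total size at most `t`,
when large disks are counted as disks of size `t`. -/
lemma sum_min_sq_le {ι : Type*} {c : ι → ℂ} {s : ι → ℝ} (hs : ∀ i, 0 ≤ s i)
    (hdisj : Pairwise fun i j => Disjoint (Metric.closedBall (c i) (s i))
      (Metric.closedBall (c j) (s j))) {w₀ : ℂ} {t : ℝ} (ht : 0 < t) (S : Finset ι)
    (hS : ∀ i ∈ S, (Metric.closedBall (c i) (s i) ∩ closedRing w₀ t).Nonempty) :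
    ∑ i ∈ S, min (s i) t ^ 2 ≤ 16 * t ^ 2 := by
  -- Each disk contains a disk of radius `min (s i) t` within distance `4t` of `w₀`, obtained by
  -- contracting it towards a point in the ring. Comparing areas gives the constant `16`.
  have hball : ∀ i ∈ S, ∃ y, Metric.closedBall y (min (s i) t) ⊆ Metric.closedBall (c i) (s i) ∧
      Metric.closedBall y (min (s i) t) ⊆ Metric.closedBall w₀ (4 * t) := by
    intro i hi
    obtain ⟨x, hx, -, hx2⟩ := hS i hi
    rw [mem_closedBall_iff_norm] at hx
    have hm0 : 0 ≤ min (s i) t := le_min (hs i) ht.le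
    have hms : min (s i) t ≤ s i := min_le_left _ _
    have hmt : min (s i) t ≤ t := min_le_right _ _
    set m := min (s i) t
    -- The ratio of contraction; a disk of radius `0` has to be treated apart.
    have hlam : ∃ l : ℝ, 0 ≤ l ∧ l ≤ 1 ∧ l * s i = m := by
      rcases (hs i).eq_or_lt with h0 | h0
      · exact ⟨0, le_rfl, zero_le_one, by linarith⟩
      · exact ⟨m / s i, by positivity, (div_le_one h0).2 hms, by field_simp⟩
    obtain ⟨l, hl0, hl1, hlm⟩ := hlam
    have h1 : ‖x + (l : ℂ) * (c i - x) - c i‖ ≤ s i - m := by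
      have : x + (l : ℂ) * (c i - x) - c i = ((1 - l : ℝ) : ℂ) * (x - c i) := by
        push_cast
        ring
      rw [this, norm_mul, Complex.norm_real, Real.norm_of_nonneg (by linarith)]
      nlinarith
    have h2 : ‖x + (l : ℂ) * (c i - x) - w₀‖ ≤ 2 * t + m := by
      have : x + (l : ℂ) * (c i - x) - w₀ = (x - w₀) + (l : ℂ) * (c i - x) := by ring
      rw [this]
      refine (norm_add_le _ _).trans (add_le_add hx2 ?_)
      rw [norm_mul, Complex.norm_real, Real.norm_of_nonneg hl0, norm_sub_rev, ← hlm]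
      exact mul_le_mul_of_nonneg_left hx hl0
    refine ⟨x + (l : ℂ) * (c i - x), ?_, ?_⟩
    · refine Metric.closedBall_subset_closedBall' ?_
      rw [dist_eq_norm]
      linarith
    · refine Metric.closedBall_subset_closedBall' ?_
      rw [dist_eq_norm]
      linarith
  choose! y hy1 hy2 using hball
  have hvol : ∑ i ∈ S, volume (Metric.closedBall (y i) (min (s i) t)) ≤
      volume (Metric.closedBall w₀ (4 * t)) := by
    rw [← measure_biUnion_finset (fun i hi j hj hij => (hdisj hij).mono (hy1 i hi) (hy1 j hj))
      fun i _ => Metric.isClosed_closedBall.measurableSet]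
    exact measure_mono (iUnion₂_subset hy2)
  simp only [Complex.volume_closedBall] at hvol
  rw [← Finset.sum_mul, ENNReal.mul_le_mul_iff_left (by simp [NNReal.pi_ne_zero]) (by simp)] at hvol
  have hvol' : ENNReal.ofReal (∑ i ∈ S, min (s i) t ^ 2) ≤ ENNReal.ofReal ((4 * t) ^ 2) := by
    rw [ENNReal.ofReal_sum_of_nonneg fun i _ => sq_nonneg _, ENNReal.ofReal_pow (by positivity)]
    refine (Finset.sum_congr rfl fun i _ => ?_).trans_le hvol
    rw [ENNReal.ofReal_pow (le_min (hs i) ht.le)]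
  rw [ENNReal.ofReal_le_ofReal_iff (by positivity)] at hvol'
  linarith

/-- A function which is `1` near `w₀` and `0` off a given neighbourhood, with small Dirichlet energy
and small sum of squared oscillations over a family of disjoint disks which shrink at `w₀`. -/
theorem exists_cutoff {ι : Type*} {c : ι → ℂ} {s : ι → ℝ} (hs : ∀ i, 0 ≤ s i)
    (hdisj : Pairwise fun i j => Disjoint (Metric.closedBall (c i) (s i))
      (Metric.closedBall (c j) (s j))) {w₀ : ℂ}
    (hshrink : ∀ δ > 0, ∃ δ' > 0, ∀ i, (Metric.closedBall (c i) (s i) ∩ Metric.ball w₀ δ').Nonempty →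
      Metric.closedBall (c i) (s i) ⊆ Metric.ball w₀ δ) {δ ε : ℝ} (hδ : 0 < δ) (hε : 0 < ε) :
    ∃ U : ℂ → ℝ, ContDiff ℝ 1 U ∧ (∀ᶠ w in 𝓝 w₀, U w = 1) ∧ (∀ w, δ ≤ ‖w - w₀‖ → U w = 0) ∧
      ∫⁻ w, ENNReal.ofReal (‖fderiv ℝ U w‖ ^ 2) ≤ ENNReal.ofReal ε ∧
      ∃ o : ι → ℝ, (∀ i, 0 ≤ o i) ∧
        (∀ i, ∀ x ∈ Metric.closedBall (c i) (s i), ∀ y ∈ Metric.closedBall (c i) (s i),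
          |U x - U y| ≤ o i) ∧
        ∀ S : Finset ι, ∑ i ∈ S, o i ^ 2 ≤ ε := by
  obtain ⟨C, hC1, hC⟩ := exists_lipschitz_unitBump
  have hC1' : (1 : ℝ) ≤ C := by exact_mod_cast hC1
  choose! d hd hdsub using hshrink
  -- Each scale is so small compared with the previous one that the rings are disjoint and no disk
  -- meets two of them.
  let t : ℕ → ℝ := fun k => Nat.rec (δ / 2) (fun _ r => min (d r) r / 4) k
  have ht0 : t 0 = δ / 2 := rfl
  have htsucc : ∀ k, t (k + 1) = min (d (t k)) (t k) / 4 := fun k => rfl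
  have htpos : ∀ k, 0 < t k := by
    intro k
    induction k with
    | zero => rw [ht0]; linarith
    | succ k ih => rw [htsucc]; exact div_pos (lt_min (hd _ ih) ih) (by norm_num)
  have htanti : Antitone t := antitone_nat_of_succ_le fun k => by
    rw [htsucc]
    linarith [min_le_right (d (t k)) (t k), htpos k]
  have htlt : ∀ {j k}, j < k → 2 * t k < t j := by
    intro j k hjk
    have h1 : t k ≤ t (j + 1) := htanti hjk
    rw [htsucc] at h1
    linarith [min_le_right (d (t j)) (t j), htpos j]
  have htlt' : ∀ {j k}, j < k → 2 * t k < d (t j) := by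
    intro j k hjk
    have h1 : t k ≤ t (j + 1) := htanti hjk
    rw [htsucc] at h1
    linarith [min_le_left (d (t j)) (t j), hd _ (htpos j)]
  -- a point lies in at most one ring, and a disk meets at most one ring
  have hring : ∀ w, ∀ j k, w ∈ closedRing w₀ (t j) → w ∈ closedRing w₀ (t k) → j = k := by
    have key : ∀ w, ∀ j k, j < k → w ∈ closedRing w₀ (t j) → w ∉ closedRing w₀ (t k) := by
      rintro w j k hjk ⟨h1, -⟩ ⟨-, h2⟩
      linarith [htlt hjk]
    intro w j k hj hk
    rcases lt_trichotomy j k with h | h | h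
    · exact absurd hk (key w j k h hj)
    · exact h
    · exact absurd hj (key w k j h hk)
  have hmeet : ∀ i, ∀ j k, (Metric.closedBall (c i) (s i) ∩ closedRing w₀ (t j)).Nonempty →
      (Metric.closedBall (c i) (s i) ∩ closedRing w₀ (t k)).Nonempty → j = k := by
    have key : ∀ i, ∀ j k, j < k → (Metric.closedBall (c i) (s i) ∩ closedRing w₀ (t j)).Nonempty →
        ¬ (Metric.closedBall (c i) (s i) ∩ closedRing w₀ (t k)).Nonempty := by
      rintro i j k hjk ⟨x, hx, hx1, -⟩ ⟨y, hy, -, hy2⟩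
      have h1 := hdsub (t j) (htpos j) i
        ⟨y, hy, by rw [mem_ball_iff_norm]; exact hy2.trans_lt (htlt' hjk)⟩ hx
      rw [mem_ball_iff_norm] at h1
      linarith
    intro i j k hj hk
    rcases lt_trichotomy j k with h | h | h
    · exact absurd hk (key i j k h hj)
    · exact h
    · exact absurd hj (key i k j h hk)
  -- One scale costs at most `16 * C ^ 2` in energy and `64 * C ^ 2` in squared oscillations. The
  -- contributions of the scales are orthogonal, so the average over `K` scales costs `1 / K` times
  -- as much.
  obtain ⟨K, hK⟩ := exists_nat_gt (max 1 (64 * C ^ 2 / ε))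
  have hK1 : (1 : ℝ) < K := (le_max_left _ _).trans_lt hK
  have hK0 : (0 : ℝ) < K := one_pos.trans hK1
  have hKε : 64 * (C : ℝ) ^ 2 / K ≤ ε := by
    have h1 : 64 * (C : ℝ) ^ 2 / ε < K := (le_max_right _ _).trans_lt hK
    rw [div_lt_iff₀ hε] at h1
    rw [div_le_iff₀ hK0]
    linarith
  let U : ℂ → ℝ := fun w => (K : ℝ)⁻¹ * ∑ k ∈ Finset.range K, scaledBump w₀ (t k) w
  have hfd : ∀ w, fderiv ℝ U w =
      (K : ℝ)⁻¹ • ∑ k ∈ Finset.range K, fderiv ℝ (scaledBump w₀ (t k)) w := by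
    intro w
    have hda : ∀ k ∈ Finset.range K, DifferentiableAt ℝ (scaledBump w₀ (t k)) w := fun k _ =>
      (contDiff_scaledBump w₀ (t k)).differentiable (by norm_num) w
    have h1 : HasFDerivAt (fun w => ∑ k ∈ Finset.range K, scaledBump w₀ (t k) w)
        (∑ k ∈ Finset.range K, fderiv ℝ (scaledBump w₀ (t k)) w) w :=
      HasFDerivAt.fun_sum fun k hk => (hda k hk).hasFDerivAt
    exact (h1.const_mul _).fderiv
  have hUpt : ∀ w, ENNReal.ofReal (‖fderiv ℝ U w‖ ^ 2) ≤ ∑ k ∈ Finset.range K,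
      (closedRing w₀ (t k)).indicator (fun _ => ENNReal.ofReal ((C / (K * t k)) ^ 2)) w := by
    intro w
    by_cases hw : ∃ k ∈ Finset.range K, w ∈ closedRing w₀ (t k)
    · obtain ⟨k, hk, hwk⟩ := hw
      have h1 : ∑ k ∈ Finset.range K, fderiv ℝ (scaledBump w₀ (t k)) w =
          fderiv ℝ (scaledBump w₀ (t k)) w := by
        refine Finset.sum_eq_single_of_mem k hk fun j _ hjk => ?_
        exact fderiv_scaledBump_eq_zero (htpos j) fun h => hjk (hring w j k h hwk)
      refine le_trans ?_ (Finset.single_le_sum (fun _ _ => zero_le) hk)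
      rw [indicator_of_mem hwk, hfd, h1, norm_smul, norm_inv, Real.norm_of_nonneg hK0.le]
      refine ENNReal.ofReal_le_ofReal (pow_le_pow_left₀ (by positivity) ?_ 2)
      have h2 := norm_fderiv_scaledBump_le (w₀ := w₀) hC (htpos k) w
      calc (K : ℝ)⁻¹ * ‖fderiv ℝ (scaledBump w₀ (t k)) w‖ ≤ (K : ℝ)⁻¹ * (C / t k) := by gcongr
        _ = C / (K * t k) := by field_simp
    · push Not at hw
      have h1 : ∑ k ∈ Finset.range K, fderiv ℝ (scaledBump w₀ (t k)) w = 0 :=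
        Finset.sum_eq_zero fun k hk => fderiv_scaledBump_eq_zero (htpos k) (hw k hk)
      rw [hfd, h1]
      simp
  -- Small disks are estimated by the Lipschitz constant `C / t k`. For large ones the oscillation
  -- is at most `1`, hence at most `2 * C` since `C ≥ 1`.
  let o' : ι → ℕ → ℝ := fun i k => open Classical in
    if (Metric.closedBall (c i) (s i) ∩ closedRing w₀ (t k)).Nonempty
      then 2 * C * min (s i) (t k) / t k else 0
  have ho'0 : ∀ i k, 0 ≤ o' i k := by
    intro i k
    have h1 := hs i
    have h2 := htpos k
    simp only [o']
    split_ifs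
    · exact div_nonneg (mul_nonneg (by positivity) (le_min h1 h2.le)) h2.le
    · exact le_rfl
  have ho'le : ∀ i k, ∀ x ∈ Metric.closedBall (c i) (s i), ∀ y ∈ Metric.closedBall (c i) (s i),
      |scaledBump w₀ (t k) x - scaledBump w₀ (t k) y| ≤ o' i k := by
    intro i k x hx y hy
    simp only [o']
    split_ifs with h
    · rcases le_total (s i) (t k) with hst | hst
      · rw [min_eq_left hst]
        refine (abs_scaledBump_sub_le hC (htpos k) x y).trans ?_
        have h1 : ‖x - y‖ ≤ 2 * s i := by
          rw [← dist_eq_norm]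
          refine (dist_triangle_right x y (c i)).trans ?_
          linarith [Metric.mem_closedBall.1 hx, Metric.mem_closedBall.1 hy]
        have h2 : (0 : ℝ) ≤ C / t k := div_nonneg (by positivity) (htpos k).le
        calc C / t k * ‖x - y‖ ≤ C / t k * (2 * s i) := mul_le_mul_of_nonneg_left h1 h2
          _ = 2 * C * s i / t k := by ring
      · rw [min_eq_right hst, mul_div_assoc, div_self (htpos k).ne', mul_one, abs_le]
        have h1 := scaledBump_nonneg (w₀ := w₀) (t := t k) x
        have h2 := scaledBump_nonneg (w₀ := w₀) (t := t k) y
        have h3 := scaledBump_le_one (w₀ := w₀) (t := t k) x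
        have h4 := scaledBump_le_one (w₀ := w₀) (t := t k) y
        constructor <;> linarith
    · rw [scaledBump_eq_of_disjoint (htpos k) (convex_closedBall _ _).isPreconnected h hx hy,
        sub_self, abs_zero]
  refine ⟨U, ?_, ?_, ?_, ?_, fun i => (K : ℝ)⁻¹ * ∑ k ∈ Finset.range K, o' i k, ?_, ?_, ?_⟩
  · exact contDiff_const.mul (ContDiff.sum fun k _ => contDiff_scaledBump w₀ (t k))
  · filter_upwards [Metric.closedBall_mem_nhds w₀ (htpos K)] with w hw
    rw [mem_closedBall_iff_norm] at hw
    have h1 : ∑ k ∈ Finset.range K, scaledBump w₀ (t k) w = ∑ k ∈ Finset.range K, 1 :=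
      Finset.sum_congr rfl fun k hk => scaledBump_eq_one (htpos k)
        (hw.trans (htanti (Finset.mem_range.1 hk).le))
    simp only [U]
    rw [h1, Finset.sum_const, Finset.card_range, nsmul_eq_mul, mul_one, inv_mul_cancel₀ hK0.ne']
  · intro w hw
    have h1 : ∑ k ∈ Finset.range K, scaledBump w₀ (t k) w = 0 := by
      refine Finset.sum_eq_zero fun k _ => scaledBump_eq_zero (htpos k) ?_
      have := htanti (Nat.zero_le k)
      rw [ht0] at this
      linarith
    simp only [U]
    rw [h1, mul_zero]
  · have hmeas : ∀ k, MeasurableSet (closedRing w₀ (t k)) := fun k => by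
      have hcont : Continuous fun w : ℂ => ‖w - w₀‖ := by fun_prop
      exact ((isClosed_le continuous_const hcont).inter
        (isClosed_le hcont continuous_const)).measurableSet
    have hone : ∀ k, ∫⁻ w, (closedRing w₀ (t k)).indicator
        (fun _ => ENNReal.ofReal ((C / (K * t k)) ^ 2)) w ≤ ENNReal.ofReal (16 * C ^ 2 / K ^ 2) := by
      intro k
      have htk := htpos k
      rw [lintegral_indicator_const (hmeas k)]
      have hsub : closedRing w₀ (t k) ⊆ Metric.closedBall w₀ (2 * t k) := fun w hw => by
        rw [mem_closedBall_iff_norm]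
        exact hw.2
      refine (mul_le_mul_right (measure_mono hsub) _).trans ?_
      rw [Complex.volume_closedBall, ← ENNReal.ofReal_pow (by positivity),
        ← ENNReal.ofReal_coe_nnreal (p := NNReal.pi), ← ENNReal.ofReal_mul (by positivity),
        ← ENNReal.ofReal_mul (by positivity)]
      refine ENNReal.ofReal_le_ofReal ?_
      have hpi : (NNReal.pi : ℝ) ≤ 4 := Real.pi_le_four
      have h1 : (C / (K * t k)) ^ 2 * ((2 * t k) ^ 2 * (NNReal.pi : ℝ)) =
          4 * C ^ 2 / K ^ 2 * NNReal.pi := by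
        field_simp
        ring
      rw [h1]
      have h2 : (0 : ℝ) ≤ 4 * C ^ 2 / K ^ 2 := by positivity
      calc 4 * (C : ℝ) ^ 2 / K ^ 2 * NNReal.pi ≤ 4 * C ^ 2 / K ^ 2 * 4 :=
            mul_le_mul_of_nonneg_left hpi h2
        _ = 16 * C ^ 2 / K ^ 2 := by ring
    calc ∫⁻ w, ENNReal.ofReal (‖fderiv ℝ U w‖ ^ 2) ≤ ∫⁻ w, ∑ k ∈ Finset.range K,
          (closedRing w₀ (t k)).indicator (fun _ => ENNReal.ofReal ((C / (K * t k)) ^ 2)) w :=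
          lintegral_mono hUpt
      _ = ∑ k ∈ Finset.range K, ∫⁻ w, (closedRing w₀ (t k)).indicator
          (fun _ => ENNReal.ofReal ((C / (K * t k)) ^ 2)) w :=
          lintegral_finsetSum _ fun k _ => measurable_const.indicator (hmeas k)
      _ ≤ ∑ k ∈ Finset.range K, ENNReal.ofReal (16 * C ^ 2 / K ^ 2) :=
          Finset.sum_le_sum fun k _ => hone k
      _ = ENNReal.ofReal (16 * C ^ 2 / K) := by
          rw [Finset.sum_const, Finset.card_range, nsmul_eq_mul, ← ENNReal.ofReal_natCast,
            ← ENNReal.ofReal_mul hK0.le]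
          congr 1
          field_simp
      _ ≤ ENNReal.ofReal ε := by
          refine ENNReal.ofReal_le_ofReal (le_trans ?_ hKε)
          gcongr
          norm_num
  · exact fun i => mul_nonneg (by positivity) (Finset.sum_nonneg fun k _ => ho'0 i k)
  · intro i x hx y hy
    simp only [U]
    rw [← mul_sub, ← Finset.sum_sub_distrib, abs_mul, abs_of_pos (inv_pos.2 hK0)]
    refine mul_le_mul_of_nonneg_left ?_ (by positivity)
    exact (Finset.abs_sum_le_sum_abs _ _).trans (Finset.sum_le_sum fun k _ => ho'le i k x hx y hy)
  · intro S
    -- At most one term of the sum is nonzero, so squaring commutes with summation.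
    have hsq : ∀ i, ((K : ℝ)⁻¹ * ∑ k ∈ Finset.range K, o' i k) ^ 2 =
        ((K : ℝ) ^ 2)⁻¹ * ∑ k ∈ Finset.range K, o' i k ^ 2 := by
      intro i
      rw [mul_pow, inv_pow]
      congr 1
      by_cases h : ∃ k ∈ Finset.range K,
          (Metric.closedBall (c i) (s i) ∩ closedRing w₀ (t k)).Nonempty
      · obtain ⟨k, hk, hne⟩ := h
        have h0 : ∀ j, j ≠ k → o' i j = 0 := fun j hjk =>
          if_neg fun hj => hjk (hmeet i j k hj hne)
        rw [Finset.sum_eq_single_of_mem k hk fun j _ hjk => h0 j hjk,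
          Finset.sum_eq_single_of_mem k hk fun j _ hjk => by rw [h0 j hjk]; ring]
      · push Not at h
        have h0 : ∀ j ∈ Finset.range K, o' i j = 0 := fun j hj =>
          if_neg (not_nonempty_iff_eq_empty.2 (h j hj))
        rw [Finset.sum_eq_zero h0, Finset.sum_eq_zero fun j hj => by rw [h0 j hj]; ring]
        ring
    have hscale : ∀ k, ∑ i ∈ S, o' i k ^ 2 ≤ 64 * C ^ 2 := by
      intro k
      classical
      have htk := htpos k
      have h1 := sum_min_sq_le hs hdisj htk
        (S.filter fun i => (Metric.closedBall (c i) (s i) ∩ closedRing w₀ (t k)).Nonempty)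
        fun i hi => (Finset.mem_filter.1 hi).2
      have h2 : ∀ i, o' i k ^ 2 =
          if (Metric.closedBall (c i) (s i) ∩ closedRing w₀ (t k)).Nonempty
            then 4 * C ^ 2 / t k ^ 2 * min (s i) (t k) ^ 2 else 0 := by
        intro i
        simp only [o']
        split_ifs
        · ring
        · ring
      simp only [h2]
      rw [← Finset.sum_filter, ← Finset.mul_sum]
      calc 4 * (C : ℝ) ^ 2 / t k ^ 2 * _ ≤ 4 * C ^ 2 / t k ^ 2 * (16 * t k ^ 2) :=
            mul_le_mul_of_nonneg_left h1 (by positivity)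
        _ = 64 * C ^ 2 := by
            field_simp
            ring
    simp only [hsq]
    rw [← Finset.mul_sum, Finset.sum_comm]
    calc ((K : ℝ) ^ 2)⁻¹ * ∑ k ∈ Finset.range K, ∑ i ∈ S, o' i k ^ 2
        ≤ ((K : ℝ) ^ 2)⁻¹ * ∑ k ∈ Finset.range K, 64 * (C : ℝ) ^ 2 := by
          gcongr with k _
          exact hscale k
      _ = 64 * C ^ 2 / K := by
          rw [Finset.sum_const, Finset.card_range, nsmul_eq_mul]
          field_simp
      _ ≤ ε := hKε

end RiemannSphere

namespace RiemannSphere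

open Filter Set Topology MeasureTheory

/-! ### Dirichlet energy -/

/-- The Dirichlet energy does not increase under composition with an injective holomorphic map. -/
lemma lintegral_energy_comp_le {W : Set ℂ} (hW : IsOpen W) {G : ℂ → ℂ}
    (hG : DifferentiableOn ℂ G W) (hinj : InjOn G W) {U : ℂ → ℝ} (hU : ContDiff ℝ 1 U) :
    ∫⁻ ζ in W, ENNReal.ofReal (‖fderiv ℝ (fun ζ => U (G ζ)) ζ‖ ^ 2) ≤
      ∫⁻ w, ENNReal.ofReal (‖fderiv ℝ U w‖ ^ 2) := by
  have hder : ∀ ζ ∈ W, HasFDerivAt G ((fderiv ℂ G ζ).restrictScalars ℝ) ζ := fun ζ hζ =>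
    ((hG ζ hζ).differentiableAt (hW.mem_nhds hζ)).hasFDerivAt.restrictScalars ℝ
  have hdet : ∀ ζ, |((fderiv ℂ G ζ).restrictScalars ℝ : ℂ →L[ℝ] ℂ).det| = ‖deriv G ζ‖ ^ 2 := by
    intro ζ
    have h1 : fderiv ℂ G ζ = ContinuousLinearMap.toSpanSingleton ℂ (deriv G ζ) := by
      ext; simp
    simp [h1, ContinuousLinearMap.det, LinearMap.det_restrictScalars, Algebra.norm_complex_eq,
      Complex.normSq_eq_norm_sq]
  refine le_trans ?_ (setLIntegral_le_lintegral (G '' W) _)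
  -- The Jacobian determinant of a holomorphic map is `‖deriv G‖ ^ 2`, which matches the factor that
  -- the chain rule puts on the squared gradient.
  rw [lintegral_image_eq_lintegral_abs_det_fderiv_mul volume hW.measurableSet
    (fun ζ hζ => (hder ζ hζ).hasFDerivWithinAt) hinj]
  refine setLIntegral_mono' hW.measurableSet fun ζ hζ => ?_
  rw [hdet, ← ENNReal.ofReal_mul (by positivity), ← mul_pow]
  refine ENNReal.ofReal_le_ofReal (pow_le_pow_left₀ (norm_nonneg _) ?_ 2)
  have h2 : HasFDerivAt (fun ζ => U (G ζ))
      ((fderiv ℝ U (G ζ)).comp ((fderiv ℂ G ζ).restrictScalars ℝ)) ζ :=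
    ((hU.differentiable one_ne_zero _).hasFDerivAt).comp ζ (hder ζ hζ)
  rw [h2.fderiv, mul_comm]
  refine (ContinuousLinearMap.opNorm_comp_le _ _).trans ?_
  rw [ContinuousLinearMap.norm_restrictScalars, norm_deriv_eq_norm_fderiv]

/-- The energy of a function on an interval of length at most one is at least the square of its
variation. -/
lemma ofReal_sq_le_lintegral_deriv {f : ℝ → ℝ} {c d M : ℝ} (hcd : c < d) (hd : d - c ≤ 1)
    (hf : ContDiffOn ℝ 1 f (Ioo c d)) (hM : 0 ≤ M)
    (hvar : ∀ η > 0, ∀ᶠ y in 𝓝[>] c, ∀ᶠ y' in 𝓝[<] d, M - η ≤ |f y' - f y|) :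
    ENNReal.ofReal (M ^ 2) ≤ ∫⁻ y in Ioo c d, ENNReal.ofReal (‖deriv f y‖ ^ 2) := by
  have h1 : ENNReal.ofReal M ≤ ∫⁻ y in Ioo c d, ‖deriv f y‖ₑ := by
    refine ENNReal.le_of_forall_pos_le_add fun η hη _ => ?_
    have hη' : (0 : ℝ) < η := by exact_mod_cast hη
    obtain ⟨m, hm⟩ := exists_between hcd
    obtain ⟨y, hy, hyc⟩ := ((hvar η hη').and (Ioo_mem_nhdsGT hm.1)).exists
    obtain ⟨y', hy', hyd⟩ := (hy.and (Ioo_mem_nhdsLT hm.2)).exists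
    have hsub : Icc y y' ⊆ Ioo c d := fun t ht =>
      ⟨hyc.1.trans_le ht.1, ht.2.trans_lt hyd.2⟩
    have h2 := enorm_sub_le_lintegral_deriv_of_contDiffOn_Icc (hf.mono hsub)
      (hyc.2.trans hyd.1).le
    have h3 : ENNReal.ofReal (M - η) ≤ ∫⁻ y in Ioo c d, ‖deriv f y‖ₑ := by
      refine le_trans ?_ (h2.trans (lintegral_mono_set hsub))
      rw [Real.enorm_eq_ofReal_abs]
      exact ENNReal.ofReal_le_ofReal hy'
    calc ENNReal.ofReal M = ENNReal.ofReal (M - η + η) := by ring_nf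
      _ ≤ ENNReal.ofReal (M - η) + ENNReal.ofReal η := ENNReal.ofReal_add_le
      _ ≤ _ := by gcongr; simp
  -- In place of the Cauchy–Schwarz inequality, integrate `2 * M * a ≤ M ^ 2 + a ^ 2` over an
  -- interval of length at most one and cancel `M ^ 2`.
  have h2 : ENNReal.ofReal (2 * M) * ∫⁻ y in Ioo c d, ‖deriv f y‖ₑ ≤
      ENNReal.ofReal (M ^ 2) + ∫⁻ y in Ioo c d, ENNReal.ofReal (‖deriv f y‖ ^ 2) := by
    rw [← lintegral_const_mul _ (measurable_deriv f).enorm]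
    calc ∫⁻ y in Ioo c d, ENNReal.ofReal (2 * M) * ‖deriv f y‖ₑ
        ≤ ∫⁻ y in Ioo c d, (ENNReal.ofReal (M ^ 2) + ENNReal.ofReal (‖deriv f y‖ ^ 2)) := by
          refine lintegral_mono fun y => ?_
          rw [← ofReal_norm, ← ENNReal.ofReal_mul (by positivity),
            ← ENNReal.ofReal_add (by positivity) (by positivity)]
          exact ENNReal.ofReal_le_ofReal (two_mul_le_add_sq _ _)
      _ = ENNReal.ofReal (M ^ 2) * volume (Ioo c d) +
          ∫⁻ y in Ioo c d, ENNReal.ofReal (‖deriv f y‖ ^ 2) := by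
          rw [lintegral_add_left measurable_const, setLIntegral_const]
      _ ≤ _ := by
          gcongr
          refine mul_le_of_le_one_right' ?_
          rw [Real.volume_Ioo]
          exact ENNReal.ofReal_le_one.2 hd
  have h3 : ENNReal.ofReal (M ^ 2) + ENNReal.ofReal (M ^ 2) ≤
      ENNReal.ofReal (M ^ 2) + ∫⁻ y in Ioo c d, ENNReal.ofReal (‖deriv f y‖ ^ 2) := by
    refine le_trans ?_ (le_trans (mul_le_mul_right h1 _) h2)
    rw [← ENNReal.ofReal_add (by positivity) (by positivity),
      ← ENNReal.ofReal_mul (by positivity)]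
    exact ENNReal.ofReal_le_ofReal (by nlinarith)
  exact (ENNReal.add_le_add_iff_left ENNReal.ofReal_ne_top).1 h3

/-- The energy of a function on a rectangle of width one and height at most one is at least the
square of the difference of its boundary values on the two horizontal sides. -/
lemma ofReal_sq_le_lintegral_rectangle {v : ℂ → ℝ} {a c d M : ℝ} (hcd : c < d) (hd : d - c ≤ 1)
    (hv : ContDiffOn ℝ 1 v (Ioo a (a + 1) ×ℂ Ioo c d)) (hM : 0 ≤ M)
    (hvar : ∀ x ∈ Ioo a (a + 1), ∀ η > 0, ∀ᶠ y : ℝ in 𝓝[>] c, ∀ᶠ y' : ℝ in 𝓝[<] d,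
      M - η ≤ |v ⟨x, y'⟩ - v ⟨x, y⟩|) :
    ENNReal.ofReal (M ^ 2) ≤
      ∫⁻ ζ in Ioo a (a + 1) ×ℂ Ioo c d, ENNReal.ofReal (‖fderiv ℝ v ζ‖ ^ 2) := by
  have hopen : IsOpen (Ioo a (a + 1) ×ℂ Ioo c d) := isOpen_Ioo.reProdIm isOpen_Ioo
  have hmeas : Measurable fun ζ => ENNReal.ofReal (‖fderiv ℝ v ζ‖ ^ 2) :=
    ENNReal.measurable_ofReal.comp ((measurable_fderiv ℝ v).norm.pow_const 2)
  have h1 : ∫⁻ ζ in Ioo a (a + 1) ×ℂ Ioo c d, ENNReal.ofReal (‖fderiv ℝ v ζ‖ ^ 2) =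
      ∫⁻ p in Ioo a (a + 1) ×ˢ Ioo c d, ENNReal.ofReal (‖fderiv ℝ v ⟨p.1, p.2⟩‖ ^ 2)
        ∂(volume.prod volume) := by
    have := Complex.volume_preserving_equiv_real_prod.symm.setLIntegral_comp_preimage_emb
      (MeasurableEquiv.measurableEmbedding _)
      (fun ζ => ENNReal.ofReal (‖fderiv ℝ v ζ‖ ^ 2)) (Ioo a (a + 1) ×ℂ Ioo c d)
    rw [← this]
    rfl
  rw [h1, setLIntegral_prod _ (by
    refine Measurable.aemeasurable ?_
    exact hmeas.comp Complex.measurableEquivRealProd.symm.measurable)]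
  -- The width is one, so it suffices to bound the energy on each vertical line.
  have h2 : ENNReal.ofReal (M ^ 2) = ∫⁻ _ in Ioo a (a + 1), ENNReal.ofReal (M ^ 2) := by
    simp
  rw [h2]
  refine setLIntegral_mono' measurableSet_Ioo fun x hx => ?_
  have hline : ∀ y : ℝ, HasDerivAt (fun y : ℝ => (⟨x, y⟩ : ℂ)) Complex.I y := by
    intro y
    have : (fun y : ℝ => (⟨x, y⟩ : ℂ)) = fun y : ℝ => (x : ℂ) + (y : ℂ) * Complex.I := by
      ext y; exact (Complex.mk_eq_add_mul_I x y)
    rw [this]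
    simpa using ((Complex.ofRealCLM.hasDerivAt (x := y)).mul_const Complex.I).const_add (x : ℂ)
  have hmaps : MapsTo (fun y : ℝ => (⟨x, y⟩ : ℂ)) (Ioo c d) (Ioo a (a + 1) ×ℂ Ioo c d) :=
    fun y hy => ⟨hx, hy⟩
  have hlineC : ContDiff ℝ 1 (fun y : ℝ => (⟨x, y⟩ : ℂ)) := by
    have : (fun y : ℝ => (⟨x, y⟩ : ℂ)) = fun y : ℝ => (x : ℂ) + (y : ℂ) * Complex.I := by
      ext y; exact (Complex.mk_eq_add_mul_I x y)
    rw [this]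
    exact contDiff_const.add (Complex.ofRealCLM.contDiff.mul contDiff_const)
  have h3 := ofReal_sq_le_lintegral_deriv (f := fun y : ℝ => v ⟨x, y⟩) hcd hd
    (hv.comp hlineC.contDiffOn hmaps) hM (hvar x hx)
  refine h3.trans (setLIntegral_mono' measurableSet_Ioo fun y hy => ?_)
  refine ENNReal.ofReal_le_ofReal (pow_le_pow_left₀ (norm_nonneg _) ?_ 2)
  have h4 : HasFDerivAt v (fderiv ℝ v ⟨x, y⟩) ⟨x, y⟩ :=
    ((hv.differentiableOn one_ne_zero _ (hmaps hy)).differentiableAt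
      (hopen.mem_nhds (hmaps hy))).hasFDerivAt
  have h5 : HasDerivAt (fun y : ℝ => v ⟨x, y⟩) (fderiv ℝ v ⟨x, y⟩ Complex.I) y :=
    h4.comp_hasDerivAt y (hline y)
  rw [h5.deriv]
  simpa using (fderiv ℝ v ⟨x, y⟩).le_opNorm Complex.I

end RiemannSphere

namespace RiemannSphere

open Filter Set Topology MeasureTheory

/-! ### Pulling back a cut-off function -/

/-- The extension to the sphere of a function of compact support in the plane. -/
noncomputable def extendZero (U : ℂ → ℝ) : RiemannSphere → ℝ
  | OnePoint.some z => U z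
  | ∞ => 0

lemma extendZero_infty (U : ℂ → ℝ) : extendZero U ∞ = 0 := rfl

lemma extendZero_of_ne {U : ℂ → ℝ} {x : RiemannSphere} (hx : x ≠ ∞) :
    extendZero U x = U (affine x) := by
  conv_lhs => rw [← coe_affine hx]
  rfl

lemma eventually_extendZero_eq_zero {U : ℂ → ℝ} {w₀ : ℂ} {δ : ℝ}
    (hU0 : ∀ w, δ ≤ ‖w - w₀‖ → U w = 0) : ∀ᶠ x in 𝓝 (∞ : RiemannSphere), extendZero U x = 0 := by
  have h : IsOpen ((↑) '' Metric.closedBall w₀ δ : Set RiemannSphere)ᶜ :=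
    OnePoint.isOpen_compl_image_coe.2 ⟨Metric.isClosed_closedBall, isCompact_closedBall _ _⟩
  filter_upwards [h.mem_nhds (by simp)] with x hx
  by_cases hxi : x = ∞
  · rw [hxi, extendZero_infty]
  · rw [extendZero_of_ne hxi]
    refine hU0 _ (le_of_not_gt fun hlt => hx ⟨affine x, ?_, coe_affine hxi⟩)
    rw [mem_closedBall_iff_norm]
    exact hlt.le

lemma continuous_extendZero {U : ℂ → ℝ} (hU : Continuous U) {w₀ : ℂ} {δ : ℝ}
    (hU0 : ∀ w, δ ≤ ‖w - w₀‖ → U w = 0) : Continuous (extendZero U) := by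
  refine continuous_iff_continuousAt.2 fun x => ?_
  by_cases hx : x = ∞
  · subst hx
    have h : extendZero U =ᶠ[𝓝 ∞] fun _ => 0 := eventually_extendZero_eq_zero hU0
    exact continuousAt_const.congr h.symm
  · rw [← coe_affine hx, OnePoint.continuousAt_coe]
    exact hU.continuousAt

section Pullback

variable {W : Set ℂ} {g : ℂ → RiemannSphere} {U : ℂ → ℝ} {w₀ : ℂ} {δ : ℝ}

lemma isOpen_inter_ne_infty (hW : IsOpen W) (hg : ContinuousOn g W) :
    IsOpen (W ∩ g ⁻¹' {∞}ᶜ) :=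
  hg.isOpen_inter_preimage hW isOpen_compl_singleton

lemma eventuallyEq_extendZero_comp (hW : IsOpen W) (hg : ContinuousOn g W) {ζ : ℂ}
    (hζ : ζ ∈ W ∩ g ⁻¹' {∞}ᶜ) :
    (fun ζ => extendZero U (g ζ)) =ᶠ[𝓝 ζ] fun ζ => U (affine (g ζ)) := by
  filter_upwards [(isOpen_inter_ne_infty hW hg).mem_nhds hζ] with y hy
  exact extendZero_of_ne hy.2

lemma eventuallyEq_zero_extendZero_comp (hW : IsOpen W) (hg : ContinuousOn g W)
    (hU0 : ∀ w, δ ≤ ‖w - w₀‖ → U w = 0) {ζ : ℂ} (hζ : ζ ∈ W) (hpole : g ζ = ∞) :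
    (fun ζ => extendZero U (g ζ)) =ᶠ[𝓝 ζ] fun _ => 0 := by
  have h := (hg.continuousAt (hW.mem_nhds hζ)).tendsto
  rw [hpole] at h
  exact h.eventually (eventually_extendZero_eq_zero hU0)

/-- Near a pole of `g` the composition vanishes identically, as `U` has bounded support; elsewhere
`g` is holomorphic in the affine coordinate. -/
lemma contDiffOn_extendZero_comp (hW : IsOpen W) (hg : ContinuousOn g W)
    (hgd : ∀ ζ ∈ W, g ζ ≠ ∞ → DifferentiableAt ℂ (fun ζ => affine (g ζ)) ζ)
    (hU : ContDiff ℝ 1 U) (hU0 : ∀ w, δ ≤ ‖w - w₀‖ → U w = 0) :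
    ContDiffOn ℝ 1 (fun ζ => extendZero U (g ζ)) W := by
  intro ζ hζ
  refine ContDiffAt.contDiffWithinAt ?_
  by_cases hpole : g ζ = ∞
  · exact contDiffAt_const.congr_of_eventuallyEq
      (eventuallyEq_zero_extendZero_comp hW hg hU0 hζ hpole)
  · have hmem : ζ ∈ W ∩ g ⁻¹' {∞}ᶜ := ⟨hζ, hpole⟩
    have hG : DifferentiableOn ℂ (fun ζ => affine (g ζ)) (W ∩ g ⁻¹' {∞}ᶜ) := fun y hy =>
      (hgd y hy.1 hy.2).differentiableWithinAt
    have hGa : ContDiffAt ℂ 1 (fun ζ => affine (g ζ)) ζ :=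
      (hG.analyticAt ((isOpen_inter_ne_infty hW hg).mem_nhds hmem)).contDiffAt
    exact (hU.contDiffAt.comp ζ (hGa.restrict_scalars ℝ)).congr_of_eventuallyEq
      (eventuallyEq_extendZero_comp hW hg hmem)

/-- The poles contribute no energy, and off the poles `lintegral_energy_comp_le` applies. -/
lemma lintegral_energy_extendZero_comp_le (hW : IsOpen W) (hg : ContinuousOn g W)
    (hinj : InjOn g W) (hgd : ∀ ζ ∈ W, g ζ ≠ ∞ → DifferentiableAt ℂ (fun ζ => affine (g ζ)) ζ)
    (hU : ContDiff ℝ 1 U) (hU0 : ∀ w, δ ≤ ‖w - w₀‖ → U w = 0) :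
    ∫⁻ ζ in W, ENNReal.ofReal (‖fderiv ℝ (fun ζ => extendZero U (g ζ)) ζ‖ ^ 2) ≤
      ∫⁻ w, ENNReal.ofReal (‖fderiv ℝ U w‖ ^ 2) := by
  set W' := W ∩ g ⁻¹' {∞}ᶜ with hW'
  have hopen : IsOpen W' := isOpen_inter_ne_infty hW hg
  have h1 : ∫⁻ ζ in W', ENNReal.ofReal (‖fderiv ℝ (fun ζ => extendZero U (g ζ)) ζ‖ ^ 2) =
      ∫⁻ ζ in W', ENNReal.ofReal (‖fderiv ℝ (fun ζ => U (affine (g ζ))) ζ‖ ^ 2) :=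
    setLIntegral_congr_fun hopen.measurableSet fun ζ hζ => by
      simp only [(eventuallyEq_extendZero_comp hW hg hζ).fderiv_eq]
  have h2 : ∫⁻ ζ in W \ W', ENNReal.ofReal (‖fderiv ℝ (fun ζ => extendZero U (g ζ)) ζ‖ ^ 2) =
      0 := by
    rw [setLIntegral_congr_fun (hW.measurableSet.diff hopen.measurableSet)
      (g := fun _ => 0), lintegral_zero]
    intro ζ hζ
    have hpole : g ζ = ∞ := by
      by_contra h
      exact hζ.2 ⟨hζ.1, h⟩
    simp [(eventuallyEq_zero_extendZero_comp hW hg hU0 hζ.1 hpole).fderiv_eq]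
  rw [← inter_union_sdiff W W', inter_eq_right.2 inter_subset_left]
  refine (lintegral_union_le _ _ _).trans ?_
  rw [h1, h2, add_zero]
  refine lintegral_energy_comp_le hopen (G := fun ζ => affine (g ζ)) (fun y hy =>
    (hgd y hy.1 hy.2).differentiableWithinAt) (fun y hy y' hy' h => hinj hy.1 hy'.1 ?_) hU
  rw [← coe_affine hy.2, ← coe_affine hy'.2]
  exact congrArg _ h

end Pullback

/-! ### Averages over the levels of the binary tree -/

/-- Every node `j` has exactly the two children `2j` and `2j + 1`. -/
lemma sum_range_two_mul_div_two (g : ℕ → ℝ) (N : ℕ) :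
    ∑ k ∈ Finset.range (2 * N), g (k / 2) = 2 * ∑ j ∈ Finset.range N, g j := by
  induction N with
  | zero => simp
  | succ N ih =>
    rw [mul_add, mul_one, Finset.sum_range_succ, Finset.sum_range_succ, ih,
      Finset.sum_range_succ, Nat.mul_div_cancel_left _ two_pos,
      show (2 * N + 1) / 2 = N by omega]
    ring

/-- A function on the binary tree that has small energy on each level and vanishes at the root
cannot be one on a whole level. -/
lemma exists_ne_one_of_small_energy {m : ℕ → ℕ → ℝ} (h0 : m 0 0 = 0)
    (hm : ∀ n, ∑ k ∈ Finset.range (2 ^ (n + 1)), (m (n + 1) k - m n (k / 2)) ^ 2 ≤ 1 / 16)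
    (N : ℕ) : ∃ j < 2 ^ N, m N j ≠ 1 := by
  -- The average over level `n`. By Cauchy–Schwarz its increment to the next level is at most `1 /
  -- 4` times the square root of `2 ^ (-(n + 1))`.
  set A : ℕ → ℝ := fun n => (2 ^ n)⁻¹ * ∑ j ∈ Finset.range (2 ^ n), m n j with hA
  have hstep : ∀ n, |A (n + 1) - A n| ≤ 1 / 4 * (3 / 4) ^ (n + 1) := by
    intro n
    have h1 : A (n + 1) - A n =
        (2 ^ (n + 1))⁻¹ * ∑ k ∈ Finset.range (2 ^ (n + 1)), (m (n + 1) k - m n (k / 2)) := by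
      have h2 := sum_range_two_mul_div_two (m n) (2 ^ n)
      rw [← pow_succ'] at h2
      rw [Finset.sum_sub_distrib, h2, mul_sub, hA]
      simp only [pow_succ]
      field_simp
    refine abs_le_of_sq_le_sq ?_ (by positivity)
    have h3 := sq_sum_le_card_mul_sum_sq (s := Finset.range (2 ^ (n + 1)))
      (f := fun k => m (n + 1) k - m n (k / 2))
    rw [Finset.card_range] at h3
    push_cast at h3
    rw [h1, mul_pow]
    have hpow : (0 : ℝ) < 2 ^ (n + 1) := by positivity
    calc ((2 : ℝ) ^ (n + 1))⁻¹ ^ 2 *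
          (∑ k ∈ Finset.range (2 ^ (n + 1)), (m (n + 1) k - m n (k / 2))) ^ 2
        ≤ ((2 : ℝ) ^ (n + 1))⁻¹ ^ 2 * (2 ^ (n + 1) * (1 / 16)) := by
          gcongr
          exact h3.trans (by gcongr; exact hm n)
      _ = 1 / 16 * (1 / 2) ^ (n + 1) := by
          rw [one_div_pow]
          linear_combination (1 / 16 * ((2 : ℝ) ^ (n + 1))⁻¹) * mul_inv_cancel₀ hpow.ne'
      -- Replacing `1 / 2` by the larger perfect square `9 / 16` avoids irrational roots; the
      -- resulting geometric series still sums to `3 / 4 < 1`.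
      _ ≤ 1 / 16 * (9 / 16) ^ (n + 1) :=
          mul_le_mul_of_nonneg_left (pow_le_pow_left₀ (by norm_num) (by norm_num) _)
            (by norm_num)
      _ = (1 / 4 * (3 / 4) ^ (n + 1)) ^ 2 := by
          rw [mul_pow, ← pow_mul, mul_comm (n + 1) 2, pow_mul]
          norm_num
  have hbound : ∀ n, |A n| ≤ 3 / 4 * (1 - (3 / 4) ^ n) := by
    intro n
    induction n with
    | zero => simp [hA, h0]
    | succ n ih =>
      calc |A (n + 1)| = |(A (n + 1) - A n) + A n| := by ring_nf
        _ ≤ _ := (abs_add_le _ _).trans (add_le_add (hstep n) ih)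
        _ = _ := by ring
  by_contra! hcon
  have hone : A N = 1 := by
    simp only [hA]
    rw [Finset.sum_congr rfl fun j hj => hcon j (Finset.mem_range.1 hj)]
    simp
  have := hbound N
  rw [hone, abs_one] at this
  have : (0 : ℝ) < (3 / 4) ^ N := by positivity
  linarith

end RiemannSphere

namespace RiemannSphere

open Filter Set Topology MeasureTheory

/-! ### Rectangles between neighbouring slits -/

variable {L : ℝ}

/-- The part of a strip that the exponential function maps into the slit domain. -/
def logDomain (L : ℝ) : Set ℂ :=
  {ζ | 0 < ζ.im ∧ ζ.im < 1} ∩ (fun ζ => (Complex.exp ζ : RiemannSphere)) ⁻¹' slitDomain L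

/-- The rectangle between the logarithmic slits of the node `(n + 1, k)` and its parent
`(n, k / 2)`. -/
def treeRect (L : ℝ) (n k : ℕ) : Set ℂ :=
  Ioo (-L * (n + 1)) (-L * (n + 1) + 1) ×ℂ
    Ioo ((2 * k + 1 - (k % 2 : ℕ)) / 2 ^ (n + 2)) ((2 * k + 2 - (k % 2 : ℕ)) / 2 ^ (n + 2))

lemma isOpen_logDomain (hL : 0 < L) : IsOpen (logDomain L) :=
  ((isOpen_lt continuous_const Complex.continuous_im).inter
    (isOpen_lt Complex.continuous_im continuous_const)).inter
      ((isOpen_slitDomain hL).preimage (OnePoint.continuous_coe.comp Complex.continuous_exp))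

lemma measurableSet_treeRect (n k : ℕ) : MeasurableSet (treeRect L n k) :=
  (isOpen_Ioo.reProdIm isOpen_Ioo).measurableSet

/-- A level-`n` or level-`(n+1)` slit does not cross a rectangle. -/
lemma treeAngle_notMem_Ioo {n k n' j : ℕ} (hn : n' = n ∨ n' = n + 1) :
    treeAngle n' j ∉ Ioo ((2 * k + 1 - (k % 2 : ℕ)) / 2 ^ (n + 2) : ℝ)
      ((2 * k + 2 - (k % 2 : ℕ)) / 2 ^ (n + 2)) := by
  rintro ⟨h1, h2⟩
  -- Angles of both levels are integer multiples of `1 / 2 ^ (n + 2)`, and the interval lies between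
  -- two consecutive multiples.
  obtain ⟨i, hi⟩ : ∃ i : ℕ, treeAngle n' j = i / 2 ^ (n + 2) := by
    rcases hn with rfl | rfl
    · refine ⟨2 * (2 * j + 1), ?_⟩
      unfold treeAngle
      push_cast
      rw [pow_succ (2 : ℝ) (n' + 1)]
      field_simp
    · refine ⟨2 * j + 1, ?_⟩
      unfold treeAngle
      push_cast
      rfl
  rw [hi] at h1 h2
  have h3 := (div_lt_div_iff_of_pos_right (by positivity)).1 h1
  have h4 := (div_lt_div_iff_of_pos_right (by positivity)).1 h2
  have h5 : 2 * k + 1 < i + k % 2 := by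
    have : (2 * k + 1 : ℝ) < i + (k % 2 : ℕ) := by linarith
    exact_mod_cast this
  have h6 : i + k % 2 < 2 * k + 2 := by
    have : (i + (k % 2 : ℕ) : ℝ) < 2 * k + 2 := by linarith
    exact_mod_cast this
  omega

/-- The real parts exclude the slits of all levels other than `n` and `n + 1`; those two levels are
excluded by `treeAngle_notMem_Ioo`. -/
lemma treeRect_subset_logDomain (hL : 2 ≤ L) {n k : ℕ} (hk : k < 2 ^ (n + 1)) :
    treeRect L n k ⊆ logDomain L := by
  rintro ζ ⟨⟨hr1, hr2⟩, hi⟩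
  have hstrip : ζ ∈ {ζ : ℂ | 0 < ζ.im ∧ ζ.im < 1} := by
    have hmod : ((k % 2 : ℕ) : ℝ) ≤ 1 := by exact_mod_cast (by omega : k % 2 ≤ 1)
    have hk' : (2 * k + 2 - (k % 2 : ℕ) : ℝ) ≤ 2 ^ (n + 2) := by
      have h1 : 2 * k + 2 ≤ 2 ^ (n + 2) + k % 2 := by rw [pow_succ]; omega
      have h2 : (2 * k + 2 : ℝ) ≤ 2 ^ (n + 2) + (k % 2 : ℕ) := by exact_mod_cast h1
      linarith
    constructor
    · refine lt_of_le_of_lt (div_nonneg ?_ (by positivity)) hi.1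
      have : (0 : ℝ) ≤ k := by positivity
      linarith
    · exact hi.2.trans_le ((div_le_one (by positivity)).2 hk')
  refine ⟨hstrip, coe_mem_slitDomain.2 fun hmem => ?_⟩
  rcases mem_slitSet.1 hmem with h0 | ⟨⟨n', j⟩, hx, ζ', hζ', he⟩
  · exact Complex.exp_ne_zero _ h0
  · have : ζ' = ζ := injOn_exp_strip (logSlit_subset_strip hx hζ') hstrip he
    subst this
    obtain ⟨h1, h2, h3⟩ := hζ'
    simp only at h1 h2 h3
    refine treeAngle_notMem_Ioo (j := j) (n' := n') (n := n) (k := k) ?_ (h1 ▸ hi)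
    have h4 : n < n' + 1 := by
      by_contra! h
      have : (n' + 1 : ℝ) ≤ n := by exact_mod_cast h
      nlinarith
    have h5 : n' < n + 2 := by
      by_contra! h
      have : (n + 2 : ℝ) ≤ n' := by exact_mod_cast h
      nlinarith
    omega

/-- The vertical sides are different unit steps of the grid of mesh `1 / 2 ^ (n + 2)`. -/
lemma disjoint_treeRect {n k k' : ℕ} (h : k ≠ k') :
    Disjoint (treeRect L n k) (treeRect L n k') := by
  rw [disjoint_left]
  rintro ζ ⟨-, h1, h2⟩ ⟨-, h3, h4⟩
  have h5 := (div_lt_div_iff_of_pos_right (by positivity)).1 (h1.trans h4)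
  have h6 := (div_lt_div_iff_of_pos_right (by positivity)).1 (h3.trans h2)
  have h7 : 2 * k + 1 + k' % 2 < 2 * k' + 2 + k % 2 := by
    have : (2 * k + 1 + (k' % 2 : ℕ) : ℝ) < 2 * k' + 2 + (k % 2 : ℕ) := by linarith
    exact_mod_cast this
  have h8 : 2 * k' + 1 + k % 2 < 2 * k + 2 + k' % 2 := by
    have : (2 * k' + 1 + (k % 2 : ℕ) : ℝ) < 2 * k + 2 + (k' % 2 : ℕ) := by linarith
    exact_mod_cast this
  omega

section Energy

variable {v : ℂ → ℝ} {m o : ℕ × ℕ → ℝ}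

/-- The energy of `v` on a rectangle between two slits near which `v` is nearly constant. -/
lemma ofReal_sq_le_lintegral_of_sides (hv : ContDiffOn ℝ 1 v (logDomain L))
    (hside : ∀ x ∈ treeNodes, ∀ ζ ∈ logSlit L x, ∀ η > 0,
      ∀ᶠ ζ' in 𝓝[logDomain L] ζ, |v ζ' - m x| ≤ o x + η)
    {x y : ℕ × ℕ} (hx : x ∈ treeNodes) (hy : y ∈ treeNodes) {a c d : ℝ} (hcd : c < d)
    (hd : d - c ≤ 1) (hc : ∀ t ∈ Ioo a (a + 1), (⟨t, c⟩ : ℂ) ∈ logSlit L x)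
    (hd' : ∀ t ∈ Ioo a (a + 1), (⟨t, d⟩ : ℂ) ∈ logSlit L y)
    (hsub : Ioo a (a + 1) ×ℂ Ioo c d ⊆ logDomain L) :
    ENNReal.ofReal (max (|m x - m y| - o x - o y) 0 ^ 2) ≤
      ∫⁻ ζ in Ioo a (a + 1) ×ℂ Ioo c d, ENNReal.ofReal (‖fderiv ℝ v ζ‖ ^ 2) := by
  refine ofReal_sq_le_lintegral_rectangle hcd hd (hv.mono hsub) (le_max_right _ _)
    fun t ht η hη => ?_
  have hvert : Continuous fun y : ℝ => (⟨t, y⟩ : ℂ) := by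
    have : (fun y : ℝ => (⟨t, y⟩ : ℂ)) = fun y : ℝ => (t : ℂ) + (y : ℂ) * Complex.I := by
      ext y; exact Complex.mk_eq_add_mul_I t y
    rw [this]
    fun_prop
  -- Each horizontal side lies on a slit, and the vertical segment approaches it within the domain;
  -- so `hside` controls the one-sided boundary values.
  have h1 : Tendsto (fun y : ℝ => (⟨t, y⟩ : ℂ)) (𝓝[>] c) (𝓝[logDomain L] ⟨t, c⟩) :=
    tendsto_nhdsWithin_iff.2 ⟨(hvert.tendsto c).mono_left nhdsWithin_le_nhds,
      mem_of_superset (Ioo_mem_nhdsGT hcd) fun y hy => hsub ⟨ht, hy⟩⟩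
  have h2 : Tendsto (fun y : ℝ => (⟨t, y⟩ : ℂ)) (𝓝[<] d) (𝓝[logDomain L] ⟨t, d⟩) :=
    tendsto_nhdsWithin_iff.2 ⟨(hvert.tendsto d).mono_left nhdsWithin_le_nhds,
      mem_of_superset (Ioo_mem_nhdsLT hcd) fun y hy => hsub ⟨ht, hy⟩⟩
  filter_upwards [h1.eventually (hside x hx _ (hc t ht) (η / 2) (by positivity))] with s hs
  filter_upwards [h2.eventually (hside y hy _ (hd' t ht) (η / 2) (by positivity))] with s' hs'
  rw [tsub_le_iff_right, max_le_iff]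
  refine ⟨?_, by positivity⟩
  have h3 : |m x - m y| ≤ |v ⟨t, s⟩ - m x| + |v ⟨t, s'⟩ - v ⟨t, s⟩| + |v ⟨t, s'⟩ - m y| := by
    rw [abs_sub_comm (v ⟨t, s⟩), abs_sub_comm (v ⟨t, s'⟩) (v ⟨t, s⟩)]
    calc |m x - m y| = |(m x - v ⟨t, s⟩) + (v ⟨t, s⟩ - v ⟨t, s'⟩) + (v ⟨t, s'⟩ - m y)| := by
          ring_nf
      _ ≤ _ := abs_add_three _ _ _
  linarith

lemma ofReal_sq_le_lintegral_treeRect (hL : 2 ≤ L)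
    (hv : ContDiffOn ℝ 1 v (logDomain L))
    (hside : ∀ x ∈ treeNodes, ∀ ζ ∈ logSlit L x, ∀ η > 0,
      ∀ᶠ ζ' in 𝓝[logDomain L] ζ, |v ζ' - m x| ≤ o x + η)
    {n k : ℕ} (hk : k < 2 ^ (n + 1)) :
    ENNReal.ofReal (max (|m (n + 1, k) - m (n, k / 2)| - o (n + 1, k) - o (n, k / 2)) 0 ^ 2) ≤
      ∫⁻ ζ in treeRect L n k, ENNReal.ofReal (‖fderiv ℝ v ζ‖ ^ 2) := by
  have hchild : (n + 1, k) ∈ treeNodes := hk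
  have hparent : (n, k / 2) ∈ treeNodes := by
    show k / 2 < 2 ^ n
    rw [pow_succ] at hk
    omega
  have hsub := treeRect_subset_logDomain hL hk
  have hlt : ((2 * k + 1 - (k % 2 : ℕ)) / 2 ^ (n + 2) : ℝ) <
      (2 * k + 2 - (k % 2 : ℕ)) / 2 ^ (n + 2) :=
    (div_lt_div_iff_of_pos_right (by positivity)).2 (by linarith)
  have hle : ((2 * k + 2 - (k % 2 : ℕ)) / 2 ^ (n + 2) : ℝ) -
      (2 * k + 1 - (k % 2 : ℕ)) / 2 ^ (n + 2) ≤ 1 := by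
    rw [← sub_div, div_le_one (by positivity)]
    have : (1 : ℝ) ≤ 2 ^ (n + 2) := one_le_pow₀ (by norm_num)
    linarith
  have hmemc : ∀ t ∈ Ioo (-L * (n + 1)) (-L * (n + 1) + 1),
      (⟨t, treeAngle (n + 1) k⟩ : ℂ) ∈ logSlit L (n + 1, k) := by
    intro t ht
    refine ⟨rfl, ?_, ?_⟩ <;> push_cast <;> nlinarith [ht.1, ht.2]
  have hmemp : ∀ t ∈ Ioo (-L * (n + 1)) (-L * (n + 1) + 1),
      (⟨t, treeAngle n (k / 2)⟩ : ℂ) ∈ logSlit L (n, k / 2) := by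
    intro t ht
    refine ⟨rfl, ?_, ?_⟩ <;> simp only <;> nlinarith [ht.1, ht.2]
  -- An even child lies below its parent, an odd one above.
  rcases Nat.mod_two_eq_zero_or_one k with h0 | h1
  · have hc : ((2 * k + 1 - (k % 2 : ℕ)) / 2 ^ (n + 2) : ℝ) = treeAngle (n + 1) k := by
      simp [h0, treeAngle]
    have hd : ((2 * k + 2 - (k % 2 : ℕ)) / 2 ^ (n + 2) : ℝ) = treeAngle n (k / 2) := by
      have : (k : ℝ) = 2 * (k / 2 : ℕ) := by exact_mod_cast (by omega : k = 2 * (k / 2))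
      rw [treeAngle, h0, Nat.cast_zero, sub_zero, this, pow_succ (2 : ℝ) (n + 1)]
      field_simp
    unfold treeRect at hsub ⊢
    rw [hc, hd] at hsub hlt hle ⊢
    exact ofReal_sq_le_lintegral_of_sides hv hside hchild hparent hlt hle hmemc hmemp hsub
  · have hc : ((2 * k + 1 - (k % 2 : ℕ)) / 2 ^ (n + 2) : ℝ) = treeAngle n (k / 2) := by
      have : (k : ℝ) = 2 * (k / 2 : ℕ) + 1 := by
        exact_mod_cast (by omega : k = 2 * (k / 2) + 1)
      rw [treeAngle, h1, Nat.cast_one, add_sub_cancel_right, pow_succ (2 : ℝ) (n + 1), this]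
      field_simp
    have hd : ((2 * k + 2 - (k % 2 : ℕ)) / 2 ^ (n + 2) : ℝ) = treeAngle (n + 1) k := by
      rw [treeAngle, h1, Nat.cast_one]
      ring_nf
    unfold treeRect at hsub ⊢
    rw [hc, hd] at hsub hlt hle ⊢
    have := ofReal_sq_le_lintegral_of_sides hv hside hparent hchild hlt hle hmemp hmemc hsub
    rwa [abs_sub_comm, sub_right_comm] at this

/-- The tree energy of the values `m` on one level is controlled by the energy of `v` and by the
oscillations `o`. -/
lemma sum_sq_sub_le (hL : 2 ≤ L) (hv : ContDiffOn ℝ 1 v (logDomain L))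
    (hside : ∀ x ∈ treeNodes, ∀ ζ ∈ logSlit L x, ∀ η > 0,
      ∀ᶠ ζ' in 𝓝[logDomain L] ζ, |v ζ' - m x| ≤ o x + η) {ε : ℝ} (hε : 0 ≤ ε)
    (henergy : ∫⁻ ζ in logDomain L, ENNReal.ofReal (‖fderiv ℝ v ζ‖ ^ 2) ≤ ENNReal.ofReal ε)
    (hsum : ∀ S : Finset (ℕ × ℕ), ∑ x ∈ S, o x ^ 2 ≤ ε) (n : ℕ) :
    ∑ k ∈ Finset.range (2 ^ (n + 1)), (m (n + 1, k) - m (n, k / 2)) ^ 2 ≤ 12 * ε := by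
  set M : ℕ → ℝ := fun k =>
    max (|m (n + 1, k) - m (n, k / 2)| - o (n + 1, k) - o (n, k / 2)) 0 with hM
  have hlevel : ∀ n N : ℕ, ∑ k ∈ Finset.range N, o (n, k) ^ 2 ≤ ε := by
    intro n N
    have := hsum ((Finset.range N).map ⟨fun k => (n, k), fun a b h => by simpa using h⟩)
    rw [Finset.sum_map] at this
    exact this
  have hrect : ∑ k ∈ Finset.range (2 ^ (n + 1)), M k ^ 2 ≤ ε := by
    rw [← ENNReal.ofReal_le_ofReal_iff hε, ENNReal.ofReal_sum_of_nonneg fun _ _ => sq_nonneg _]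
    refine le_trans ?_ henergy
    calc ∑ k ∈ Finset.range (2 ^ (n + 1)), ENNReal.ofReal (M k ^ 2)
        ≤ ∑ k ∈ Finset.range (2 ^ (n + 1)),
            ∫⁻ ζ in treeRect L n k, ENNReal.ofReal (‖fderiv ℝ v ζ‖ ^ 2) :=
          Finset.sum_le_sum fun k hk =>
            ofReal_sq_le_lintegral_treeRect hL hv hside (Finset.mem_range.1 hk)
      _ = ∫⁻ ζ in ⋃ k ∈ Finset.range (2 ^ (n + 1)), treeRect L n k,
            ENNReal.ofReal (‖fderiv ℝ v ζ‖ ^ 2) :=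
          (lintegral_biUnion_finset (fun k _ k' _ h => disjoint_treeRect h)
            (fun k _ => measurableSet_treeRect n k) _).symm
      _ ≤ _ := lintegral_mono_set (iUnion₂_subset fun k hk =>
          treeRect_subset_logDomain hL (Finset.mem_range.1 hk))
  have hterm : ∀ k, (m (n + 1, k) - m (n, k / 2)) ^ 2 ≤
      3 * (o (n + 1, k) ^ 2 + o (n, k / 2) ^ 2 + M k ^ 2) := by
    intro k
    have h1 : |m (n + 1, k) - m (n, k / 2)| ≤ o (n + 1, k) + o (n, k / 2) + M k := by
      have := le_max_left (|m (n + 1, k) - m (n, k / 2)| - o (n + 1, k) - o (n, k / 2)) 0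
      simp only [hM]
      linarith
    rw [← sq_abs (m (n + 1, k) - m (n, k / 2))]
    refine (pow_le_pow_left₀ (abs_nonneg _) h1 2).trans ?_
    nlinarith [sq_nonneg (o (n + 1, k) - o (n, k / 2)), sq_nonneg (o (n + 1, k) - M k),
      sq_nonneg (o (n, k / 2) - M k)]
  refine (Finset.sum_le_sum fun k _ => hterm k).trans ?_
  -- Each parent is counted for both children, so the three sums are at most `ε`, `2 * ε` and `ε`;
  -- with the factor `3` this gives `12 * ε`.
  rw [← Finset.mul_sum, Finset.sum_add_distrib, Finset.sum_add_distrib, pow_succ' 2 n,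
    sum_range_two_mul_div_two (fun j => o (n, j) ^ 2), ← pow_succ' 2 n]
  linarith [hlevel (n + 1) (2 ^ (n + 1)), hlevel n (2 ^ n)]

end Energy

end RiemannSphere

namespace RiemannSphere

open Filter Set Topology MeasureTheory

/-! ### Round images of the slits -/

variable {L : ℝ}

/-- A cut-off function on the sphere around `w₀`, of small energy and of small total oscillation
on a family of disjoint closed disks and points that shrink to `w₀`. -/
lemma exists_cutoff_sphere {B : ℕ × ℕ → Set RiemannSphere} {w₀ : ℂ}
    (hround : ∀ x ∈ treeNodes, ∞ ∉ B x → ∃ (c : ℂ) (s : ℝ), 0 ≤ s ∧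
      B x = (fun z : ℂ => (z : RiemannSphere)) '' Metric.closedBall c s)
    (hdisj : ∀ x ∈ treeNodes, ∀ y ∈ treeNodes, x ≠ y → Disjoint (B x) (B y))
    (hclosed : IsClosed (B (0, 0))) (hw₀ : (w₀ : RiemannSphere) ∉ B (0, 0))
    (hshrink : ∀ V ∈ 𝓝 (w₀ : RiemannSphere), ∃ W ∈ 𝓝 (w₀ : RiemannSphere),
      ∀ x ∈ treeNodes, (B x ∩ W).Nonempty → B x ⊆ V) {ε : ℝ} (hε : 0 < ε) :
    ∃ (U : ℂ → ℝ) (δ : ℝ), ContDiff ℝ 1 U ∧ (∀ w, δ ≤ ‖w - w₀‖ → U w = 0) ∧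
      ∫⁻ w, ENNReal.ofReal (‖fderiv ℝ U w‖ ^ 2) ≤ ENNReal.ofReal ε ∧
      (∀ᶠ p in 𝓝 (w₀ : RiemannSphere), extendZero U p = 1) ∧
      (∀ p ∈ B (0, 0), extendZero U p = 0) ∧
      ∃ o : ℕ × ℕ → ℝ, (∀ x ∈ treeNodes, ∀ p ∈ B x, ∀ q ∈ B x, |extendZero U p - extendZero U q| ≤ o x) ∧
        ∀ S : Finset (ℕ × ℕ), ∑ x ∈ S, o x ^ 2 ≤ ε := by
  classical
  have hcoe : Tendsto (fun z : ℂ => (z : RiemannSphere)) (𝓝 w₀) (𝓝 (w₀ : RiemannSphere)) :=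
    OnePoint.continuous_coe.tendsto _
  have hcoeinj : Function.Injective (fun z : ℂ => (z : RiemannSphere)) :=
    OnePoint.coe_injective
  choose! c s hs hB using hround
  -- a radius that separates `w₀` from the root and from the disk around `∞`
  obtain ⟨δ, hδ, hδroot, hδinf⟩ : ∃ δ > 0,
      (∀ w ∈ Metric.ball w₀ δ, (w : RiemannSphere) ∉ B (0, 0)) ∧
      ∀ x ∈ treeNodes, ∞ ∈ B x → ∀ w ∈ Metric.ball w₀ δ, (w : RiemannSphere) ∉ B x := by
    obtain ⟨W, hW, hWsub⟩ := hshrink {∞}ᶜ (isOpen_compl_singleton.mem_nhds (OnePoint.coe_ne_infty _))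
    obtain ⟨δ, hδ, hball⟩ := Metric.mem_nhds_iff.1
      (hcoe (inter_mem hW (hclosed.isOpen_compl.mem_nhds hw₀)))
    exact ⟨δ, hδ, fun w hw => (hball hw).2, fun x hx hinf w hw hwB =>
      hWsub x hx ⟨w, hwB, (hball hw).1⟩ hinf rfl⟩
  let P : ℕ × ℕ → Prop := fun x => x ∈ treeNodes ∧ ∞ ∉ B x
  obtain ⟨U, hU, hone, hzero, hen, o, ho, hosc, hsum⟩ := exists_cutoff
    (ι := {x // P x}) (c := fun i => c i.1) (s := fun i => s i.1)
    (fun i => hs _ i.2.1 i.2.2)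
    (by
      intro i j hij
      have h := hdisj i.1 i.2.1 j.1 j.2.1 fun h => hij (Subtype.ext h)
      rw [hB _ i.2.1 i.2.2, hB _ j.2.1 j.2.2] at h
      exact (disjoint_image_iff hcoeinj).1 h)
    (w₀ := w₀)
    (by
      intro r hr
      obtain ⟨W, hW, hWsub⟩ := hshrink
        ((fun z : ℂ => (z : RiemannSphere)) '' Metric.ball w₀ r)
        ((OnePoint.isOpenEmbedding_coe.isOpenMap _ Metric.isOpen_ball).mem_nhds
          ⟨w₀, Metric.mem_ball_self hr, rfl⟩)
      obtain ⟨r', hr', hball⟩ := Metric.mem_nhds_iff.1 (hcoe hW)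
      refine ⟨r', hr', fun i hi => ?_⟩
      obtain ⟨w, hw, hwb⟩ := hi
      have h := hWsub i.1 i.2.1 ⟨w, by rw [hB _ i.2.1 i.2.2]; exact ⟨w, hw, rfl⟩, hball hwb⟩
      rw [hB _ i.2.1 i.2.2] at h
      exact (image_subset_image_iff hcoeinj).1 h)
    hδ hε
  have hvanish : ∀ (A : Set RiemannSphere), (∀ w ∈ Metric.ball w₀ δ, (w : RiemannSphere) ∉ A) →
      ∀ p ∈ A, extendZero U p = 0 := by
    intro A hA p hp
    by_cases hpi : p = ∞
    · rw [hpi, extendZero_infty]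
    · rw [extendZero_of_ne hpi]
      refine hzero _ (le_of_not_gt fun hlt => hA (affine p) ?_ ?_)
      · rwa [mem_ball_iff_norm]
      · rwa [coe_affine hpi]
  refine ⟨U, δ, hU, hzero, hen, ?_, hvanish _ hδroot,
    fun x => if h : P x then o ⟨x, h⟩ else 0, fun x hx p hp q hq => ?_,
    fun S => ?_⟩
  · rw [OnePoint.nhds_coe_eq, eventually_map]
    exact hone
  · dsimp only
    -- The set containing `∞`, if there is one, need not be a Euclidean disk, but it lies where the
    -- cut-off function vanishes.
    by_cases hinf : ∞ ∈ B x
    · rw [hvanish _ (hδinf x hx hinf) p hp, hvanish _ (hδinf x hx hinf) q hq, sub_zero, abs_zero]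
      split_ifs
      · exact ho _
      · exact le_rfl
    · rw [dif_pos ⟨hx, hinf⟩]
      rw [hB x hx hinf] at hp hq
      obtain ⟨p', hp', rfl⟩ := hp
      obtain ⟨q', hq', rfl⟩ := hq
      exact hosc ⟨x, hx, hinf⟩ p' hp' q' hq'
  · calc ∑ x ∈ S, (if h : P x then o ⟨x, h⟩ else 0) ^ 2
        = ∑ x ∈ S with P x, (if h : P x then o ⟨x, h⟩ else 0) ^ 2 := by
          rw [Finset.sum_filter]
          refine Finset.sum_congr rfl fun x _ => ?_
          split_ifs <;> simp
      _ = ∑ i ∈ S.subtype P, o i ^ 2 := by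
          rw [← Finset.sum_subtype_eq_sum_filter]
          refine Finset.sum_congr rfl fun i _ => ?_
          rw [dif_pos i.2]
      _ ≤ ε := hsum _

/-- An injective holomorphic map of the slit domain cannot blow up all slits to disjoint closed
disks and points that shrink to a point. -/
theorem false_of_round_images (hL : 2 ≤ L) {h : RiemannSphere → RiemannSphere}
    (hcont : ContinuousOn h (slitDomain L)) (hinj : InjOn h (slitDomain L))
    (hdiff : ∀ z : ℂ, (z : RiemannSphere) ∈ slitDomain L → h z ≠ ∞ →
      DifferentiableAt ℂ (fun ζ : ℂ => affine (h ζ)) z)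
    {B : ℕ × ℕ → Set RiemannSphere} {w₀ : ℂ}
    (hround : ∀ x ∈ treeNodes, ∞ ∉ B x → ∃ (c : ℂ) (s : ℝ), 0 ≤ s ∧
      B x = (fun z : ℂ => (z : RiemannSphere)) '' Metric.closedBall c s)
    (hne : ∀ x ∈ treeNodes, (B x).Nonempty)
    (hdisj : ∀ x ∈ treeNodes, ∀ y ∈ treeNodes, x ≠ y → Disjoint (B x) (B y))
    (hclosed : IsClosed (B (0, 0))) (hw₀ : (w₀ : RiemannSphere) ∉ B (0, 0))
    (hshrink : ∀ V ∈ 𝓝 (w₀ : RiemannSphere), ∃ W ∈ 𝓝 (w₀ : RiemannSphere),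
      ∀ x ∈ treeNodes, (B x ∩ W).Nonempty → B x ⊆ V)
    (hlevel : ∀ V ∈ 𝓝 (w₀ : RiemannSphere), ∃ n, ∀ j < 2 ^ n, B (n, j) ⊆ V)
    (hcluster : ∀ x ∈ treeNodes, ∀ V, IsOpen V → B x ⊆ V → ∀ z ∈ sphereSlit L x,
      ∀ᶠ z' in 𝓝[slitDomain L] z, h z' ∈ V) : False := by
  have hL0 : 0 < L := by linarith
  -- `12 / 192` is the bound `1 / 16` of `exists_ne_one_of_small_energy`.
  obtain ⟨U, δ, hU, hU0, hen, hone, hroot, o, hosc, hsum⟩ :=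
    exists_cutoff_sphere hround hdisj hclosed hw₀ hshrink (ε := 1 / 192) (by norm_num)
  set u := extendZero U with hu
  have hucont : Continuous u := continuous_extendZero hU.continuous hU0
  choose! b hb using hne
  let g : ℂ → RiemannSphere := fun ζ => h (Complex.exp ζ : ℂ)
  have hexp : Continuous fun ζ : ℂ => (Complex.exp ζ : RiemannSphere) :=
    OnePoint.continuous_coe.comp Complex.continuous_exp
  have hg : ContinuousOn g (logDomain L) :=
    hcont.comp hexp.continuousOn fun ζ hζ => hζ.2
  have hginj : InjOn g (logDomain L) := fun ζ hζ ζ' hζ' he =>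
    injOn_exp_strip hζ.1 hζ'.1 (OnePoint.coe_injective (hinj hζ.2 hζ'.2 he))
  have hgd : ∀ ζ ∈ logDomain L, g ζ ≠ ∞ → DifferentiableAt ℂ (fun ζ => affine (g ζ)) ζ :=
    fun ζ hζ hpole => (hdiff _ hζ.2 hpole).comp ζ Complex.differentiableAt_exp
  have hv := contDiffOn_extendZero_comp (isOpen_logDomain hL0) hg hgd hU hU0
  have henergy := (lintegral_energy_extendZero_comp_le (isOpen_logDomain hL0) hg hginj hgd hU
    hU0).trans hen
  -- Near a slit the map takes values near `B x`, where `u` differs from its value at the chosen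
  -- point `b x` by at most `o x`.
  have hside : ∀ x ∈ treeNodes, ∀ ζ ∈ logSlit L x, ∀ η > 0,
      ∀ᶠ ζ' in 𝓝[logDomain L] ζ, |u (g ζ') - u (b x)| ≤ o x + η := by
    intro x hx ζ hζ η hη
    have hV : IsOpen {p | |u p - u (b x)| < o x + η} :=
      isOpen_lt (hucont.sub continuous_const).abs continuous_const
    have h1 := hcluster x hx _ hV (fun p hp => (hosc x hx p hp _ (hb x hx)).trans_lt (by linarith))
      (Complex.exp ζ) ⟨_, ⟨ζ, hζ, rfl⟩, rfl⟩
    have h2 : Tendsto (fun ζ : ℂ => (Complex.exp ζ : RiemannSphere)) (𝓝[logDomain L] ζ)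
        (𝓝[slitDomain L] (Complex.exp ζ : RiemannSphere)) :=
      tendsto_nhdsWithin_iff.2 ⟨(hexp.tendsto ζ).mono_left nhdsWithin_le_nhds,
        mem_of_superset self_mem_nhdsWithin fun ζ' hζ' => hζ'.2⟩
    filter_upwards [h2.eventually h1] with ζ' hζ'
    exact le_of_lt hζ'
  obtain ⟨N, hN⟩ := hlevel _ hone
  obtain ⟨j, hj, hj1⟩ := exists_ne_one_of_small_energy (m := fun n j => u (b (n, j)))
    (hroot _ (hb (0, 0) (by simp [treeNodes])))
    (fun n => (sum_sq_sub_le (m := fun x => u (b x)) hL hv hside (by norm_num) henergy hsum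
      n).trans (by norm_num)) N
  exact hj1 (hN j hj (hb (N, j) hj))

end RiemannSphere

namespace RiemannSphere

open Filter Set Topology

/-! ### The image of the point component -/

variable {L : ℝ} {D : Set RiemannSphere} {f : OpenPartialHomeomorph RiemannSphere RiemannSphere}
  {F : DecompositionSpace (slitDomain L) ≃ₜ DecompositionSpace D}

lemma affine_inversion_eq_inv (x : RiemannSphere) : affine (inversion x) = (affine x)⁻¹ := by
  induction x using OnePoint.rec with
  | infty => simp [affine, inversion]
  | coe z => exact affine_inversion z

lemma coord_infty (w : RiemannSphere) : coord ∞ w = affine (inversion w) := by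
  induction w using OnePoint.rec with
  | infty => simp [affine, inversion, coord]
  | coe z => exact (affine_inversion z).symm

/-- At a pole of `f` this is differentiability in the chart at `∞`; elsewhere it is the reciprocal
of a nonvanishing function. -/
lemma differentiableAt_affine_inversion {f : RiemannSphere → RiemannSphere} {z : ℂ}
    (hf : ComplexDifferentiableAt f z) (hz : inversion (f z) ≠ ∞) :
    DifferentiableAt ℂ (fun ζ : ℂ => affine (inversion (f ζ))) z := by
  by_cases h : f z = ∞
  · unfold ComplexDifferentiableAt at hf
    rw [h] at hf
    simp only [coord_infty] at hf
    exact hf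
  · have h0 : affine (f z) ≠ 0 := by
      intro h0
      rw [← coe_affine h, h0, inversion_zero] at hz
      exact hz rfl
    simp only [affine_inversion_eq_inv]
    exact (differentiableAt_affine hf h).inv h0

/-- Classes of points of `D` already come from points of the domain, and the extension is injective.
-/
lemma notMem_of_quotMap_eq (hf : IsConformalHomeo f (slitDomain L) D) (hF : IsHatExtension f F)
    {y p : RiemannSphere} (hy : y ∉ slitDomain L) (hp : quotMap D p = F (quotMap _ y)) : p ∉ D := by
  intro hpD
  rw [← hf.2.1] at hpD
  have hz : f.symm p ∈ slitDomain L := hf.1 ▸ f.map_target hpD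
  have h := hF _ hz
  rw [f.right_inv hpD, hp] at h
  have := (quotMap_eq_iff_of_mem hz).1 (F.injective h).symm
  exact hy (this ▸ hz)

lemma hatFiber_mem_complComponents (hf : IsConformalHomeo f (slitDomain L) D)
    (hF : IsHatExtension f F) {y : RiemannSphere} (hy : y ∉ slitDomain L) :
    quotMap D ⁻¹' {F (quotMap _ y)} ∈ complComponents D := by
  obtain ⟨p, hp⟩ := surjective_quotMap (D := D) (F (quotMap _ y))
  have hpD := notMem_of_quotMap_eq hf hF hy hp
  exact ⟨p, hpD, by rw [← hp, preimage_quotMap_singleton hpD]⟩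

lemma quotMap_eq_of_mem_sphereSlit (hL : 0 < L) {x : ℕ × ℕ} (hx : x ∈ treeNodes)
    {z w : RiemannSphere} (hz : z ∈ sphereSlit L x) (hw : w ∈ sphereSlit L x) :
    quotMap (slitDomain L) z = quotMap (slitDomain L) w := by
  refine quotMap_eq_iff.2 (Or.inr ⟨sphereSlit_subset_compl hx hw, ?_⟩)
  rwa [connectedComponentIn_of_mem_sphereSlit hL hx hw]

lemma mem_sphereSlit_of_quotMap_eq (hL : 0 < L) {x : ℕ × ℕ} (hx : x ∈ treeNodes)
    {z w : RiemannSphere} (hw : w ∈ sphereSlit L x)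
    (h : quotMap (slitDomain L) z = quotMap (slitDomain L) w) : z ∈ sphereSlit L x := by
  rcases quotMap_eq_iff.1 h with rfl | ⟨-, hz⟩
  · exact hw
  · rwa [connectedComponentIn_of_mem_sphereSlit hL hx hw] at hz

/-- The point component of the slit domain is not mapped to a point, up to a conformal change of
coordinates `ψ` after which the point is finite. -/
lemma hatFiber_ne_singleton (hL : 2 ≤ L) (hD : IsCircleDomain D)
    (hf : IsConformalHomeo f (slitDomain L) D) (hF : IsHatExtension f F)
    (ψ : RiemannSphere ≃ₜ RiemannSphere) (hψ : ∀ A, IsDisk A → IsDisk (ψ '' A))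
    (hdiff : ∀ z : ℂ, (z : RiemannSphere) ∈ slitDomain L → ψ (f z) ≠ ∞ →
      DifferentiableAt ℂ (fun ζ : ℂ => affine (ψ (f ζ))) z)
    {p : RiemannSphere} {w₀ : ℂ} (hp : ψ p = w₀) :
    quotMap D ⁻¹' {F (quotMap _ ((0 : ℂ) : RiemannSphere))} ≠ {p} := by
  intro hfiber
  have hL0 : 0 < L := by linarith
  have hDo : IsOpen D := hD.1.1
  have := t2Space_decompositionSpace hDo
  choose z hz using fun x => nonempty_slit hL0.le (L := L) x
  have hzs : ∀ x, (z x : RiemannSphere) ∈ sphereSlit L x := fun x => mem_image_of_mem _ (hz x)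
  set K : ℕ × ℕ → Set RiemannSphere := fun x => quotMap D ⁻¹' {F (quotMap _ (z x))} with hK
  have hKcomp : ∀ x ∈ treeNodes, K x ∈ complComponents D := fun x hx =>
    hatFiber_mem_complComponents hf hF (sphereSlit_subset_compl hx (hzs x))
  have hKF : ∀ x, ∀ q ∈ K x, quotMap D q = F (quotMap _ (z x)) := fun x q hq => hq
  have hFcont : Continuous fun y => F (quotMap (slitDomain L) y) :=
    F.continuous.comp continuous_quotMap
  -- upper semicontinuity at the point component
  have husc : ∀ V ∈ 𝓝 (w₀ : RiemannSphere), ∃ O : Set (DecompositionSpace D), IsOpen O ∧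
      F (quotMap _ ((0 : ℂ) : RiemannSphere)) ∈ O ∧ quotMap D ⁻¹' O ⊆ ψ ⁻¹' V := by
    intro V hV
    have hV' : ψ ⁻¹' V ∈ 𝓝 p := ψ.continuous.continuousAt.preimage_mem_nhds (by rwa [hp])
    obtain ⟨O, hO, hsub, hmem⟩ := exists_isOpen_preimage_subset hDo (isOpen_interior (s := ψ ⁻¹' V))
    refine ⟨O, hO, hmem _ ?_, hsub.trans interior_subset⟩
    rw [hfiber, singleton_subset_iff]
    exact mem_interior_iff_mem_nhds.2 hV'
  refine false_of_round_images hL (h := fun y => ψ (f y)) (B := fun x => ψ '' K x) (w₀ := w₀)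
    ?_ ?_ hdiff ?_ ?_ ?_ ?_ ?_ ?_ ?_ ?_
  · exact ψ.continuous.comp_continuousOn (hf.1 ▸ f.continuousOn)
  · exact fun y hy y' hy' h => f.injOn (hf.1 ▸ hy) (hf.1 ▸ hy') (ψ.injective h)
  · intro x hx hinf
    -- Nontrivial components are disks by hypothesis; a point is a closed ball of radius `0`.
    by_cases hpos : 0 < sphDiam (K x)
    · exact (hψ _ (hD.2 _ ⟨hKcomp x hx, hpos⟩)).eq_closedBall hinf
    · obtain ⟨q, hq⟩ := surjective_quotMap (D := D) (F (quotMap _ (z x)))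
      have hKq : K x = {q} :=
        eq_singleton_iff_unique_mem.2 ⟨hq, fun y hy => eq_of_not_sphDiam_pos hpos hy hq⟩
      rw [hKq, image_singleton] at hinf ⊢
      have hne : ψ q ≠ ∞ := fun h => hinf h.symm
      exact ⟨affine (ψ q), 0, le_rfl, by
        rw [Metric.closedBall_zero, image_singleton, coe_affine hne]⟩
  · intro x _
    obtain ⟨q, hq⟩ := surjective_quotMap (D := D) (F (quotMap _ (z x)))
    exact ⟨ψ q, q, hq, rfl⟩
  · intro x hx y hy hxy
    rw [disjoint_image_iff ψ.injective, disjoint_left]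
    intro q hqx hqy
    have h : quotMap (slitDomain L) (z x) = quotMap (slitDomain L) (z y) :=
      F.injective ((hKF x q hqx).symm.trans (hKF y q hqy))
    have h' := mem_sphereSlit_of_quotMap_eq hL0 hy (hzs y) h
    exact hxy (eq_of_mem_slit hx hy (hz x) (OnePoint.coe_injective.mem_set_image.1 h'))
  · exact ψ.isClosedMap _ (isClosed_singleton.preimage continuous_quotMap)
  · rintro ⟨q, hq, hqw⟩
    have hqp : q = p := ψ.injective (hqw.trans hp.symm)
    have hp0 : quotMap D p = F (quotMap _ ((0 : ℂ) : RiemannSphere)) := by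
      have : p ∈ quotMap D ⁻¹' {F (quotMap _ ((0 : ℂ) : RiemannSphere))} := by
        rw [hfiber]; rfl
      exact this
    have h := F.injective (hp0.symm.trans (hKF _ p (hqp ▸ hq)))
    exact zero_notMem_sphereSlit _
      (mem_sphereSlit_of_quotMap_eq hL0 (by simp [treeNodes]) (hzs (0, 0)) h)
  · intro V hV
    obtain ⟨O, hO, h0, hsub⟩ := husc V hV
    refine ⟨ψ.symm ⁻¹' (quotMap D ⁻¹' O), ?_, ?_⟩
    · refine ((hO.preimage continuous_quotMap).preimage ψ.symm.continuous).mem_nhds ?_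
      have : p ∈ quotMap D ⁻¹' {F (quotMap _ ((0 : ℂ) : RiemannSphere))} := by
        rw [hfiber]; rfl
      rw [← hp, mem_preimage, ψ.symm_apply_apply, mem_preimage, this]
      exact h0
    · rintro x hx ⟨_, ⟨q, hq, rfl⟩, hqO⟩
      rw [mem_preimage, ψ.symm_apply_apply, mem_preimage, hKF x q hq] at hqO
      rintro _ ⟨q', hq', rfl⟩
      refine hsub ?_
      rw [mem_preimage, hKF x q' hq']
      exact hqO
  · intro V hV
    obtain ⟨O, hO, h0, hsub⟩ := husc V hV
    -- The slits of high level lie in a small disk around `0`, so by continuity their classes are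
    -- sent close to the class of `p`.
    have h1 : (fun y : ℂ => F (quotMap (slitDomain L) y)) ⁻¹' O ∈ 𝓝 (0 : ℂ) :=
      ((hO.preimage hFcont).preimage OnePoint.continuous_coe).mem_nhds h0
    obtain ⟨r, hr, hball⟩ := Metric.mem_nhds_iff.1 h1
    obtain ⟨n, hn⟩ := ((tendsto_exp_level hL0).eventually (gt_mem_nhds hr)).exists
    refine ⟨n, fun j _ => ?_⟩
    rintro _ ⟨q, hq, rfl⟩
    refine hsub ?_
    rw [mem_preimage, hKF _ q hq]
    exact hball (mem_ball_zero_iff.2 ((norm_le_of_mem_slit (hz (n, j))).trans_lt hn))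
  · intro x hx V hV hsubV y hy
    obtain ⟨O, hO, hsub, hmem⟩ := exists_isOpen_preimage_subset hDo (hV.preimage ψ.continuous)
    have h0 : F (quotMap _ y) ∈ O := by
      rw [quotMap_eq_of_mem_sphereSlit hL0 hx hy (hzs x)]
      exact hmem _ (image_subset_iff.1 hsubV)
    filter_upwards [self_mem_nhdsWithin,
      mem_nhdsWithin_of_mem_nhds ((hO.preimage hFcont).mem_nhds h0)] with y' hy' hyO
    refine hsub ?_
    rw [mem_preimage, ← hF y' hy']
    exact hyO

/-- The point component `{0}` of the slit domain becomes a nontrivial component under every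
conformal map onto a circle domain. -/
theorem hatImage_zero_mem_nontrivialComponents (hL : 2 ≤ L) (hD : IsCircleDomain D)
    (hf : IsConformalHomeo f (slitDomain L) D) (hF : IsHatExtension f F) :
    hatImage F {((0 : ℂ) : RiemannSphere)} ∈ nontrivialComponents D := by
  have heq : hatImage F {((0 : ℂ) : RiemannSphere)} =
      quotMap D ⁻¹' {F (quotMap _ ((0 : ℂ) : RiemannSphere))} := by
    simp only [hatImage, image_singleton]
  rw [heq]
  refine ⟨hatFiber_mem_complComponents hf hF zero_notMem_slitDomain, ?_⟩
  by_contra hpos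
  obtain ⟨p, hp⟩ := surjective_quotMap (D := D) (F (quotMap _ ((0 : ℂ) : RiemannSphere)))
  have hsingle : quotMap D ⁻¹' {F (quotMap _ ((0 : ℂ) : RiemannSphere))} = {p} :=
    eq_singleton_iff_unique_mem.2 ⟨hp, fun y hy => eq_of_not_sphDiam_pos hpos hy hp⟩
  -- The cut-off function lives in the plane, so a point at `∞` is first moved to `0` by the
  -- inversion.
  by_cases hpi : p = ∞
  · exact hatFiber_ne_singleton hL hD hf hF inversionHomeomorph (fun A hA => hA.image_inversion)
      (fun z hz hne => differentiableAt_affine_inversion (hf.2.2 _ hz) hne) (w₀ := 0)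
      (by rw [hpi]; exact inversion_infty) hsingle
  · exact hatFiber_ne_singleton hL hD hf hF (Homeomorph.refl _) (fun A hA => by simpa using hA)
      (fun z hz hne => differentiableAt_affine (hf.2.2 _ hz) hne) (coe_affine hpi).symm hsingle

end RiemannSphere

/-! ### The main theorem. -/

theorem theorem1p4 (α : ℝ) (hα : 0 < α) :
    ∃ Ω : Set RiemannSphere,
      RiemannSphere.IsEllDomain α Ω ∧
      {((0 : ℂ) : RiemannSphere)} ∈ RiemannSphere.pointComponents Ω ∧
      ∀ (D : Set RiemannSphere) (f : OpenPartialHomeomorph RiemannSphere RiemannSphere),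
        RiemannSphere.IsCircleDomain D → RiemannSphere.IsConformalHomeo f Ω D →
          (∃ F : RiemannSphere.DecompositionSpace Ω ≃ₜ RiemannSphere.DecompositionSpace D,
            RiemannSphere.IsHatExtension f F) ∧
          ∀ F : RiemannSphere.DecompositionSpace Ω ≃ₜ RiemannSphere.DecompositionSpace D,
            RiemannSphere.IsHatExtension f F →
              RiemannSphere.hatImage F {((0 : ℂ) : RiemannSphere)} ∈
                RiemannSphere.nontrivialComponents D := by
  -- With `L = 2 + α⁻¹` the first summand leaves room for the rectangles, and the second gives `α *
  -- L ≥ 1` for summability.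
  have hL : 2 ≤ 2 + α⁻¹ := by
    have := inv_pos.2 hα
    linarith
  have hL0 : 0 < 2 + α⁻¹ := by linarith
  have hLα : 1 ≤ α * (2 + α⁻¹) := by
    rw [mul_add, mul_inv_cancel₀ hα.ne']
    linarith
  exact ⟨RiemannSphere.slitDomain (2 + α⁻¹),
    RiemannSphere.isEllDomain_slitDomain hα hL0 hLα,
    RiemannSphere.zero_mem_pointComponents_slitDomain hL0,
    fun D f hD hf => ⟨RiemannSphere.exists_isHatExtension hL0 hf, fun F hF =>
      RiemannSphere.hatImage_zero_mem_nontrivialComponents hL hD hf hF⟩⟩
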